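/- Fix $d\ge 2$, $T>0$ and $e>0$. Let $\mathcal P(\mathbb R^d)$ be the set of Borel probability measures on $\mathbb R^d$ with the weak topology, and let $\mathcal P_e$ be the set of $\pi\in\mathcal P(\mathbb R^d)$ with $\int v\,d\pi=0$ and $\int \tfrac12|v|^2\,d\pi\le e$. Let $\mathscr M$ be the set of finite positive Borel measures $Q$ on $[0,T]\times\mathbb R^{2d}\times\mathbb R^{2d}$, with points written $(t,(v,v_*),(v',v'_*))$, that are invariant under relabelling of the two particles, i.e. under $(t,v,v_*,v',v_*')\mapsto(t,v_*,v,v_*',v')$. (Measures invariant under each of the exchanges $v\leftrightarrow v_*$ and $v'\leftrightarrow v'_*$ separately are included.) Let $\mathscr S$ be the set of pairs $(P,Q)$ with $P=(P_t)_{t\in[0,T]}\in C([0,T];\mathcal P(\mathbb R^d))$ and $Q\in\mathscr M$ that satisfy the balance equation $$P_T(\phi_T)-P_0(\phi_0)-\int_0^T P_t(\partial_t\phi_t)\,dt=\int\big[\phi_t(v')+\phi_t(v'_*)-\phi_t(v)-\phi_t(v_*)\big]\,Q(dt,dv,dv_*,dv',dv'_*)$$ for every bounded continuous $\phi:[0,T]\times\mathbb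 R^d\to\mathbb R$ with a bounded continuous time derivative $\partial_t\phi$. Let $\mathscr S_e$ be the set of $(P,Q)\in\mathscr S$ with $P_t\in\mathcal P_e$ for all $t\in[0,T]$. For $P\in C([0,T];\mathcal P(\mathbb R^d))$ put $$Q^{P\otimes P}(dt,dv,dv_*,dv',dv'_*)=dt\,\tfrac12P_t(dv)P_t(dv_*)\int_{S^{d-1}}d\omega\,\tfrac12|(v-v_*)\cdot\omega|\,\delta_{v-((v-v_*)\cdot\omega)\omega}(dv')\,\delta_{v_*+((v-v_*)\cdot\omega)\omega}(dv'_*),$$ where $d\omega$ is the surface measure on the unit sphere, and let $\Upsilon(t,v,v_*,v',v'_*)=(t,v',v'_*,v,v_*)$. A pair $(P,Q)\in\mathscr S$ is a measure-flux solution of the homogeneous Boltzmann equation (with hard-sphere kernel) if $Q=Q^{P\otimes P}$. For $\pi\in\mathcal P_e$ let $\mathcal H(\pi)=\int\log f\,d\pi\in(-\infty,+\infty]$ if $\pi$ has a density $f$ with respect to Lebesgue measure, and $\mathcal H(\pi)=+\infty$ otherwise. For finite positive measures $V,W$ on the same space let $\mathrm E(V|W)=\int\log\frac{dV}{dW}\,dV-V(1)+W(1)\in[0,+\infty]$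 if $V\ll W$, and $\mathrm E(V|W)=+\infty$ otherwise. Then for every $(P,Q)\in\mathscr S_e$ with $\mathcal H(P_0)<+\infty$, $$\mathcal H(P_T)+\mathrm E\big(Q\,\big|\,Q^{P\otimes P}\big)+\mathrm E\big(Q\,\big|\,\Upsilon_\#Q^{P\otimes P}\big)\;\ge\;\mathcal H(P_0).$$ Moreover, equality holds if and only if $Q=Q^{P\otimes P}$, that is, if and only if $(P,Q)$ is a measure-flux solution of the homogeneous Boltzmann equation. -/

import Mathlib

open MeasureTheory ProbabilityTheory Set
open scoped ENNReal BoundedContinuousFunction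

noncomputable section

namespace HBE

/-- Velocity space `ℝ^d` with the Euclidean norm. -/
abbrev Vel (d : ℕ) : Type := EuclideanSpace ℝ (Fin d)

/-- The time interval `[0,T]`. -/
abbrev Time (T : ℝ) : Type := Icc (0 : ℝ) T

/-- The space `[0,T] × ℝ^{2d} × ℝ^{2d}` of points `(t, (v, v_*), (v', v'_*))`. -/
abbrev FluxSpace (d : ℕ) (T : ℝ) : Type := Time T × (Vel d × Vel d) × (Vel d × Vel d)

/-- Lebesgue measure `dt` on `[0,T]`. -/
def timeMeasure (T : ℝ) : Measure (Time T) := (volume : Measure ℝ).comap Subtype.val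

instance (T : ℝ) : IsFiniteMeasure (timeMeasure T) := by
  constructor
  rw [timeMeasure, (MeasurableEmbedding.subtype_coe measurableSet_Icc).comap_apply]
  exact lt_of_le_of_lt (measure_mono (Subtype.coe_image_subset _ _)) (measure_Icc_lt_top (a := (0 : ℝ)) (b := T))

/-- Weakly continuous paths `C([0,T]; 𝒫(ℝ^d))`, where `ProbabilityMeasure` carries the topology of
weak convergence. -/
abbrev ProbPath (d : ℕ) (T : ℝ) : Type := C(Time T, ProbabilityMeasure (Vel d))

/-- The time `0` as a point of `[0,T]`. -/
def t0 {T : ℝ} (hT : 0 ≤ T) : Time T := ⟨0, left_mem_Icc.2 hT⟩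

/-- The time `T` as a point of `[0,T]`. -/
def t1 {T : ℝ} (hT : 0 ≤ T) : Time T := ⟨T, right_mem_Icc.2 hT⟩

/-- The entropy `ℋ(π) = ∫ dπ log f`, `dπ = f dℓ`, with values in `[-∞, +∞]` (positive part minus
negative part), and `+∞` if `π` is not absolutely continuous. For a probability with finite second
moment the negative part has a finite integral, so that the value is in `(-∞, +∞]` and no
indeterminate difference occurs. -/
def entropyH {d : ℕ} (π : ProbabilityMeasure (Vel d)) : EReal :=
  open scoped Classical in
  if (π : Measure (Vel d)) ≪ volume then
    ((∫⁻ v, ENNReal.ofReal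
        (Real.log ((π : Measure (Vel d)).rnDeriv volume v).toReal) ∂(π : Measure (Vel d)) : ℝ≥0∞)
        : EReal)
    - ((∫⁻ v, ENNReal.ofReal
        (-Real.log ((π : Measure (Vel d)).rnDeriv volume v).toReal) ∂(π : Measure (Vel d)) : ℝ≥0∞)
        : EReal)
  else ⊤

/-- The relative entropy `E(V | W) = ∫ dV log (dV/dW) - V(X) + W(X)` of finite positive measures,
equal to `+∞` if `V` is not absolutely continuous with respect to `W` (or if the integral is
`+∞`); this is Mathlib's Kullback-Leibler divergence, here with values in `EReal`. -/
def relE {X : Type*} [MeasurableSpace X] (V W : Measure X) : EReal :=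
  (InformationTheory.klDiv V W : ℝ≥0∞)

/-- The set `𝒫_e` of probabilities with mean zero and `∫ |v|²/2 dπ ≤ e`. -/
def MeanZeroEnergyLE {d : ℕ} (e : ℝ) (π : ProbabilityMeasure (Vel d)) : Prop :=
  Integrable (fun v : Vel d => ‖v‖ ^ 2 / 2) (π : Measure (Vel d)) ∧
  ∫ v, ‖v‖ ^ 2 / 2 ∂(π : Measure (Vel d)) ≤ e ∧
  ∫ v, v ∂(π : Measure (Vel d)) = 0

/-- The outgoing velocities `v' = v - ((v-v_*)·ω) ω`, `v'_* = v_* + ((v-v_*)·ω) ω`. -/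
def collide {d : ℕ} (p : Vel d × Vel d) (ω : Vel d) : Vel d × Vel d :=
  (p.1 - inner ℝ (p.1 - p.2) ω • ω, p.2 + inner ℝ (p.1 - p.2) ω • ω)

/-- The hard-sphere kernel `B(w, ω) = |w · ω| / 2`. -/
def hardSphere {d : ℕ} (w ω : Vel d) : ℝ := |inner ℝ w ω| / 2

/-- A weakly continuous path of probabilities is measurable in time. -/
theorem measurable_path {d : ℕ} {T : ℝ} (P : ProbPath d T) :
    Measurable fun t : Time T => (P t : Measure (Vel d)) := by
  refine Measurable.measure_of_isPiSystem_of_isProbabilityMeasure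
    (S := {s : Set (Vel d) | IsOpen s}) BorelSpace.measurable_eq isPiSystem_isOpen ?_
  intro s hs
  refine LowerSemicontinuous.measurable ?_
  intro t
  refine lowerSemicontinuousAt_iff_le_liminf.2 ?_
  exact ProbabilityMeasure.le_liminf_measure_open_of_tendsto (P.continuous.tendsto t) hs

/-- The path `P` as a Markov kernel `t ↦ P_t`. -/
def pathKernel {d : ℕ} {T : ℝ} (P : ProbPath d T) : Kernel (Time T) (Vel d) where
  toFun t := (P t : Measure (Vel d))
  measurable' := measurable_path P

instance {d : ℕ} {T : ℝ} (P : ProbPath d T) : IsMarkovKernel (pathKernel P) :=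
  ⟨fun t => inferInstanceAs (IsProbabilityMeasure (P t : Measure (Vel d)))⟩

/-- The measure `Q^{P⊗P}`, i.e. the law of `(t, (v, v_*), (v', v'_*))` under
`dt ½ P_t(dv) P_t(dv_*) B(v - v_*, ω) dω`, where `dω` is the surface measure on the unit sphere and
`(v', v'_*)` are the velocities after the collision with parameter `ω`. -/
def fluxPP {d : ℕ} {T : ℝ} (P : ProbPath d T) : Measure (FluxSpace d T) :=
  (((timeMeasure T ⊗ₘ (pathKernel P ×ₖ pathKernel P)).prod
      (volume : Measure (Vel d)).toSphere).withDensity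
    (fun x : (Time T × (Vel d × Vel d)) × Metric.sphere (0 : Vel d) 1 =>
      ENNReal.ofReal (1 / 2 * hardSphere (x.1.2.1 - x.1.2.2) (x.2 : Vel d)))).map
    (fun x : (Time T × (Vel d × Vel d)) × Metric.sphere (0 : Vel d) 1 =>
      (x.1.1, x.1.2, collide x.1.2 (x.2 : Vel d)))

/-- The map `Υ` exchanging incoming and outgoing velocities. -/
def exchange {d : ℕ} {T : ℝ} (x : FluxSpace d T) : FluxSpace d T := (x.1, x.2.2, x.2.1)

/-- Relabelling of the two colliding particles: `v ↔ v_*` and `v' ↔ v'_*` simultaneously. -/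
def relabel {d : ℕ} {T : ℝ} (x : FluxSpace d T) : FluxSpace d T :=
  (x.1, x.2.1.swap, x.2.2.swap)

/-- The set `ℳ` of fluxes: finite measures invariant under relabelling of the two particles.
(The flux of a solution has this joint symmetry in every dimension; it is invariant under the
separate exchanges `v ↔ v_*` and `v' ↔ v'_*` only for `d = 3`.) -/
def IsFlux {d : ℕ} {T : ℝ} (Q : FiniteMeasure (FluxSpace d T)) : Prop :=
  (Q : Measure (FluxSpace d T)).map relabel = Q

/-- Invariance under the two separate exchanges `v ↔ v_*` and `v' ↔ v'_*` is a special case. -/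
theorem IsFlux.of_separate {d : ℕ} {T : ℝ} (Q : FiniteMeasure (FluxSpace d T))
    (hin : (Q : Measure (FluxSpace d T)).map (fun x => (x.1, x.2.1.swap, x.2.2)) = Q)
    (hout : (Q : Measure (FluxSpace d T)).map (fun x => (x.1, x.2.1, x.2.2.swap)) = Q) :
    IsFlux Q := by
  have h := Measure.map_map (μ := (Q : Measure (FluxSpace d T)))
    (g := fun x : FluxSpace d T => (x.1, x.2.1, x.2.2.swap))
    (f := fun x : FluxSpace d T => (x.1, x.2.1.swap, x.2.2)) (by fun_prop) (by fun_prop)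
  rw [hin, hout] at h
  exact h.symm

/-- `φ` is a bounded continuous test function on `[0,T] × ℝ^d`, differentiable in `t` with the
bounded continuous time derivative `ψ = ∂_t φ` (one-sided at the endpoints). -/
def IsTimeDeriv {d : ℕ} {T : ℝ} (hT : 0 ≤ T) (φ ψ : (Time T × Vel d) →ᵇ ℝ) : Prop :=
  ∀ (t : Time T) (v : Vel d),
    HasDerivWithinAt (fun s : ℝ => φ (projIcc 0 T hT s, v)) (ψ (t, v)) (Icc 0 T) (t : ℝ)

/-- `∇̄φ = φ_t(v') + φ_t(v'_*) - φ_t(v) - φ_t(v_*)`. -/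
def collisionGrad {d : ℕ} {T : ℝ} (φ : (Time T × Vel d) →ᵇ ℝ) (x : FluxSpace d T) : ℝ :=
  φ (x.1, x.2.2.1) + φ (x.1, x.2.2.2) - φ (x.1, x.2.1.1) - φ (x.1, x.2.1.2)

/-- The balance equation
`P_T(φ_T) - P_0(φ_0) - ∫_0^T P_t(∂_t φ_t) dt = Q(∇̄φ)` for all test functions. -/
def Balance {d : ℕ} {T : ℝ} (hT : 0 ≤ T) (P : ProbPath d T) (Q : FiniteMeasure (FluxSpace d T)) :
    Prop :=
  ∀ φ ψ : (Time T × Vel d) →ᵇ ℝ, IsTimeDeriv hT φ ψ →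
    ∫ v, φ (t1 hT, v) ∂(P (t1 hT) : Measure (Vel d))
      - ∫ v, φ (t0 hT, v) ∂(P (t0 hT) : Measure (Vel d))
      - ∫ t : Time T, ∫ v, ψ (t, v) ∂(P t : Measure (Vel d)) ∂(timeMeasure T)
    = ∫ x, collisionGrad φ x ∂(Q : Measure (FluxSpace d T))

/-- The set `𝒮` of measure-flux pairs. -/
def MeasureFlux {d : ℕ} {T : ℝ} (hT : 0 ≤ T) (P : ProbPath d T) (Q : FiniteMeasure (FluxSpace d T)) :
    Prop :=
  IsFlux Q ∧ Balance hT P Q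

/-- The set `𝒮_e` of measure-flux pairs with `P_t ∈ 𝒫_e` for every `t ∈ [0,T]`. -/
def MeasureFluxLE {d : ℕ} {T : ℝ} (hT : 0 ≤ T) (e : ℝ) (P : ProbPath d T)
    (Q : FiniteMeasure (FluxSpace d T)) : Prop :=
  MeasureFlux hT P Q ∧ ∀ t, MeanZeroEnergyLE e (P t)

/-- Measure-flux solutions of the homogeneous Boltzmann equation: `(P,Q) ∈ 𝒮`, `Q = Q^{P⊗P}`. -/
def IsMeasureFluxSolution {d : ℕ} {T : ℝ} (hT : 0 ≤ T) (P : ProbPath d T)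
    (Q : FiniteMeasure (FluxSpace d T)) : Prop :=
  MeasureFlux hT P Q ∧ (Q : Measure (FluxSpace d T)) = fluxPP P

end HBE

end

set_option linter.unusedSectionVars false

namespace HBE

open Filter Topology InformationTheory

/-! ### Gibbs (Donsker–Varadhan) variational formula for the relative entropy of finite measures -/

section DonskerVaradhan

variable {X : Type*} [MeasurableSpace X] {μ ν : Measure X}

/-! Write R for the flux `fluxPP P` and R' for its image under `exchange`. Formally, if P_t has
density f_t, the balance equation tested with log f gives H(P_T) - H(P_0) = ∫ ∇̄ log f dQ, and
exp(∇̄ log f) = f'f'_*/(f f_*) is the density of R' with respect to R, because the collision is an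
involution that preserves Lebesgue measure and the kernel. The Gibbs inequality for R' tested with
-∇̄ log f then gives H(P_0) ≤ H(P_T) + E(Q|R') (`weightEntropy_le_add_klDiv`), since the exponential
term is just the mass of R'. Adding E(Q|R) ≥ 0 proves the inequality, and equality with a finite
value forces E(Q|R) = 0, that is Q = R. Conversely, if Q = R, the elementary bound a ≤ exp(a + Φ) -
1 - Φ with a = ∇̄ log f, integrated against R, gives H(P_T) - H(P_0) ≤ ∫ exp Φ dR' - R(1) - ∫ Φ dR
for every bounded continuous Φ. The supremum over Φ turns this into H(P_T) + E(R|R') ≤ H(P_0)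
(`weightEntropy_add_klDiv_le`), which meets the first inequality.

Since f need be neither positive, smooth nor even defined at intermediate times, log f is replaced
by `pot`: the Gaussian average, at scale τ², of the logarithm of `reg`, which is the mollified
density plus τ² times a polynomial weight. Three facts make τ → 0 possible. (1) The regularized
entropy has an exact chain rule (`regEntropy_sub_eq`). Convexity bounds each time increment from
both sides, by the potential at its left and at its right endpoint, and the two Riemann sums have
the same limit. The logarithm of `reg` grows only like log(1 + |v|), and this is integrable for Q as
soon as E(Q|R') is finite, because R' integrates 1 + |v|. (2) The regularized entropy is at most H +
O(τ²) (`regEntropy_le`) and is asymptotically bounded below by each Gibbs functional whose supremum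
is H (`exists_le_regEntropy`). (3) The exponential moment of the regularized collisional gradient
against R is at most the formal value plus O(τ) (`exists_integral_exp_potGrad_le`). A pair of
Gaussians is invariant under collisions, so the gradient of `pot` is a Gaussian average of the
logarithm of the collision ratio. Jensen takes the exponential inside, and what remains is to
commute mollification with the unbounded kernel (`lintegral_kernel_gauss_le`). The tails of this
commutator are absorbed by the added weight. -/

theorem mul_sub_exp_add_one_le_klFun {r : ℝ} (hr : 0 ≤ r) (a : ℝ) :
    r * a - Real.exp a + 1 ≤ klFun r := by
  rw [klFun_apply]
  rcases hr.eq_or_lt with rfl | hr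
  · have := Real.exp_pos a
    simp; linarith
  -- With b = a - log r the claim is r (1 + b) ≤ r exp b. This is Young's inequality for the
  -- conjugate pair `klFun` and exp - 1.
  · have h1 : Real.exp a = r * Real.exp (a - Real.log r) := by
      rw [Real.exp_sub, Real.exp_log hr]; field_simp
    have h2 := Real.add_one_le_exp (a - Real.log r)
    have h3 := mul_le_mul_of_nonneg_left h2 hr.le
    rw [h1]; nlinarith

/-- Young's inequality bounds the density times f by `klFun` of the density plus exp f, both
integrable for ν. It is used with f = log(1 + |v|), so a first moment of ν becomes a logarithmic
moment of μ. -/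
theorem integrable_of_integrable_exp [IsFiniteMeasure μ] [IsFiniteMeasure ν]
    (hkl : klDiv μ ν ≠ ⊤) {f : X → ℝ} (hf : Measurable f) (h0 : ∀ x, 0 ≤ f x)
    (he : Integrable (fun x => Real.exp (f x)) ν) : Integrable f μ := by
  obtain ⟨hac, hint⟩ := klDiv_ne_top_iff.1 hkl
  rw [← integrable_rnDeriv_smul_iff hac]
  have hk := (integrable_klFun_rnDeriv_iff hac).2 hint
  refine (hk.add he).mono' (by fun_prop) (ae_of_all _ fun x => ?_)
  have := mul_sub_exp_add_one_le_klFun (ENNReal.toReal_nonneg (a := μ.rnDeriv ν x)) (f x)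
  rw [smul_eq_mul, Real.norm_of_nonneg (mul_nonneg ENNReal.toReal_nonneg (h0 x))]
  simp only [Pi.add_apply]
  linarith

/-- Gibbs variational inequality for the Kullback–Leibler divergence of finite measures. -/
theorem integral_le_toReal_klDiv_add [IsFiniteMeasure μ] [IsFiniteMeasure ν]
    (hkl : klDiv μ ν ≠ ⊤) {f : X → ℝ} (hf : Integrable f μ)
    (he : Integrable (fun x => Real.exp (f x)) ν) :
    ∫ x, f x ∂μ ≤ (klDiv μ ν).toReal + ∫ x, Real.exp (f x) ∂ν - ν.real univ := by
  obtain ⟨hac, hint⟩ := klDiv_ne_top_iff.1 hkl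
  have hk := (integrable_klFun_rnDeriv_iff hac).2 hint
  rw [toReal_klDiv_eq_integral_klFun hac, ← integral_rnDeriv_smul hac]
  have h1 : ν.real univ = ∫ _, (1 : ℝ) ∂ν := by simp
  rw [h1, ← integral_add hk he, ← integral_sub (f := fun x => klFun (μ.rnDeriv ν x).toReal + Real.exp (f x))
    (hk.add he) (integrable_const _)]
  refine integral_mono ((integrable_rnDeriv_smul_iff hac).2 hf)
    ((hk.add he).sub (integrable_const _)) fun x => ?_
  have := mul_sub_exp_add_one_le_klFun (ENNReal.toReal_nonneg (a := μ.rnDeriv ν x)) (f x)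
  simp only [smul_eq_mul]
  linarith

/-- Bounded continuous functions are dense in L¹(μ + ν), and exp is Lipschitz with constant exp K on
[-K, K], so an L¹ error η moves the functional by at most (1 + exp K) η. -/
theorem variational_bound_of_boundedContinuous [TopologicalSpace X] [NormalSpace X] [BorelSpace X]
    [IsFiniteMeasure μ] [IsFiniteMeasure ν] [(μ + ν).WeaklyRegular] {c : ℝ}
    (h : ∀ Φ : X →ᵇ ℝ, ∫ x, Φ x ∂μ - ∫ x, Real.exp (Φ x) ∂ν ≤ c)
    {f : X → ℝ} (hf : Measurable f) {K : ℝ} (hK : ∀ x, |f x| ≤ K) :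
    ∫ x, f x ∂μ - ∫ x, Real.exp (f x) ∂ν ≤ c := by
  have bint : ∀ (m : Measure X) [IsFiniteMeasure m] (u : X → ℝ), Measurable u →
      (∀ x, |u x| ≤ K) → Integrable u m := fun m _ u hu hb =>
    Integrable.of_bound hu.aestronglyMeasurable K (ae_of_all _ fun x => by simpa using hb x)
  have eint : ∀ (m : Measure X) [IsFiniteMeasure m] (u : X → ℝ), Measurable u →
      (∀ x, |u x| ≤ K) → Integrable (fun x => Real.exp (u x)) m := fun m _ u hu hb =>
    Integrable.of_bound hu.exp.aestronglyMeasurable (Real.exp K) (ae_of_all _ fun x => by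
      rw [Real.norm_of_nonneg (Real.exp_pos _).le]
      exact Real.exp_le_exp.2 ((le_abs_self _).trans (hb x)))
  have key : ∀ η : ℝ, 0 < η →
      ∫ x, f x ∂μ - ∫ x, Real.exp (f x) ∂ν ≤ c + (1 + Real.exp K) * η := by
    intro η hη
    obtain ⟨g, hg, -⟩ := (bint (μ + ν) f hf hK).exists_boundedContinuous_integral_sub_le hη
    -- Clamping to [-K, K] is 1-Lipschitz and fixes f, so it does not increase the distance to f.
    let Φ : X →ᵇ ℝ := BoundedContinuousFunction.mkOfBound
      ⟨fun x => max (-K) (min K (g x)), by fun_prop⟩ (2 * |K|) (by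
        intro x y
        simp only [ContinuousMap.coe_mk, Real.dist_eq]
        have hx : |max (-K) (min K (g x))| ≤ |K| := by
          rw [abs_le]
          exact ⟨le_max_of_le_left (neg_le_neg (le_abs_self K)),
            max_le (neg_le_abs K) ((min_le_left _ _).trans (le_abs_self K))⟩
        have hy : |max (-K) (min K (g y))| ≤ |K| := by
          rw [abs_le]
          exact ⟨le_max_of_le_left (neg_le_neg (le_abs_self K)),
            max_le (neg_le_abs K) ((min_le_left _ _).trans (le_abs_self K))⟩
        rw [abs_le] at hx hy ⊢
        constructor <;> linarith)
    have hΦ : ∀ x, Φ x = max (-K) (min K (g x)) := fun x => rfl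
    have hΦm : Measurable fun x => Φ x := Φ.continuous.measurable
    have hΦK : ∀ x, |Φ x| ≤ K := fun x => by
      have hK0 : 0 ≤ K := (abs_nonneg _).trans (hK x)
      rw [hΦ, abs_le]
      exact ⟨le_max_left _ _, max_le (by linarith) (min_le_left _ _)⟩
    have hd : ∀ x, |f x - Φ x| ≤ |f x - g x| := fun x => by
      have := abs_le.1 (hK x)
      have h1 : f x = max (-K) (min K (f x)) := by
        rw [min_eq_right this.2, max_eq_right this.1]
      rw [hΦ]
      conv_lhs => rw [h1]
      refine (abs_max_sub_max_le_max _ _ _ _).trans ?_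
      rw [sub_self, abs_zero, max_eq_right (abs_nonneg _)]
      refine (abs_min_sub_min_le_max _ _ _ _).trans ?_
      rw [sub_self, abs_zero, max_eq_right (abs_nonneg _)]
    have hdi : Integrable (fun x => |f x - Φ x|) (μ + ν) :=
      ((bint (μ + ν) f hf hK).sub (bint (μ + ν) _ hΦm hΦK)).abs
    have hsum : ∫ x, |f x - Φ x| ∂μ + ∫ x, |f x - Φ x| ∂ν ≤ η := by
      rw [← integral_add_measure (hdi.mono_measure (Measure.le_add_right le_rfl))
        (hdi.mono_measure (Measure.le_add_left le_rfl))]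
      refine le_trans (integral_mono_of_nonneg (ae_of_all _ fun x => abs_nonneg _) ?_
        (ae_of_all _ hd)) (by simpa using hg)
      by_contra hni
      exact absurd ((bint (μ + ν) f hf hK).sub (BoundedContinuousFunction.integrable _ g)).abs
        (by simpa using hni)
    have n1 : 0 ≤ ∫ x, |f x - Φ x| ∂μ := integral_nonneg fun x => abs_nonneg _
    have n2 : 0 ≤ ∫ x, |f x - Φ x| ∂ν := integral_nonneg fun x => abs_nonneg _
    have e1 : ∫ x, f x ∂μ - ∫ x, Φ x ∂μ ≤ ∫ x, |f x - Φ x| ∂μ := by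
      rw [← integral_sub (bint μ f hf hK) (bint μ _ hΦm hΦK)]
      exact integral_mono ((bint μ f hf hK).sub (bint μ _ hΦm hΦK))
        (hdi.mono_measure (Measure.le_add_right le_rfl)) fun x => le_abs_self _
    have e2 : ∫ x, Real.exp (Φ x) ∂ν - ∫ x, Real.exp (f x) ∂ν
        ≤ Real.exp K * ∫ x, |f x - Φ x| ∂ν := by
      rw [← integral_sub (eint ν _ hΦm hΦK) (eint ν f hf hK), ← integral_const_mul]
      refine integral_mono ((eint ν _ hΦm hΦK).sub (eint ν f hf hK))
        ((hdi.mono_measure (Measure.le_add_left le_rfl)).const_mul _) fun x => ?_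
      have h1 := Real.add_one_le_exp (f x - Φ x)
      have h2 : Real.exp (f x) = Real.exp (Φ x) * Real.exp (f x - Φ x) := by
        rw [← Real.exp_add]; ring_nf
      have h3 : Real.exp (Φ x) ≤ Real.exp K :=
        Real.exp_le_exp.2 ((le_abs_self _).trans (hΦK x))
      have h4 : Φ x - f x ≤ |f x - Φ x| := by rw [abs_sub_comm]; exact le_abs_self _
      have h5 := Real.exp_pos (Φ x)
      have h6 := mul_le_mul_of_nonneg_left h1 h5.le
      have h7 := mul_le_mul_of_nonneg_left h4 h5.le
      have h8 := mul_le_mul_of_nonneg_right h3 (abs_nonneg (f x - Φ x))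
      simp only
      nlinarith
    have h0 := h Φ
    have hE := Real.exp_pos K
    nlinarith
  refine le_of_forall_pos_le_add fun δ hδ => ?_
  have hE : 0 < 1 + Real.exp K := by have := Real.exp_pos K; linarith
  have := key (δ / (1 + Real.exp K)) (by positivity)
  rwa [mul_div_cancel₀ _ hE.ne'] at this

/-- Converse part of the variational formula for the Kullback–Leibler divergence. -/
theorem klDiv_le_of_forall_bounded [IsFiniteMeasure μ] [IsFiniteMeasure ν] {c : ℝ}
    (h : ∀ f : X → ℝ, Measurable f → (∃ K, ∀ x, |f x| ≤ K) →
      ∫ x, f x ∂μ - ∫ x, Real.exp (f x) ∂ν + ν.real univ ≤ c) :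
    klDiv μ ν ≤ ENNReal.ofReal c := by
  -- On a ν-null set A the test functions k·1_A leave the ν-terms unchanged, so k μ(A) ≤ c for every
  -- k.
  have hac : μ ≪ ν := by
    refine Measure.AbsolutelyContinuous.mk fun A hA hνA => ?_
    by_contra hne
    have hpos : 0 < μ.real A := ENNReal.toReal_pos hne (measure_ne_top _ _)
    obtain ⟨k, hk⟩ := exists_nat_gt (c / μ.real A)
    have hm : Measurable (A.indicator fun _ => (k : ℝ)) := measurable_const.indicator hA
    have := h _ hm ⟨k, fun x => by
      by_cases hx : x ∈ A <;> simp [hx]⟩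
    have e1 : ∫ x, Real.exp (A.indicator (fun _ => (k : ℝ)) x) ∂ν = ν.real univ := by
      rw [integral_congr_ae (g := fun _ => (1 : ℝ))]
      · simp
      · filter_upwards [measure_eq_zero_iff_ae_notMem.1 hνA] with x hx
        simp [hx]
    rw [e1, integral_indicator hA, setIntegral_const, smul_eq_mul] at this
    rw [div_lt_iff₀ hpos] at hk
    linarith
  rw [klDiv_eq_lintegral_klFun_of_ac hac]
  let r : X → ℝ := fun x => (μ.rnDeriv ν x).toReal
  have hr : Measurable r := (Measure.measurable_rnDeriv μ ν).ennreal_toReal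
  have hr0 : ∀ x, 0 ≤ r x := fun x => ENNReal.toReal_nonneg
  let F : ℕ → X → ℝ := fun n x => max (-(n : ℝ)) (min n (Real.log (r x)))
  have hF : ∀ n, Measurable (F n) := fun n => by fun_prop
  have hFb : ∀ n x, |F n x| ≤ n := fun n x => by
    have : (0 : ℝ) ≤ n := n.cast_nonneg
    rw [abs_le]; exact ⟨le_max_left _ _, max_le (by linarith) (min_le_left _ _)⟩
  let H : ℕ → X → ℝ := fun n x => if r x = 0 then 1 - Real.exp (-n) else
    r x * F n x - Real.exp (F n x) + 1
  -- The optimal test function is log r, truncated to [-n, n]. Where r = 0 its true value is -∞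
  -- while `Real.log 0 = 0`, so the truncation -n is imposed by hand.
  let G : ℕ → X → ℝ := fun n x => if r x = 0 then -(n : ℝ) else F n x
  have hG : ∀ n, Measurable (G n) := fun n =>
    Measurable.ite (hr (measurableSet_singleton 0)) measurable_const (hF n)
  have hGb : ∀ n x, |G n x| ≤ n := fun n x => by
    by_cases hx : r x = 0
    · simp [G, hx]
    · simpa [G, hx] using hFb n x
  have hHG : ∀ n x, H n x = r x * G n x - Real.exp (G n x) + 1 := fun n x => by
    by_cases hx : r x = 0
    · simp [G, H, hx]; ring
    · simp [G, H, hx]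
  -- Nonnegativity is what Fatou's lemma needs. For r > 0 and a the truncated logarithm, a (r - exp
  -- a) ≥ 0, so the integrand is at least a exp a - exp a + 1 ≥ 0.
  have hH0 : ∀ n x, 0 ≤ H n x := by
    intro n x
    have hn : (0 : ℝ) ≤ n := n.cast_nonneg
    by_cases hx : r x = 0
    · have : Real.exp (-(n : ℝ)) ≤ 1 := Real.exp_le_one_iff.2 (by linarith)
      simp only [H, hx, if_true]; linarith
    · have hpos : 0 < r x := lt_of_le_of_ne (hr0 x) (Ne.symm hx)
      simp only [H, hx, if_false]
      have hb : ∀ a : ℝ, 0 ≤ Real.exp a * a - Real.exp a + 1 := fun a => by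
        have h1 := Real.add_one_le_exp (-a)
        have h2 := mul_le_mul_of_nonneg_left h1 (Real.exp_pos a).le
        rw [← Real.exp_add] at h2
        simp at h2; linarith
      refine (hb (F n x)).trans ?_
      have : Real.exp (F n x) * F n x ≤ r x * F n x := by
        rcases le_total (Real.log (r x)) (-(n : ℝ)) with hc | hc
        · have hFx : F n x = -n := by
            simp only [F]; rw [min_eq_right (by linarith), max_eq_left hc]
          have : r x ≤ Real.exp (F n x) := by
            rw [hFx]; exact (Real.log_le_iff_le_exp hpos).1 hc
          rw [hFx] at *
          nlinarith
        · rcases le_total (Real.log (r x)) n with hd | hd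
          · have hFx : F n x = Real.log (r x) := by
              simp only [F]; rw [min_eq_right hd, max_eq_right hc]
            rw [hFx, Real.exp_log hpos]
          · have hFx : F n x = n := by
              simp only [F]; rw [min_eq_left hd, max_eq_right (by linarith)]
            have : Real.exp (F n x) ≤ r x := by
              rw [hFx]; exact (Real.le_log_iff_exp_le hpos).1 hd
            rw [hFx] at *
            nlinarith
      linarith
  have hlim : ∀ x, Tendsto (fun n => H n x) atTop (𝓝 (klFun (r x))) := by
    intro x
    by_cases hx : r x = 0
    · simp only [H, hx, if_true, klFun_zero]
      have : Tendsto (fun n : ℕ => Real.exp (-(n : ℝ))) atTop (𝓝 0) :=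
        Real.tendsto_exp_neg_atTop_nhds_zero.comp tendsto_natCast_atTop_atTop
      simpa using tendsto_const_nhds.sub this
    · have hpos : 0 < r x := lt_of_le_of_ne (hr0 x) (Ne.symm hx)
      obtain ⟨N, hN⟩ := exists_nat_ge |Real.log (r x)|
      refine tendsto_const_nhds.congr' ?_
      filter_upwards [eventually_ge_atTop N] with n hn
      have hnN : (N : ℝ) ≤ n := by exact_mod_cast hn
      have := abs_le.1 (hN.trans hnN)
      have hFx : F n x = Real.log (r x) := by
        simp only [F]; rw [min_eq_right this.2, max_eq_right this.1]
      simp only [H, hx, if_false, hFx, Real.exp_log hpos, klFun_apply]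
      ring
  have hbd : ∀ n, ∫⁻ x, ENNReal.ofReal (H n x) ∂ν ≤ ENNReal.ofReal c := by
    intro n
    have i1 : Integrable (G n) μ := Integrable.of_bound (hG n).aestronglyMeasurable n
      (ae_of_all _ fun x => by simpa using hGb n x)
    have i2 : Integrable (fun x => Real.exp (G n x)) ν :=
      Integrable.of_bound (hG n).exp.aestronglyMeasurable (Real.exp n) (ae_of_all _ fun x => by
        rw [Real.norm_of_nonneg (Real.exp_pos _).le]
        exact Real.exp_le_exp.2 ((le_abs_self _).trans (hGb n x)))
    have i3 : Integrable (fun x => r x * G n x) ν := by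
      simpa [r] using (integrable_rnDeriv_smul_iff hac).2 i1
    have hint : Integrable (H n) ν := by
      rw [funext (hHG n)]
      exact (i3.sub i2).add (integrable_const _)
    rw [← ofReal_integral_eq_lintegral_ofReal hint (ae_of_all _ (hH0 n))]
    refine ENNReal.ofReal_le_ofReal ?_
    have := h (G n) (hG n) ⟨n, hGb n⟩
    rw [← integral_rnDeriv_smul hac] at this
    rw [funext (hHG n), integral_add (f := fun x => r x * G n x - Real.exp (G n x)) (i3.sub i2)
      (integrable_const _), integral_sub i3 i2]
    simpa [r] using this
  calc ∫⁻ x, ENNReal.ofReal (klFun (r x)) ∂ν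
      = ∫⁻ x, liminf (fun n => ENNReal.ofReal (H n x)) atTop ∂ν := by
        refine lintegral_congr fun x => ?_
        exact (ENNReal.tendsto_ofReal (hlim x)).liminf_eq.symm
    _ ≤ liminf (fun n => ∫⁻ x, ENNReal.ofReal (H n x) ∂ν) atTop :=
        lintegral_liminf_le fun n => by
          refine Measurable.ennreal_ofReal ?_
          rw [funext (hHG n)]
          exact ((hr.mul (hG n)).sub (hG n).exp).add_const _
    _ ≤ ENNReal.ofReal c := by
        refine (liminf_le_liminf (v := fun _ => ENNReal.ofReal c) (Eventually.of_forall hbd)).trans ?_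
        simp

theorem klDiv_le_of_forall_boundedContinuous [TopologicalSpace X] [NormalSpace X] [BorelSpace X]
    [IsFiniteMeasure μ] [IsFiniteMeasure ν] [(μ + ν).WeaklyRegular] {c : ℝ}
    (h : ∀ Φ : X →ᵇ ℝ, ∫ x, Φ x ∂μ - ∫ x, Real.exp (Φ x) ∂ν + ν.real univ ≤ c) :
    klDiv μ ν ≤ ENNReal.ofReal c := by
  refine klDiv_le_of_forall_bounded fun f hf ⟨K, hK⟩ => ?_
  have := variational_bound_of_boundedContinuous (c := c - ν.real univ) (μ := μ) (ν := ν)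
    (fun Φ => by have := h Φ; linarith) hf hK
  linarith

end DonskerVaradhan

/-! ### Gaussian mollification, the polynomial weight and the regularized density -/

section Mollifier

variable {d : ℕ}

/-- The density `π^{-d/2} exp (-|y|²)`. -/
noncomputable def gauss (y : Vel d) : ℝ := (Real.pi ^ ((d : ℝ) / 2))⁻¹ * Real.exp (-‖y‖ ^ 2)

theorem gauss_pos (y : Vel d) : 0 < gauss y := by
  have := Real.pi_pos
  unfold gauss; positivity

theorem gauss_le_one (y : Vel d) : gauss y ≤ 1 := by
  unfold gauss
  have h1 : (1 : ℝ) ≤ Real.pi ^ ((d : ℝ) / 2) :=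
    Real.one_le_rpow (by have := Real.pi_gt_three; linarith) (by positivity)
  have h2 : Real.exp (-‖y‖ ^ 2) ≤ 1 := Real.exp_le_one_iff.2 (by have := sq_nonneg ‖y‖; linarith)
  exact mul_le_one₀ (inv_le_one_of_one_le₀ h1) (Real.exp_pos _).le h2

@[fun_prop]
theorem continuous_gauss : Continuous (gauss : Vel d → ℝ) := by
  unfold gauss; fun_prop

theorem integral_gauss : ∫ y : Vel d, gauss y = 1 := by
  unfold gauss
  have h := GaussianFourier.integral_rexp_neg_mul_sq_norm (V := Vel d) one_pos
  simp only [neg_mul, one_mul, div_one, finrank_euclideanSpace, Fintype.card_fin] at h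
  rw [integral_const_mul, h, inv_mul_cancel₀]
  have := Real.pi_pos
  positivity

theorem integrable_gauss : Integrable (gauss : Vel d → ℝ) := by
  by_contra h
  have := integral_gauss (d := d)
  rw [integral_undef h] at this
  exact zero_ne_one this

/-- The Gaussian probability with density `gauss`. -/
noncomputable def gaussMeasure (d : ℕ) : Measure (Vel d) :=
  volume.withDensity fun y => ENNReal.ofReal (gauss y)

instance : IsProbabilityMeasure (gaussMeasure d) := by
  constructor
  rw [gaussMeasure, withDensity_apply _ MeasurableSet.univ, Measure.restrict_univ,
    ← ofReal_integral_eq_lintegral_ofReal integrable_gauss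
      (ae_of_all _ fun y => (gauss_pos y).le), integral_gauss, ENNReal.ofReal_one]

theorem integrable_norm_gaussMeasure : Integrable (fun y : Vel d => ‖y‖) (gaussMeasure d) := by
  rw [gaussMeasure, integrable_withDensity_iff (by fun_prop) (by simp)]
  have h := GaussianFourier.integral_rexp_neg_mul_sq_norm (V := Vel d) (b := 1 / 2) (by norm_num)
  have hi : Integrable (fun y : Vel d => Real.exp (-(1 / 2) * ‖y‖ ^ 2)) := by
    by_contra hc
    rw [integral_undef hc] at h
    have : 0 < (Real.pi / (1 / 2)) ^ ((Module.finrank ℝ (Vel d) : ℝ) / 2) := by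
      have := Real.pi_pos
      positivity
    linarith
  refine (hi.const_mul (Real.pi ^ ((d : ℝ) / 2))⁻¹).mono'
    (by fun_prop : Measurable _).aestronglyMeasurable (ae_of_all _ fun y => ?_)
  rw [ENNReal.toReal_ofReal (gauss_pos y).le, Real.norm_of_nonneg
    (mul_nonneg (norm_nonneg _) (gauss_pos y).le), gauss]
  have h1 : Real.exp (-‖y‖ ^ 2) = Real.exp (-(1 / 2) * ‖y‖ ^ 2) * Real.exp (-(1 / 2) * ‖y‖ ^ 2) := by
    rw [← Real.exp_add]; ring_nf
  have h2 : ‖y‖ * Real.exp (-(1 / 2) * ‖y‖ ^ 2) ≤ 1 := by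
    have h3 := Real.add_one_le_exp (1 / 2 * ‖y‖ ^ 2)
    have h4 : ‖y‖ ≤ Real.exp (1 / 2 * ‖y‖ ^ 2) := by nlinarith [sq_nonneg (‖y‖ - 1)]
    rw [neg_mul, Real.exp_neg]
    exact mul_inv_le_one_of_le₀ h4 (Real.exp_pos _).le
  have h5 : 0 < (Real.pi ^ ((d : ℝ) / 2))⁻¹ := by have := Real.pi_pos; positivity
  have h6 := Real.exp_pos (-(1 / 2) * ‖y‖ ^ 2)
  calc ‖y‖ * ((Real.pi ^ ((d : ℝ) / 2))⁻¹ * Real.exp (-‖y‖ ^ 2))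
      = (Real.pi ^ ((d : ℝ) / 2))⁻¹ * ((‖y‖ * Real.exp (-(1 / 2) * ‖y‖ ^ 2))
          * Real.exp (-(1 / 2) * ‖y‖ ^ 2)) := by rw [h1]; ring
    _ ≤ (Real.pi ^ ((d : ℝ) / 2))⁻¹ * (1 * Real.exp (-(1 / 2) * ‖y‖ ^ 2)) := by gcongr
    _ = _ := by ring

/-- The rescaled density `s^{-d} gauss (z / s)`. -/
noncomputable def gaussScaled (s : ℝ) (z : Vel d) : ℝ := (s ^ d)⁻¹ * gauss (s⁻¹ • z)

theorem gaussScaled_pos {s : ℝ} (hs : 0 < s) (z : Vel d) : 0 < gaussScaled s z :=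
  mul_pos (by positivity) (gauss_pos _)

theorem gaussScaled_le {s : ℝ} (hs : 0 < s) (z : Vel d) : gaussScaled s z ≤ (s ^ d)⁻¹ :=
  mul_le_of_le_one_right (by positivity) (gauss_le_one _)

@[fun_prop]
theorem continuous_gaussScaled (s : ℝ) : Continuous (gaussScaled s : Vel d → ℝ) := by
  unfold gaussScaled; fun_prop

theorem lintegral_gaussMeasure_comp {s : ℝ} (hs : 0 < s) (v : Vel d) {h : Vel d → ℝ≥0∞}
    (hh : Measurable h) :
    ∫⁻ y, h (v + s • y) ∂(gaussMeasure d)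
      = ∫⁻ z, h z * ENNReal.ofReal (gaussScaled s (z - v)) := by
  have e1 : ∫⁻ z, h z * ENNReal.ofReal (gaussScaled s (z - v))
      = ∫⁻ z, h (v + z) * ENNReal.ofReal (gaussScaled s z) := by
    rw [← lintegral_add_left_eq_self (μ := (volume : Measure (Vel d))) _ v]
    simp
  have e2 : ∫⁻ y : Vel d, h (v + s • y) * ENNReal.ofReal (gauss y)
      = ∫⁻ z, h (v + z) * ENNReal.ofReal (gauss (s⁻¹ • z))
        ∂((volume : Measure (Vel d)).map (s • ·)) := by
    rw [lintegral_map (by fun_prop) (by fun_prop)]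
    refine lintegral_congr fun y => ?_
    rw [smul_smul, inv_mul_cancel₀ hs.ne', one_smul]
  rw [e1, gaussMeasure, lintegral_withDensity_eq_lintegral_mul _ (by fun_prop) (by fun_prop)]
  simp only [Pi.mul_apply]
  simp_rw [mul_comm (ENNReal.ofReal (gauss _))]
  rw [e2, Measure.map_addHaar_smul _ hs.ne', lintegral_smul_measure, smul_eq_mul,
    ← lintegral_const_mul _ (by fun_prop)]
  refine lintegral_congr fun z => ?_
  rw [gaussScaled, ENNReal.ofReal_mul (by positivity), finrank_euclideanSpace, Fintype.card_fin,
    abs_of_nonneg (by positivity : (0 : ℝ) ≤ (s ^ d)⁻¹)]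
  ring

variable {s : ℝ} (π : Measure (Vel d)) [IsProbabilityMeasure π]

/-- The density of `π` convolved with the Gaussian of scale `s`. -/
noncomputable def mollify (s : ℝ) (π : Measure (Vel d)) (z : Vel d) : ℝ :=
  ∫ v, gaussScaled s (z - v) ∂π

theorem integrable_gaussScaled (hs : 0 < s) (z : Vel d) :
    Integrable (fun v => gaussScaled s (z - v)) π :=
  Integrable.of_bound (by fun_prop) ((s ^ d)⁻¹) (ae_of_all _ fun v => by
    rw [Real.norm_of_nonneg (gaussScaled_pos hs _).le]; exact gaussScaled_le hs _)

theorem mollify_nonneg (hs : 0 < s) (z : Vel d) : 0 ≤ mollify s π z :=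
  integral_nonneg fun _ => (gaussScaled_pos hs _).le

theorem mollify_le (hs : 0 < s) (z : Vel d) : mollify s π z ≤ (s ^ d)⁻¹ := by
  refine (integral_mono (integrable_gaussScaled π hs z) (integrable_const ((s ^ d)⁻¹))
    fun _ => gaussScaled_le hs _).trans ?_
  simp

theorem ofReal_mollify (hs : 0 < s) (z : Vel d) :
    ENNReal.ofReal (mollify s π z) = ∫⁻ v, ENNReal.ofReal (gaussScaled s (z - v)) ∂π :=
  ofReal_integral_eq_lintegral_ofReal (integrable_gaussScaled π hs z)
    (ae_of_all _ fun _ => (gaussScaled_pos hs _).le)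

theorem measurable_mollify : Measurable (mollify s π) := by
  unfold mollify
  have hc : Continuous (Function.uncurry fun z v : Vel d => gaussScaled s (z - v)) := by
    unfold Function.uncurry; fun_prop
  exact hc.stronglyMeasurable.integral_prod_right.measurable

theorem map_prod_gaussMeasure (hs : 0 < s) :
    (π.prod (gaussMeasure d)).map (fun p => p.1 + s • p.2)
      = volume.withDensity fun z => ENNReal.ofReal (mollify s π z) := by
  have hm := measurable_mollify π (s := s)
  refine Measure.ext_of_lintegral _ fun h hh => ?_
  rw [lintegral_map hh (by fun_prop), lintegral_prod _ (by fun_prop),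
    lintegral_withDensity_eq_lintegral_mul _ (by fun_prop) hh]
  simp_rw [lintegral_gaussMeasure_comp hs _ hh]
  rw [lintegral_lintegral_swap]
  · refine lintegral_congr fun z => ?_
    rw [lintegral_const_mul _ (by fun_prop), Pi.mul_apply, ofReal_mollify π hs, mul_comm]
  · exact ((hh.comp measurable_snd).mul
      ((by fun_prop : Continuous fun p : Vel d × Vel d =>
        gaussScaled s (p.2 - p.1)).measurable.ennreal_ofReal)).aemeasurable

theorem lintegral_mollify (hs : 0 < s) {h : Vel d → ℝ≥0∞} (hh : Measurable h) :
    ∫⁻ z, h z * ENNReal.ofReal (mollify s π z)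
      = ∫⁻ v, ∫⁻ y, h (v + s • y) ∂(gaussMeasure d) ∂π := by
  have hm := measurable_mollify π (s := s)
  rw [← lintegral_prod (fun p : Vel d × Vel d => h (p.1 + s • p.2)) (by fun_prop),
    ← lintegral_map (f := h) (g := fun p : Vel d × Vel d => p.1 + s • p.2) hh (by fun_prop),
    map_prod_gaussMeasure π hs, lintegral_withDensity_eq_lintegral_mul _ (by fun_prop) hh]
  simp [mul_comm]

theorem integrable_mul_mollify_iff (hs : 0 < s) {h : Vel d → ℝ} (hh : Measurable h) :
    Integrable (fun z => h z * mollify s π z) ↔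
      Integrable (fun p : Vel d × Vel d => h (p.1 + s • p.2)) (π.prod (gaussMeasure d)) := by
  have hm := measurable_mollify π (s := s)
  have := integrable_map_measure (μ := π.prod (gaussMeasure d)) (g := h)
    (f := fun p : Vel d × Vel d => p.1 + s • p.2) hh.aestronglyMeasurable (by fun_prop)
  rw [map_prod_gaussMeasure π hs, integrable_withDensity_iff (by fun_prop) (by simp)] at this
  simpa only [ENNReal.toReal_ofReal (mollify_nonneg π hs _), Function.comp_def] using this

theorem integral_mul_mollify (hs : 0 < s) {h : Vel d → ℝ} (hh : Measurable h) :
    ∫ z, h z * mollify s π z = ∫ p, h (p.1 + s • p.2) ∂(π.prod (gaussMeasure d)) := by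
  have hm := measurable_mollify π (s := s)
  rw [← integral_map (φ := fun p : Vel d × Vel d => p.1 + s • p.2) (by fun_prop)
    hh.aestronglyMeasurable, map_prod_gaussMeasure π hs,
    integral_withDensity_eq_integral_toReal_smul (by fun_prop) (by simp)]
  simp only [ENNReal.toReal_ofReal (mollify_nonneg π hs _), smul_eq_mul, mul_comm]

theorem integrable_mollify (hs : 0 < s) : Integrable (mollify s π) := by
  have := (integrable_mul_mollify_iff π hs (h := fun _ => 1) measurable_const).2
    (integrable_const _)
  simpa using this

theorem integral_mollify (hs : 0 < s) : ∫ z, mollify s π z = 1 := by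
  have := integral_mul_mollify π hs (h := fun _ => 1) measurable_const
  simpa using this

/-- An integrable polynomial weight. -/
noncomputable def weight (z : Vel d) : ℝ := ((1 + ‖z‖) ^ (d + 3))⁻¹

theorem weight_pos (z : Vel d) : 0 < weight z := by unfold weight; positivity

theorem weight_le_one (z : Vel d) : weight z ≤ 1 :=
  inv_le_one_of_one_le₀ (one_le_pow₀ (by have := norm_nonneg z; linarith))

@[fun_prop]
theorem continuous_weight : Continuous (weight : Vel d → ℝ) := by
  unfold weight
  refine Continuous.inv₀ (by fun_prop) fun z => ?_
  positivity

theorem log_weight (z : Vel d) : Real.log (weight z) = -((d + 3 : ℕ) * Real.log (1 + ‖z‖)) := by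
  rw [weight, Real.log_inv, Real.log_pow]

theorem log_one_add_norm_nonneg (z : Vel d) : 0 ≤ Real.log (1 + ‖z‖) :=
  Real.log_nonneg (by have := norm_nonneg z; linarith)

theorem log_one_add_norm_le (z : Vel d) : Real.log (1 + ‖z‖) ≤ ‖z‖ := by
  have := Real.log_le_sub_one_of_pos (x := 1 + ‖z‖) (by positivity)
  linarith

theorem log_one_add_norm_add_le (v y : Vel d) :
    Real.log (1 + ‖v + y‖) ≤ Real.log (1 + ‖v‖) + ‖y‖ := by
  have h1 := norm_add_le v y
  have h2 : 1 + ‖v + y‖ ≤ (1 + ‖v‖) * (1 + ‖y‖) := by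
    have := mul_nonneg (norm_nonneg v) (norm_nonneg y)
    nlinarith
  refine (Real.log_le_log (by positivity) h2).trans ?_
  rw [Real.log_mul (by positivity) (by positivity)]
  have := log_one_add_norm_le y
  linarith

theorem integrable_one_add_norm_mul_weight :
    Integrable fun z : Vel d => (1 + ‖z‖) * weight z := by
  have h := integrable_one_add_norm (E := Vel d) (μ := volume) (r := d + 2)
    (by rw [finrank_euclideanSpace, Fintype.card_fin]; linarith)
  refine h.congr (ae_of_all _ fun z => ?_)
  have hp : 0 < 1 + ‖z‖ := by positivity
  have e : (-((d : ℝ) + 2)) = -((d + 2 : ℕ) : ℝ) := by push_cast; ring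
  simp only [weight]
  rw [e, Real.rpow_neg hp.le, Real.rpow_natCast, pow_succ _ (d + 2)]
  field_simp

theorem integrable_weight : Integrable (weight : Vel d → ℝ) :=
  integrable_one_add_norm_mul_weight.mono' (by fun_prop) (ae_of_all _ fun z => by
    rw [Real.norm_of_nonneg (weight_pos z).le]
    exact le_mul_of_one_le_left (weight_pos z).le (by have := norm_nonneg z; linarith))

/-- The finite measure with density `weight`. -/
noncomputable def weightMeasure (d : ℕ) : Measure (Vel d) :=
  volume.withDensity fun z => ENNReal.ofReal (weight z)

instance : IsFiniteMeasure (weightMeasure d) :=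
  isFiniteMeasure_withDensity_ofReal integrable_weight.2

theorem integrable_weightMeasure_iff {h : Vel d → ℝ} :
    Integrable h (weightMeasure d) ↔ Integrable fun z => h z * weight z := by
  rw [weightMeasure, integrable_withDensity_iff (by fun_prop) (by simp)]
  simp only [ENNReal.toReal_ofReal (weight_pos _).le]

theorem integral_weightMeasure (h : Vel d → ℝ) :
    ∫ z, h z ∂(weightMeasure d) = ∫ z, h z * weight z := by
  rw [weightMeasure, integral_withDensity_eq_integral_toReal_smul (by fun_prop) (by simp)]
  simp only [ENNReal.toReal_ofReal (weight_pos _).le, smul_eq_mul, mul_comm]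

theorem weightMeasure_real_univ : (weightMeasure d).real univ = ∫ z : Vel d, weight z := by
  have := integral_weightMeasure (d := d) (fun _ => 1)
  simpa using this

/-- The regularized density: mollified at scale `τ²`, with the weight added with factor `τ²`. -/
noncomputable def reg (τ : ℝ) (π : Measure (Vel d)) (z : Vel d) : ℝ :=
  mollify (τ ^ 2) π z + τ ^ 2 * weight z

/-- Mollification of the logarithm of the regularized density. -/
noncomputable def pot (τ : ℝ) (π : Measure (Vel d)) (v : Vel d) : ℝ :=
  ∫ y, Real.log (reg τ π (v + τ ^ 2 • y)) ∂(gaussMeasure d)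

variable {τ : ℝ}

theorem measurable_reg : Measurable (reg τ π) :=
  (measurable_mollify π).add ((by fun_prop : Continuous fun z : Vel d => τ ^ 2 * weight z).measurable)

theorem weight_le_reg (hτ : 0 < τ) (z : Vel d) : τ ^ 2 * weight z ≤ reg τ π z := by
  have := mollify_nonneg π (pow_pos hτ 2) z
  unfold reg; linarith

theorem mollify_le_reg (hτ : 0 < τ) (z : Vel d) : mollify (τ ^ 2) π z ≤ reg τ π z := by
  have := mul_pos (pow_pos hτ 2) (weight_pos z)
  unfold reg; linarith

theorem reg_pos (hτ : 0 < τ) (z : Vel d) : 0 < reg τ π z :=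
  (mul_pos (pow_pos hτ 2) (weight_pos z)).trans_le (weight_le_reg π hτ z)

theorem reg_le (hτ : 0 < τ) (z : Vel d) : reg τ π z ≤ ((τ ^ 2) ^ d)⁻¹ + τ ^ 2 := by
  have h1 := mollify_le π (pow_pos hτ 2) z
  have h2 := mul_le_of_le_one_right (pow_pos hτ 2).le (weight_le_one z)
  unfold reg; linarith

theorem integrable_reg (hτ : 0 < τ) : Integrable (reg τ π) :=
  (integrable_mollify π (pow_pos hτ 2)).add (integrable_weight.const_mul _)

theorem integral_reg (hτ : 0 < τ) : ∫ z, reg τ π z = 1 + τ ^ 2 * ∫ z : Vel d, weight z := by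
  unfold reg
  rw [integral_add (integrable_mollify π (pow_pos hτ 2)) (integrable_weight.const_mul _),
    integral_mollify π (pow_pos hτ 2), integral_const_mul]

/-- The constant in the logarithmic bound of the regularized density. -/
noncomputable def logBound (d : ℕ) (τ : ℝ) : ℝ := |Real.log (τ ^ 2)| + (((τ ^ 2) ^ d)⁻¹ + τ ^ 2)

theorem logBound_nonneg : 0 ≤ logBound d τ := by unfold logBound; positivity

/-- The weight keeps the density above an inverse power of 1 + |z|, so the logarithm grows only
logarithmically. A Gaussian lower bound alone would allow quadratic growth, which the flux Q cannot
be assumed to integrate. -/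
theorem abs_log_reg_le (hτ : 0 < τ) (z : Vel d) :
    |Real.log (reg τ π z)| ≤ logBound d τ + (d + 3 : ℕ) * Real.log (1 + ‖z‖) := by
  have h0 := log_one_add_norm_nonneg z
  have h1 : Real.log (τ ^ 2 * weight z) ≤ Real.log (reg τ π z) :=
    Real.log_le_log (mul_pos (pow_pos hτ 2) (weight_pos z)) (weight_le_reg π hτ z)
  rw [Real.log_mul (pow_pos hτ 2).ne' (weight_pos z).ne', log_weight] at h1
  have h2 := Real.log_le_sub_one_of_pos (reg_pos π hτ z)
  have h3 := reg_le π hτ z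
  have h4 := neg_abs_le (Real.log (τ ^ 2))
  have h5 : 0 ≤ ((τ ^ 2) ^ d)⁻¹ + τ ^ 2 := by positivity
  have h6 : (0 : ℝ) ≤ (d + 3 : ℕ) * Real.log (1 + ‖z‖) := by positivity
  have h7 := abs_nonneg (Real.log (τ ^ 2))
  unfold logBound
  rw [abs_le]; constructor <;> linarith

theorem abs_log_reg_add_le (hτ : 0 < τ) (v y : Vel d) :
    |Real.log (reg τ π (v + τ ^ 2 • y))|
      ≤ logBound d τ + (d + 3 : ℕ) * (Real.log (1 + ‖v‖) + τ ^ 2 * ‖y‖) := by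
  refine (abs_log_reg_le π hτ _).trans ?_
  have := log_one_add_norm_add_le v (τ ^ 2 • y)
  rw [norm_smul, Real.norm_of_nonneg (pow_pos hτ 2).le] at this
  gcongr

theorem integrable_log_reg_add (hτ : 0 < τ) (v : Vel d) :
    Integrable (fun y => Real.log (reg τ π (v + τ ^ 2 • y))) (gaussMeasure d) := by
  have hm := measurable_reg π (τ := τ)
  refine Integrable.mono' (g := fun y => logBound d τ
    + (d + 3 : ℕ) * (Real.log (1 + ‖v‖) + τ ^ 2 * ‖y‖)) ?_
    (by fun_prop : Measurable _).aestronglyMeasurable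
    (ae_of_all _ fun y => abs_log_reg_add_le π hτ v y)
  exact (integrable_const _).add
    (((integrable_const _).add (integrable_norm_gaussMeasure.const_mul _)).const_mul _)

/-- The first absolute moment of the Gaussian. -/
noncomputable def gaussMoment (d : ℕ) : ℝ := ∫ y, ‖y‖ ∂(gaussMeasure d)

theorem abs_pot_le (hτ : 0 < τ) (v : Vel d) :
    |pot τ π v| ≤ logBound d τ + (d + 3 : ℕ) * (Real.log (1 + ‖v‖) + τ ^ 2 * gaussMoment d) := by
  have h : ∫ y : Vel d, (logBound d τ + (d + 3 : ℕ) * (Real.log (1 + ‖v‖) + τ ^ 2 * ‖y‖))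
      ∂(gaussMeasure d)
      = logBound d τ + (d + 3 : ℕ) * (Real.log (1 + ‖v‖) + τ ^ 2 * gaussMoment d) := by
    have hi : Integrable (fun y : Vel d => Real.log (1 + ‖v‖) + τ ^ 2 * ‖y‖) (gaussMeasure d) :=
      (integrable_const _).add (integrable_norm_gaussMeasure.const_mul _)
    rw [integral_add (integrable_const _) (hi.const_mul _), integral_const_mul,
      integral_add (integrable_const _) (integrable_norm_gaussMeasure.const_mul _),
      integral_const_mul]
    simp [gaussMoment]
  rw [← h]
  refine abs_integral_le_integral_abs.trans (integral_mono
    (integrable_log_reg_add π hτ v).abs ?_ fun y => abs_log_reg_add_le π hτ v y)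
  exact (integrable_const _).add
    (((integrable_const _).add (integrable_norm_gaussMeasure.const_mul _)).const_mul _)

end Mollifier

/-! ### Entropy of the regularized density: convexity, upper and lower bounds -/

section Entropy

variable {d : ℕ} {τ : ℝ} (π ρ : Measure (Vel d)) [IsProbabilityMeasure π] [IsProbabilityMeasure ρ]

/-- Jensen's inequality in `ℝ≥0∞`: if exp f is not integrable the right side is infinite, so no
exponential moment has to be known beforehand. -/
theorem ofReal_exp_integral_le {X : Type*} [MeasurableSpace X] {m : Measure X}
    [IsProbabilityMeasure m] {f : X → ℝ} (hf : Integrable f m) :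
    ENNReal.ofReal (Real.exp (∫ x, f x ∂m)) ≤ ∫⁻ x, ENNReal.ofReal (Real.exp (f x)) ∂m := by
  by_cases he : Integrable (fun x => Real.exp (f x)) m
  · rw [← ofReal_integral_eq_lintegral_ofReal he (ae_of_all _ fun x => (Real.exp_pos _).le)]
    refine ENNReal.ofReal_le_ofReal ?_
    exact convexOn_exp.map_integral_le Real.continuous_exp.continuousOn isClosed_univ
      (ae_of_all _ fun _ => mem_univ _) hf he
  · have : ∫⁻ x, ENNReal.ofReal (Real.exp (f x)) ∂m = ⊤ := by
      by_contra hne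
      refine he ⟨Real.continuous_exp.comp_aestronglyMeasurable hf.aestronglyMeasurable, ?_⟩
      rw [hasFiniteIntegral_iff_ofReal (ae_of_all _ fun x => (Real.exp_pos _).le)]
      exact lt_top_iff_ne_top.2 hne
    rw [this]
    exact le_top

theorem measurable_pot : Measurable (pot τ π) := by
  have hm := measurable_reg π (τ := τ)
  have hc : Measurable (Function.uncurry fun v y : Vel d => Real.log (reg τ π (v + τ ^ 2 • y))) := by
    unfold Function.uncurry; fun_prop
  exact hc.stronglyMeasurable.integral_prod_right.measurable

theorem integrable_log_one_add_norm {X : Type*} [MeasurableSpace X] {m : Measure X} {u : X → Vel d}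
    (hu : Measurable u) (h : Integrable (fun x => ‖u x‖) m) :
    Integrable (fun x => Real.log (1 + ‖u x‖)) m :=
  h.mono' (by fun_prop : Measurable _).aestronglyMeasurable (ae_of_all _ fun x => by
    rw [Real.norm_of_nonneg (log_one_add_norm_nonneg _)]
    exact log_one_add_norm_le _)

theorem integrable_pot_comp (hτ : 0 < τ) {X : Type*} [MeasurableSpace X] {m : Measure X}
    [IsFiniteMeasure m] {u : X → Vel d} (hu : Measurable u)
    (h : Integrable (fun x => Real.log (1 + ‖u x‖)) m) :
    Integrable (fun x => pot τ π (u x)) m := by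
  have hm := measurable_pot π (τ := τ)
  refine Integrable.mono' (g := fun x => logBound d τ
    + (d + 3 : ℕ) * (Real.log (1 + ‖u x‖) + τ ^ 2 * gaussMoment d)) ?_
    (by fun_prop : Measurable _).aestronglyMeasurable (ae_of_all _ fun x => abs_pot_le π hτ _)
  exact (integrable_const _).add ((h.add (integrable_const _)).const_mul _)

variable {π ρ}

theorem integrable_pot (hτ : 0 < τ) (hρ : Integrable (fun v => ‖v‖) ρ) :
    Integrable (pot τ π) ρ :=
  integrable_pot_comp π hτ measurable_id (integrable_log_one_add_norm measurable_id hρ)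

theorem integrable_norm_add_gauss (hπ : Integrable (fun v => ‖v‖) π) :
    Integrable (fun p : Vel d × Vel d => ‖p.1‖ + ‖p.2‖) (π.prod (gaussMeasure d)) :=
  (hπ.comp_fst _).add (integrable_norm_gaussMeasure.comp_snd _)

theorem integrable_log_reg_prod (hτ : 0 < τ) (hρ : Integrable (fun v => ‖v‖) ρ) :
    Integrable (fun p : Vel d × Vel d => Real.log (reg τ π (p.1 + τ ^ 2 • p.2)))
      (ρ.prod (gaussMeasure d)) := by
  have hm := measurable_reg π (τ := τ)
  refine Integrable.mono' (g := fun p : Vel d × Vel d => logBound d τ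
    + (d + 3 : ℕ) * (Real.log (1 + ‖p.1‖) + τ ^ 2 * ‖p.2‖)) ?_
    (by fun_prop : Measurable _).aestronglyMeasurable
    (ae_of_all _ fun p => abs_log_reg_add_le π hτ _ _)
  refine (integrable_const _).add (Integrable.const_mul ?_ _)
  exact ((integrable_log_one_add_norm measurable_id hρ).comp_fst _).add
    ((integrable_norm_gaussMeasure.const_mul _).comp_snd _)

theorem integrable_log_reg_mul_mollify (hτ : 0 < τ) (hρ : Integrable (fun v => ‖v‖) ρ) :
    Integrable fun z => Real.log (reg τ π z) * mollify (τ ^ 2) ρ z :=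
  (integrable_mul_mollify_iff ρ (pow_pos hτ 2) (measurable_reg π).log).2
    (integrable_log_reg_prod hτ hρ)

theorem integral_log_reg_mul_mollify (hτ : 0 < τ) (hρ : Integrable (fun v => ‖v‖) ρ) :
    ∫ z, Real.log (reg τ π z) * mollify (τ ^ 2) ρ z = ∫ v, pot τ π v ∂ρ := by
  rw [integral_mul_mollify ρ (pow_pos hτ 2) (measurable_reg π).log,
    integral_prod _ (integrable_log_reg_prod hτ hρ)]
  rfl

theorem integrable_log_reg_mul_weight (hτ : 0 < τ) :
    Integrable fun z => Real.log (reg τ π z) * weight z := by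
  have hm := measurable_reg π (τ := τ)
  refine (integrable_one_add_norm_mul_weight.const_mul (logBound d τ + (d + 3 : ℕ))).mono'
    (hm.log.mul continuous_weight.measurable).aestronglyMeasurable (ae_of_all _ fun z => ?_)
  rw [norm_mul, Real.norm_of_nonneg (weight_pos z).le, ← mul_assoc]
  refine mul_le_mul_of_nonneg_right ((abs_log_reg_le π hτ z).trans ?_) (weight_pos z).le
  have h1 := log_one_add_norm_le z
  have h2 := logBound_nonneg (d := d) (τ := τ)
  have h3 := norm_nonneg z
  have h4 : (0 : ℝ) ≤ (d + 3 : ℕ) := Nat.cast_nonneg _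
  have h5 := mul_le_mul_of_nonneg_left h1 h4
  nlinarith [mul_nonneg h2 h3]

theorem integrable_log_reg_mul_reg (hτ : 0 < τ) (hρ : Integrable (fun v => ‖v‖) ρ) :
    Integrable fun z => Real.log (reg τ π z) * reg τ ρ z := by
  refine ((integrable_log_reg_mul_mollify (π := π) hτ hρ).add
    ((integrable_log_reg_mul_weight (π := π) hτ).const_mul (τ ^ 2))).congr (ae_of_all _ fun z => ?_)
  simp only [Pi.add_apply, reg]; ring

theorem integral_log_reg_mul_reg (hτ : 0 < τ) (hρ : Integrable (fun v => ‖v‖) ρ) :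
    ∫ z, Real.log (reg τ π z) * reg τ ρ z
      = ∫ v, pot τ π v ∂ρ + τ ^ 2 * ∫ z, Real.log (reg τ π z) * weight z := by
  rw [← integral_log_reg_mul_mollify hτ hρ, ← integral_const_mul,
    ← integral_add (integrable_log_reg_mul_mollify (π := π) hτ hρ)
    ((integrable_log_reg_mul_weight (π := π) hτ).const_mul (τ ^ 2))]
  refine integral_congr_ae (ae_of_all _ fun z => ?_)
  simp only [reg]; ring

/-- The entropy of the regularized density. -/
noncomputable def regEntropy (τ : ℝ) (π : Measure (Vel d)) : ℝ :=
  ∫ z, Real.log (reg τ π z) * reg τ π z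

/-- Convexity of the regularized entropy along a pair of probabilities. -/
theorem integral_pot_sub_le (hτ : 0 < τ) (hπ : Integrable (fun v => ‖v‖) π)
    (hρ : Integrable (fun v => ‖v‖) ρ) :
    ∫ v, pot τ π v ∂ρ - ∫ v, pot τ π v ∂π ≤ regEntropy τ ρ - regEntropy τ π := by
  have h1 := integral_log_reg_mul_reg (π := π) hτ hρ
  have h2 : regEntropy τ π = _ := integral_log_reg_mul_reg (π := π) hτ hπ
  have h3 : ∫ z, (Real.log (reg τ π z) * reg τ ρ z - reg τ π z)
      ≤ ∫ z, (Real.log (reg τ ρ z) * reg τ ρ z - reg τ ρ z) := by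
    refine integral_mono ((integrable_log_reg_mul_reg hτ hρ).sub (integrable_reg π hτ))
      ((integrable_log_reg_mul_reg hτ hρ).sub (integrable_reg ρ hτ)) fun z => ?_
    have := mul_sub_exp_add_one_le_klFun (reg_pos ρ hτ z).le (Real.log (reg τ π z))
    rw [Real.exp_log (reg_pos π hτ z), klFun_apply] at this
    simp only
    linarith
  rw [integral_sub (integrable_log_reg_mul_reg hτ hρ) (integrable_reg π hτ),
    integral_sub (integrable_log_reg_mul_reg hτ hρ) (integrable_reg ρ hτ),
    integral_reg π hτ, integral_reg ρ hτ] at h3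
  have h4 : regEntropy τ ρ = ∫ z, Real.log (reg τ ρ z) * reg τ ρ z := rfl
  linarith

/-- By Jensen, the exponential of an averaged logarithm is at most the average of the density, and
by translation invariance averaging over shifts preserves the Lebesgue mass. -/
theorem integrable_exp_pot (hτ : 0 < τ) :
    Integrable (fun v => Real.exp (pot τ π v)) ∧
      ∫ v, Real.exp (pot τ π v) ≤ 1 + τ ^ 2 * ∫ z : Vel d, weight z := by
  have hm := measurable_reg π (τ := τ)
  have hp := measurable_pot π (τ := τ)
  have hle : ∫⁻ v, ENNReal.ofReal (Real.exp (pot τ π v))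
      ≤ ENNReal.ofReal (∫ z, reg τ π z) := by
    calc ∫⁻ v, ENNReal.ofReal (Real.exp (pot τ π v))
        ≤ ∫⁻ v, ∫⁻ y, ENNReal.ofReal (reg τ π (v + τ ^ 2 • y)) ∂(gaussMeasure d) := by
          refine lintegral_mono fun v => ?_
          refine (ofReal_exp_integral_le (integrable_log_reg_add π hτ v)).trans_eq ?_
          simp only [Real.exp_log (reg_pos π hτ _)]
      _ = ∫⁻ y, ∫⁻ v, ENNReal.ofReal (reg τ π (v + τ ^ 2 • y)) ∂volume ∂(gaussMeasure d) := by
          refine lintegral_lintegral_swap ?_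
          unfold Function.uncurry; fun_prop
      _ = ENNReal.ofReal (∫ z, reg τ π z) := by
          have ht : ∀ y : Vel d, ∫⁻ v, ENNReal.ofReal (reg τ π (v + τ ^ 2 • y))
              = ∫⁻ z, ENNReal.ofReal (reg τ π z) := fun y =>
            lintegral_add_right_eq_self (μ := (volume : Measure (Vel d)))
              (fun z => ENNReal.ofReal (reg τ π z)) (τ ^ 2 • y)
          simp_rw [ht]
          rw [ofReal_integral_eq_lintegral_ofReal (integrable_reg π hτ)
            (ae_of_all _ fun z => (reg_pos π hτ z).le)]
          simp
  have hi : Integrable (fun v => Real.exp (pot τ π v)) := by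
    refine ⟨hp.exp.aestronglyMeasurable, ?_⟩
    rw [hasFiniteIntegral_iff_ofReal (ae_of_all _ fun x => (Real.exp_pos _).le)]
    exact hle.trans_lt ENNReal.ofReal_lt_top
  refine ⟨hi, ?_⟩
  rw [← ofReal_integral_eq_lintegral_ofReal hi (ae_of_all _ fun x => (Real.exp_pos _).le)] at hle
  rw [← integral_reg π hτ]
  exact (ENNReal.ofReal_le_ofReal_iff (integral_nonneg fun z => (reg_pos π hτ z).le)).1 hle

theorem integrable_log_weight (hπ : Integrable (fun v => ‖v‖) π) :
    Integrable (fun v => Real.log (weight v)) π := by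
  simp_rw [log_weight]
  exact ((integrable_log_one_add_norm measurable_id hπ).const_mul _).neg

/-- The entropy of `π` with respect to Lebesgue measure, through the divergence from the weight. -/
noncomputable def weightEntropy (π : Measure (Vel d)) : ℝ :=
  (klDiv π (weightMeasure d)).toReal + (∫ v, Real.log (weight v) ∂π + 1 - ∫ z : Vel d, weight z)

/-- The entropy dominates its Gibbs functional at the test function `pot` minus log `weight`, whose
exponential term is at most the mass of the regularized density. The rest of the regularized entropy
is τ² ∫ log(reg)·weight, bounded through log u ≤ u. -/
theorem regEntropy_le (hτ : 0 < τ) (hπ : Integrable (fun v => ‖v‖) π)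
    (hkl : klDiv π (weightMeasure d) ≠ ⊤) :
    regEntropy τ π ≤ weightEntropy π
      + τ ^ 2 * (1 + (1 + τ ^ 2) * ∫ z : Vel d, weight z) := by
  have h1 : regEntropy τ π = _ := integral_log_reg_mul_reg (π := π) hτ hπ
  have h2 : ∫ z, Real.log (reg τ π z) * weight z ≤ ∫ z, reg τ π z := by
    refine integral_mono (integrable_log_reg_mul_weight hτ) (integrable_reg π hτ) fun z => ?_
    have := Real.log_le_sub_one_of_pos (reg_pos π hτ z)
    exact (mul_le_mul_of_nonneg_right (this.trans (sub_le_self _ zero_le_one))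
      (weight_pos z).le).trans (mul_le_of_le_one_right (reg_pos π hτ z).le (weight_le_one z))
  rw [integral_reg π hτ] at h2
  have e : ∀ v : Vel d, Real.exp (pot τ π v - Real.log (weight v)) * weight v
      = Real.exp (pot τ π v) := fun v => by
    rw [Real.exp_sub, Real.exp_log (weight_pos v), div_mul_cancel₀ _ (weight_pos v).ne']
  have h3 := integral_le_toReal_klDiv_add hkl (f := fun v => pot τ π v - Real.log (weight v))
    ((integrable_pot hτ hπ).sub (integrable_log_weight hπ)) (by
      rw [integrable_weightMeasure_iff]
      simp_rw [e]
      exact (integrable_exp_pot hτ).1)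
  rw [integral_weightMeasure, weightMeasure_real_univ,
    integral_sub (integrable_pot hτ hπ) (integrable_log_weight hπ)] at h3
  simp_rw [e] at h3
  have h4 := (integrable_exp_pot (π := π) hτ).2
  have h5 := mul_le_mul_of_nonneg_left h2 (pow_pos hτ 2).le
  unfold weightEntropy
  rw [h1]
  linarith

theorem integrable_shift_of_linear_growth {h : Vel d → ℝ} (hc : Continuous h) {A B : ℝ}
    (hb : ∀ z, |h z| ≤ A + B * ‖z‖) (hπ : Integrable (fun v => ‖v‖) π) (r : ℝ) :
    Integrable (fun p : Vel d × Vel d => h (p.1 + r • p.2)) (π.prod (gaussMeasure d)) := by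
  refine Integrable.mono' (g := fun p : Vel d × Vel d => A + |B| * (‖p.1‖ + |r| * ‖p.2‖)) ?_
    (by fun_prop : Continuous _).aestronglyMeasurable (ae_of_all _ fun p => ?_)
  · exact (integrable_const _).add
      (((hπ.comp_fst _).add ((integrable_norm_gaussMeasure.comp_snd _).const_mul _)).const_mul _)
  · refine (hb _).trans ?_
    have h1 := norm_add_le p.1 (r • p.2)
    rw [norm_smul, Real.norm_eq_abs] at h1
    have h2 := mul_le_mul_of_nonneg_right (le_abs_self B) (norm_nonneg (p.1 + r • p.2))
    have h3 := mul_le_mul_of_nonneg_left h1 (abs_nonneg B)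
    linarith

theorem tendsto_integral_shift {h : Vel d → ℝ} (hc : Continuous h) {A B : ℝ}
    (hb : ∀ z, |h z| ≤ A + B * ‖z‖) (hπ : Integrable (fun v => ‖v‖) π) :
    Tendsto (fun τ : ℝ => ∫ p, h (p.1 + τ ^ 2 • p.2) ∂(π.prod (gaussMeasure d))) (𝓝[>] 0)
      (𝓝 (∫ v, h v ∂π)) := by
  have e : ∫ v, h v ∂π = ∫ p : Vel d × Vel d, h p.1 ∂(π.prod (gaussMeasure d)) := by
    rw [integral_fun_fst]; simp
  rw [e]
  refine tendsto_integral_filter_of_dominated_convergence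
    (fun p : Vel d × Vel d => A + |B| * (‖p.1‖ + ‖p.2‖))
    (Eventually.of_forall fun τ => (by fun_prop : Continuous _).aestronglyMeasurable) ?_
    ((integrable_const _).add ((integrable_norm_add_gauss hπ).const_mul _))
    (ae_of_all _ fun p => ?_)
  · filter_upwards [Ioo_mem_nhdsGT (zero_lt_one (α := ℝ))] with τ hτ
    refine ae_of_all _ fun p => (hb _).trans ?_
    have h1 := norm_add_le p.1 (τ ^ 2 • p.2)
    have h0 : τ ^ 2 ≤ 1 := pow_le_one₀ hτ.1.le hτ.2.le
    rw [norm_smul, Real.norm_of_nonneg (pow_pos hτ.1 2).le] at h1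
    have h4 := mul_le_of_le_one_left (norm_nonneg p.2) h0
    have h2 := mul_le_mul_of_nonneg_right (le_abs_self B) (norm_nonneg (p.1 + τ ^ 2 • p.2))
    have h3 := mul_le_mul_of_nonneg_left (h1.trans (add_le_add_right h4 _)) (abs_nonneg B)
    linarith
  · have : Continuous fun τ : ℝ => h (p.1 + τ ^ 2 • p.2) := by fun_prop
    have := (this.tendsto 0).mono_left (nhdsWithin_le_nhds (s := Ioi 0))
    simpa using this

theorem abs_log_weight_le (z : Vel d) : |Real.log (weight z)| ≤ (d + 3 : ℕ) * ‖z‖ := by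
  rw [log_weight, abs_neg, abs_of_nonneg (mul_nonneg (Nat.cast_nonneg _)
    (log_one_add_norm_nonneg z))]
  exact mul_le_mul_of_nonneg_left (log_one_add_norm_le z) (Nat.cast_nonneg _)

theorem continuous_log_weight : Continuous fun z : Vel d => Real.log (weight z) :=
  continuous_weight.log fun z => (weight_pos z).ne'

/-- Every bounded continuous test function bounds the regularized entropy asymptotically from
below. -/
theorem exists_le_regEntropy (hπ : Integrable (fun v => ‖v‖) π) (Φ : Vel d →ᵇ ℝ) :
    ∃ L : ℝ → ℝ, (∀ τ, 0 < τ → L τ ≤ regEntropy τ π) ∧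
      Tendsto L (𝓝[>] 0) (𝓝 (∫ v, Φ v ∂π + ∫ v, Real.log (weight v) ∂π + 1
        - ∫ v, Real.exp (Φ v) ∂(weightMeasure d))) := by
  -- With this h, exp h = exp Φ · weight. Young's inequality with the regularized density and slope
  -- h gives the lower bound. As h is continuous with at most linear growth, its mollification can
  -- be removed in the limit.
  set h : Vel d → ℝ := fun z => Φ z + Real.log (weight z) with hh
  have hc : Continuous h := Φ.continuous.add continuous_log_weight
  have hb : ∀ z, |h z| ≤ ‖Φ‖ + (d + 3 : ℕ) * ‖z‖ := fun z =>
    (abs_add_le _ _).trans (add_le_add (Φ.norm_coe_le_norm z) (abs_log_weight_le z))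
  have hwi : Integrable fun z => h z * weight z := by
    refine (integrable_one_add_norm_mul_weight.const_mul (‖Φ‖ + (d + 3 : ℕ))).mono'
      (hc.mul continuous_weight).aestronglyMeasurable (ae_of_all _ fun z => ?_)
    rw [norm_mul, Real.norm_of_nonneg (weight_pos z).le, ← mul_assoc]
    refine mul_le_mul_of_nonneg_right ((hb z).trans ?_) (weight_pos z).le
    have h3 := norm_nonneg z
    have h4 : (0 : ℝ) ≤ (d + 3 : ℕ) := Nat.cast_nonneg _
    nlinarith [mul_nonneg (norm_nonneg Φ) h3]
  have hei : Integrable fun z => Real.exp (Φ z) * weight z := by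
    refine (integrable_weight.const_mul (Real.exp ‖Φ‖)).mono'
      ((Real.continuous_exp.comp Φ.continuous).mul continuous_weight).aestronglyMeasurable
      (ae_of_all _ fun z => ?_)
    rw [norm_mul, Real.norm_of_nonneg (weight_pos z).le, Real.norm_of_nonneg (Real.exp_pos _).le]
    exact mul_le_mul_of_nonneg_right (Real.exp_le_exp.2
      ((le_abs_self _).trans (Φ.norm_coe_le_norm z))) (weight_pos z).le
  refine ⟨fun τ => ∫ p, h (p.1 + τ ^ 2 • p.2) ∂(π.prod (gaussMeasure d))
    + τ ^ 2 * (∫ z, h z * weight z) - ∫ v, Real.exp (Φ v) ∂(weightMeasure d)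
    + (1 + τ ^ 2 * ∫ z : Vel d, weight z), fun τ hτ => ?_, ?_⟩
  · have hmi : Integrable fun z => h z * mollify (τ ^ 2) π z :=
      (integrable_mul_mollify_iff π (pow_pos hτ 2) hc.measurable).2
        (integrable_shift_of_linear_growth hc hb hπ _)
    have h1 : Integrable fun z => h z * reg τ π z := by
      refine (hmi.add (hwi.const_mul (τ ^ 2))).congr (ae_of_all _ fun z => ?_)
      simp only [Pi.add_apply, reg]; ring
    have h2 : ∫ z, h z * reg τ π z = ∫ p, h (p.1 + τ ^ 2 • p.2) ∂(π.prod (gaussMeasure d))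
        + τ ^ 2 * (∫ z, h z * weight z) := by
      rw [← integral_mul_mollify π (pow_pos hτ 2) hc.measurable, ← integral_const_mul,
        ← integral_add hmi (hwi.const_mul (τ ^ 2))]
      refine integral_congr_ae (ae_of_all _ fun z => ?_)
      simp only [reg]; ring
    simp only []
    rw [← h2, integral_weightMeasure, ← integral_reg π hτ, ← integral_sub h1 hei]
    have h3 := integral_add (f := fun z => h z * reg τ π z - Real.exp (Φ z) * weight z)
      (h1.sub hei) (integrable_reg π hτ)
    rw [← h3]
    refine integral_mono ((h1.sub hei).add (integrable_reg π hτ))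
      (integrable_log_reg_mul_reg hτ hπ) fun z => ?_
    have h4 := mul_sub_exp_add_one_le_klFun (reg_pos π hτ z).le (h z)
    rw [klFun_apply] at h4
    have h5 : Real.exp (h z) = Real.exp (Φ z) * weight z := by
      rw [hh, Real.exp_add, Real.exp_log (weight_pos z)]
    rw [h5] at h4
    simp only
    linarith
  · have t0 : Tendsto (fun τ : ℝ => τ ^ 2) (𝓝[>] 0) (𝓝 0) := by
      have : Continuous fun τ : ℝ => τ ^ 2 := by fun_prop
      simpa using (this.tendsto 0).mono_left (nhdsWithin_le_nhds (s := Ioi 0))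
    have t1 := tendsto_integral_shift hc hb hπ
    have := (((t1.add (t0.mul_const (∫ z, h z * weight z))).sub_const
      (∫ v, Real.exp (Φ v) ∂(weightMeasure d))).add
      ((t0.mul_const (∫ z : Vel d, weight z)).const_add 1))
    convert this using 2
    rw [hh, integral_add (Φ.integrable π) (integrable_log_weight hπ)]
    ring

end Entropy

/-! ### The entropy as a relative entropy with respect to the weight -/

section EntropyDivergence

variable {d : ℕ}

theorem volume_ac_weightMeasure : (volume : Measure (Vel d)) ≪ weightMeasure d :=
  withDensity_absolutelyContinuous' (by fun_prop)
    (ae_of_all _ fun z => (ENNReal.ofReal_pos.2 (weight_pos z)).ne')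

/-- Written against ν the integrand is the negative part of r log r, which is bounded by 1, and ν is
finite. -/
theorem integrable_min_llr_zero {X : Type*} [MeasurableSpace X] {μ ν : Measure X}
    [IsFiniteMeasure μ] [IsFiniteMeasure ν] (hac : μ ≪ ν) :
    Integrable (fun x => min (llr μ ν x) 0) μ := by
  rw [← integrable_rnDeriv_smul_iff hac]
  have hm : Measurable fun x => (μ.rnDeriv ν x).toReal :=
    (Measure.measurable_rnDeriv μ ν).ennreal_toReal
  refine Integrable.of_bound (hm.smul ((measurable_llr μ ν).min measurable_const)).aestronglyMeasurable
    1 (ae_of_all _ fun x => ?_)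
  set r := (μ.rnDeriv ν x).toReal with hr
  have hr0 : 0 ≤ r := ENNReal.toReal_nonneg
  have hl : llr μ ν x = Real.log r := rfl
  rw [smul_eq_mul, norm_mul, Real.norm_of_nonneg hr0, hl]
  rcases hr0.eq_or_lt with h | h
  · rw [← h]; simp
  rcases le_total r 1 with h1 | h1
  · rw [min_eq_left (Real.log_nonpos hr0 h1)]
    have := Real.abs_log_mul_self_lt r h h1
    rw [abs_mul, abs_of_pos h] at this
    rw [Real.norm_eq_abs, mul_comm]
    exact this.le
  · rw [min_eq_right (Real.log_nonneg h1)]; simp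

/-- The Lebesgue density is the density relative to the weight measure times the weight, and log
`weight` is π-integrable thanks to the first moment. The negative part therefore always has a finite
integral, and both sides are infinite together. This replaces the infinite reference measure by a
finite one, for which the variational formula is available. -/
theorem entropyH_eq (π : ProbabilityMeasure (Vel d))
    (hπ : Integrable (fun v => ‖v‖) (π : Measure (Vel d))) :
    entropyH π = ((klDiv (π : Measure (Vel d)) (weightMeasure d) : ℝ≥0∞) : EReal)
      + ((∫ v, Real.log (weight v) ∂(π : Measure (Vel d)) + 1 - ∫ z : Vel d, weight z : ℝ) : EReal) := by
  set m : Measure (Vel d) := (π : Measure (Vel d)) with hm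
  unfold entropyH
  by_cases hac : m ≪ volume
  swap
  · have : ¬ m ≪ weightMeasure d := fun h => hac (h.trans (withDensity_absolutelyContinuous _ _))
    rw [if_neg hac, klDiv_of_not_ac this, EReal.coe_ennreal_top, EReal.top_add_coe]
  rw [if_pos hac]
  have hacw : m ≪ weightMeasure d := hac.trans volume_ac_weightMeasure
  have hllr : ∀ᵐ v ∂m, Real.log (m.rnDeriv volume v).toReal
      = llr m (weightMeasure d) v + Real.log (weight v) := by
    have h1 := Measure.rnDeriv_withDensity_right m (volume : Measure (Vel d))
      (f := fun z => ENNReal.ofReal (weight z)) (by fun_prop)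
      (ae_of_all _ fun z => (ENNReal.ofReal_pos.2 (weight_pos z)).ne')
      (ae_of_all _ fun z => ENNReal.ofReal_ne_top)
    filter_upwards [hac h1, Measure.rnDeriv_pos hac, hac (Measure.rnDeriv_lt_top m volume)]
      with v h2 h3 h4
    have h5 : 0 < (m.rnDeriv volume v).toReal := ENNReal.toReal_pos h3.ne' h4.ne
    rw [llr, weightMeasure, h2, ENNReal.toReal_mul, ENNReal.toReal_inv,
      ENNReal.toReal_ofReal (weight_pos v).le,
      Real.log_mul (inv_ne_zero (weight_pos v).ne') h5.ne', Real.log_inv]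
    ring
  have hw := integrable_log_weight hπ
  set u : Vel d → ℝ := fun v => Real.log (m.rnDeriv volume v).toReal
  change ∀ᵐ v ∂m, u v = llr m (weightMeasure d) v + Real.log (weight v) at hllr
  have hum : Measurable u := (Measure.measurable_rnDeriv m volume).ennreal_toReal.log
  have hneg : ∫⁻ v, ENNReal.ofReal (-u v) ∂m ≠ ⊤ := by
    have hi : Integrable (fun v => ‖min (llr m (weightMeasure d) v) 0‖ + ‖Real.log (weight v)‖) m :=
      (integrable_min_llr_zero hacw).norm.add hw.norm
    refine ne_top_of_le_ne_top hi.lintegral_lt_top.ne (lintegral_mono_ae ?_)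
    filter_upwards [hllr] with v hv
    refine ENNReal.ofReal_le_ofReal ?_
    rw [hv, Real.norm_eq_abs, Real.norm_eq_abs]
    have h1 := neg_abs_le (Real.log (weight v))
    have h2 := neg_abs_le (min (llr m (weightMeasure d) v) 0)
    have h3 := min_le_left (llr m (weightMeasure d) v) 0
    linarith
  by_cases hint : Integrable (llr m (weightMeasure d)) m
  · have hui : Integrable u m := (hint.add hw).congr (hllr.mono fun v hv => hv.symm)
    have hpos : ∫⁻ v, ENNReal.ofReal (u v) ∂m ≠ ⊤ := hui.lintegral_lt_top.ne
    have h1 := integral_eq_lintegral_pos_part_sub_lintegral_neg_part hui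
    rw [integral_congr_ae hllr, integral_add hint hw] at h1
    have h2 := toReal_klDiv hacw hint
    rw [← EReal.coe_toReal (x := ((klDiv m (weightMeasure d) : ℝ≥0∞) : EReal))
      (by simpa using klDiv_ne_top hacw hint) (by simp), EReal.toReal_coe_ennreal, h2,
      ← ENNReal.ofReal_toReal hpos, ← ENNReal.ofReal_toReal hneg,
      EReal.coe_ennreal_ofReal, EReal.coe_ennreal_ofReal,
      max_eq_left ENNReal.toReal_nonneg, max_eq_left ENNReal.toReal_nonneg,
      ← EReal.coe_sub, ← h1, ← EReal.coe_add, weightMeasure_real_univ]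
    congr 1
    have h1 : m.real univ = 1 := by simp [hm]
    rw [h1]
    ring
  · have hpos : ∫⁻ v, ENNReal.ofReal (u v) ∂m = ⊤ := by
      by_contra hne
      refine hint ?_
      have hui : Integrable u m := by
        refine ⟨hum.aestronglyMeasurable, ?_⟩
        rw [hasFiniteIntegral_iff_norm]
        have hle : ∀ v, ENNReal.ofReal ‖u v‖ ≤ ENNReal.ofReal (u v) + ENNReal.ofReal (-u v) := by
          intro v
          rcases le_total 0 (u v) with h | h
          · rw [Real.norm_of_nonneg h]; exact le_self_add
          · rw [Real.norm_of_nonpos h]; exact le_add_self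
        refine (lintegral_mono hle).trans_lt ?_
        rw [lintegral_add_left (by fun_prop)]
        exact ENNReal.add_lt_top.2 ⟨lt_top_iff_ne_top.2 hne, lt_top_iff_ne_top.2 hneg⟩
      refine (hui.sub hw).congr (hllr.mono fun v hv => ?_)
      simp only [Pi.sub_apply, hv, add_sub_cancel_right]
    rw [hpos, klDiv_of_not_integrable hint, EReal.coe_ennreal_top, EReal.top_add_coe,
      ← ENNReal.ofReal_toReal hneg, EReal.coe_ennreal_ofReal, EReal.top_sub_coe]

end EntropyDivergence

/-! ### Smooth time cutoffs and their derivatives as an approximate identity -/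

section TimeCutoff

theorem deriv_smoothTransition_of_nonpos {u : ℝ} (hu : u < 0) : deriv Real.smoothTransition u = 0 := by
  have : Real.smoothTransition =ᶠ[𝓝 u] fun _ => (0 : ℝ) := by
    filter_upwards [Iio_mem_nhds hu] with r hr
    exact Real.smoothTransition.zero_of_nonpos hr.le
  rw [this.deriv_eq, deriv_const]

theorem deriv_smoothTransition_of_one_lt {u : ℝ} (hu : 1 < u) :
    deriv Real.smoothTransition u = 0 := by
  have : Real.smoothTransition =ᶠ[𝓝 u] fun _ => (1 : ℝ) := by
    filter_upwards [Ioi_mem_nhds hu] with r hr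
    exact Real.smoothTransition.one_of_one_le (mem_Ioi.1 hr).le
  rw [this.deriv_eq, deriv_const]

theorem continuous_deriv_smoothTransition : Continuous (deriv Real.smoothTransition) :=
  (Real.smoothTransition.contDiff (n := 1)).continuous_deriv le_rfl

theorem hasDerivAt_smoothTransition (u : ℝ) :
    HasDerivAt Real.smoothTransition (deriv Real.smoothTransition u) u :=
  ((Real.smoothTransition.contDiff (n := 1)).differentiable one_ne_zero u).hasDerivAt

theorem deriv_smoothTransition_eq_indicator (u : ℝ) :
    deriv Real.smoothTransition u = (Icc 0 1).indicator (deriv Real.smoothTransition) u := by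
  by_cases hu : u ∈ Icc (0 : ℝ) 1
  · rw [indicator_of_mem hu]
  · rw [indicator_of_notMem hu]
    rw [mem_Icc, not_and_or, not_le, not_le] at hu
    rcases hu with h | h
    · exact deriv_smoothTransition_of_nonpos h
    · exact deriv_smoothTransition_of_one_lt h

theorem integrable_deriv_smoothTransition : Integrable (deriv Real.smoothTransition) := by
  rw [show deriv Real.smoothTransition = (Icc 0 1).indicator (deriv Real.smoothTransition) from
    funext deriv_smoothTransition_eq_indicator]
  exact (continuous_deriv_smoothTransition.continuousOn.integrableOn_compact
    isCompact_Icc).integrable_indicator measurableSet_Icc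

theorem integral_deriv_smoothTransition : ∫ u, deriv Real.smoothTransition u = 1 := by
  rw [integral_congr_ae (ae_of_all _ deriv_smoothTransition_eq_indicator),
    integral_indicator measurableSet_Icc, integral_Icc_eq_integral_Ioc,
    ← intervalIntegral.integral_of_le zero_le_one,
    intervalIntegral.integral_deriv_eq_sub (fun u _ => (hasDerivAt_smoothTransition u).differentiableAt)
      (continuous_deriv_smoothTransition.intervalIntegrable _ _)]
  simp

/-- The derivatives of the time cutoffs at `s` form an approximate identity at `s`. -/
theorem tendsto_integral_cutoff {T : ℝ} (hT : 0 ≤ T) {a : Time T → ℝ} (ha : Continuous a)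
    (s : Time T) (hs : (s : ℝ) < T) :
    Tendsto (fun n : ℕ => ∫ t : Time T, ((n + 1 : ℝ) *
      deriv Real.smoothTransition ((n + 1 : ℝ) * ((t : ℝ) - s))) * a t ∂(timeMeasure T)) atTop
      (𝓝 (a s)) := by
  obtain ⟨K, hK⟩ : ∃ K, ∀ t, ‖a t‖ ≤ K := by
    obtain ⟨K, hK⟩ := (isCompact_range ha).isBounded.exists_norm_le
    exact ⟨K, fun t => hK _ (mem_range_self t)⟩
  let A : ℝ → ℝ := fun r => a (projIcc 0 T hT r)
  have hA : Continuous A := ha.comp continuous_projIcc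
  have e : ∀ n : ℕ, ∫ t : Time T, ((n + 1 : ℝ) *
      deriv Real.smoothTransition ((n + 1 : ℝ) * ((t : ℝ) - s))) * a t ∂(timeMeasure T)
      = ∫ u, (Icc 0 T).indicator (fun _ => (1 : ℝ)) (s + u / (n + 1)) *
        (deriv Real.smoothTransition u * A (s + u / (n + 1))) := by
    intro n
    have hn : (0 : ℝ) < n + 1 := by positivity
    let G : ℝ → ℝ := fun r => (Icc 0 T).indicator (fun _ => (1 : ℝ)) r *
      (((n + 1 : ℝ) * deriv Real.smoothTransition ((n + 1 : ℝ) * (r - s))) * A r)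
    have h1 : ∫ t : Time T, ((n + 1 : ℝ) *
        deriv Real.smoothTransition ((n + 1 : ℝ) * ((t : ℝ) - s))) * a t ∂(timeMeasure T)
        = ∫ r, G r := by
      have h2 : ∀ t : Time T, ((n + 1 : ℝ) *
          deriv Real.smoothTransition ((n + 1 : ℝ) * ((t : ℝ) - s))) * a t
          = (fun r => ((n + 1 : ℝ) * deriv Real.smoothTransition ((n + 1 : ℝ) * (r - s))) * A r) t :=
        fun t => by simp only [A, projIcc_val]
      have h3 := integral_subtype_comap (μ := (volume : Measure ℝ)) (measurableSet_Icc (a := 0) (b := T))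
        (fun r => ((n + 1 : ℝ) * deriv Real.smoothTransition ((n + 1 : ℝ) * (r - s))) * A r)
      rw [integral_congr_ae (ae_of_all _ h2), timeMeasure]
      refine h3.trans ?_
      rw [← integral_indicator measurableSet_Icc]
      refine integral_congr_ae (ae_of_all _ fun r => ?_)
      by_cases hr : r ∈ Icc 0 T <;> simp [G, hr]
    -- Substitution r = s + u/(n + 1), after which the cutoff derivative no longer depends on n.
    rw [h1, ← integral_add_left_eq_self G (s : ℝ)]
    have h3 := Measure.integral_comp_div (fun r => G (s + r)) (n + 1 : ℝ)
    rw [abs_of_pos hn, smul_eq_mul] at h3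
    have h4 : ∫ r, G (s + r) = (n + 1 : ℝ)⁻¹ * ∫ u, G (s + u / (n + 1)) := by
      rw [h3, inv_mul_cancel_left₀ hn.ne']
    rw [h4, ← integral_const_mul]
    refine integral_congr_ae (ae_of_all _ fun u => ?_)
    simp only [G, add_sub_cancel_left, mul_div_cancel₀ u hn.ne']
    field_simp
  simp_rw [e]
  have e2 : a s = ∫ u, deriv Real.smoothTransition u * a s := by
    rw [integral_mul_const, integral_deriv_smoothTransition, one_mul]
  have hdiv : ∀ u : ℝ, Tendsto (fun n : ℕ => (s : ℝ) + u / (n + 1)) atTop (𝓝 s) := fun u => by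
    have := (tendsto_const_div_atTop_nhds_zero_nat u).comp (tendsto_add_atTop_nat 1)
    simpa [Function.comp_def] using this.const_add (s : ℝ)
  rw [e2]
  refine tendsto_integral_of_dominated_convergence
    (fun u => ‖deriv Real.smoothTransition u‖ * K) (fun n => ?_)
    (integrable_deriv_smoothTransition.norm.mul_const _) (fun n => ae_of_all _ fun u => ?_)
    (ae_of_all _ fun u => ?_)
  · have h1 : Measurable fun u : ℝ =>
        (Icc 0 T).indicator (fun _ => (1 : ℝ)) ((s : ℝ) + u / (n + 1)) :=
      (measurable_const.indicator measurableSet_Icc).comp (by fun_prop)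
    exact (h1.mul (continuous_deriv_smoothTransition.mul
      (hA.comp (by fun_prop))).measurable).aestronglyMeasurable
  · rw [norm_mul, norm_mul]
    have h1 : ‖(Icc 0 T).indicator (fun _ => (1 : ℝ)) ((s : ℝ) + u / (n + 1))‖ ≤ 1 := by
      by_cases hr : (s : ℝ) + u / (n + 1) ∈ Icc 0 T <;> simp [hr]
    exact (mul_le_of_le_one_left (by positivity) h1).trans
      (mul_le_mul_of_nonneg_left (hK _) (norm_nonneg _))
  -- The derivative of the transition vanishes for u < 0, so only points s + u/(n + 1) to the right
  -- of s matter. They eventually lie in [0,T] because s < T; this one-sidedness also covers s = 0.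
  · by_cases hu : u < 0
    · simp [deriv_smoothTransition_of_nonpos hu]
    push Not at hu
    have h1 : ∀ᶠ n : ℕ in atTop, (s : ℝ) + u / (n + 1) ∈ Icc 0 T := by
      filter_upwards [(hdiv u).eventually (Iio_mem_nhds hs)] with n hn
      exact ⟨add_nonneg s.2.1 (by positivity), (mem_Iio.1 hn).le⟩
    have h2 : Tendsto (fun n : ℕ => deriv Real.smoothTransition u * A (s + u / (n + 1))) atTop
        (𝓝 (deriv Real.smoothTransition u * a s)) := by
      have h3 : A s = a s := by simp only [A, projIcc_val]
      rw [← h3]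
      exact ((hA.tendsto _).comp (hdiv u)).const_mul _
    refine h2.congr' (h1.mono fun n hn => ?_)
    simp only []
    rw [indicator_of_mem hn, one_mul]

end TimeCutoff

/-! ### The balance equation on time intervals, as an identity of measures -/

section Balance

variable {d : ℕ} {T : ℝ}

/-- The collisional gradient of a function of the velocity. -/
def velGrad (h : Vel d → ℝ) (x : FluxSpace d T) : ℝ :=
  h x.2.2.1 + h x.2.2.2 - h x.2.1.1 - h x.2.1.2

theorem continuous_integral_path (P : ProbPath d T) (φ : Vel d →ᵇ ℝ) :
    Continuous fun t => ∫ v, φ v ∂(P t : Measure (Vel d)) :=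
  continuous_iff_continuousAt.2 fun t =>
    (ProbabilityMeasure.tendsto_iff_forall_integral_tendsto.1 (P.continuous.tendsto t)) φ

/-- Test with χ_n(t) φ(v), where χ_n increases from 0 to 1 just after s. The value χ_n(0) = 0
removes the initial term, the time derivative concentrates at s and recovers P_s, and the flux term
converges to the integral over times > s. -/
theorem integral_sub_eq_of_boundedContinuous (hT : 0 ≤ T) {P : ProbPath d T}
    {Q : FiniteMeasure (FluxSpace d T)} (hB : Balance hT P Q) (φ : Vel d →ᵇ ℝ) (s : Time T) :
    ∫ v, φ v ∂(P (t1 hT) : Measure (Vel d)) - ∫ v, φ v ∂(P s : Measure (Vel d))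
      = ∫ x in {x | s < x.1}, velGrad φ x ∂(Q : Measure (FluxSpace d T)) := by
  have hset : MeasurableSet {x : FluxSpace d T | s < x.1} :=
    measurableSet_lt measurable_const measurable_fst
  have hsT : (s : ℝ) ≤ T := s.2.2
  rcases hsT.eq_or_lt with hs | hs
  · have h1 : s = t1 hT := Subtype.ext hs
    have h2 : {x : FluxSpace d T | s < x.1} = ∅ := by
      ext x
      simp only [mem_ofPred_eq, mem_empty_iff_false, iff_false, not_lt]
      exact Subtype.coe_le_coe.1 (x.1.2.2.trans hs.ge)
    rw [h2, h1]; simp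
  have hφg : Continuous (velGrad (T := T) φ) := by
    unfold velGrad
    have := φ.continuous
    fun_prop
  have hφb : ∀ x : FluxSpace d T, ‖velGrad φ x‖ ≤ 4 * ‖φ‖ := fun x => by
    have h1 := φ.norm_coe_le_norm x.2.2.1
    have h2 := φ.norm_coe_le_norm x.2.2.2
    have h3 := φ.norm_coe_le_norm x.2.1.1
    have h4 := φ.norm_coe_le_norm x.2.1.2
    rw [Real.norm_eq_abs, abs_le] at *
    unfold velGrad
    constructor <;> linarith
  let χ : ℕ → C(Time T, ℝ) := fun n =>
    ⟨fun t => Real.smoothTransition ((n + 1 : ℝ) * ((t : ℝ) - s)),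
      Real.smoothTransition.continuous.comp (by fun_prop)⟩
  let χ' : ℕ → C(Time T, ℝ) := fun n =>
    ⟨fun t => (n + 1 : ℝ) * deriv Real.smoothTransition ((n + 1 : ℝ) * ((t : ℝ) - s)),
      (continuous_deriv_smoothTransition.comp (by fun_prop)).const_mul _⟩
  let lift : C(Time T, ℝ) → ((Time T × Vel d) →ᵇ ℝ) := fun c =>
    (BoundedContinuousFunction.mkOfCompact c).compContinuous ⟨Prod.fst, continuous_fst⟩
      * φ.compContinuous ⟨Prod.snd, continuous_snd⟩
  have hlift : ∀ c t v, lift c (t, v) = c t * φ v := fun c t v => rfl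
  have hderiv : ∀ n, IsTimeDeriv hT (lift (χ n)) (lift (χ' n)) := by
    intro n t v
    rw [hlift]
    have h1 : HasDerivAt (fun r : ℝ => Real.smoothTransition ((n + 1 : ℝ) * (r - s)) * φ v)
        (χ' n t * φ v) t := by
      have h2 : HasDerivAt (fun r : ℝ => (n + 1 : ℝ) * (r - s)) ((n + 1 : ℝ) * 1) t :=
        ((hasDerivAt_id (t : ℝ)).sub_const _).const_mul _
      have h3 := ((hasDerivAt_smoothTransition ((n + 1 : ℝ) * (t - s))).comp (t : ℝ) h2).mul_const
        (φ v)
      refine h3.congr_deriv ?_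
      change _ = ((n + 1 : ℝ) * deriv Real.smoothTransition ((n + 1 : ℝ) * ((t : ℝ) - s))) * φ v
      ring
    refine h1.hasDerivWithinAt.congr (fun r hr => ?_) ?_
    · rw [hlift]; simp only [χ, ContinuousMap.coe_mk, projIcc_of_mem hT hr]
    · rw [hlift]; simp only [χ, ContinuousMap.coe_mk, projIcc_val]
  have hbal := fun n => hB _ _ (hderiv n)
  simp only [hlift, collisionGrad] at hbal
  have hχ0 : ∀ n, χ n (t0 hT) = 0 := fun n => by
    refine Real.smoothTransition.zero_of_nonpos ?_
    have : (0 : ℝ) ≤ s := s.2.1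
    have hn : (0 : ℝ) ≤ n + 1 := by positivity
    change (n + 1 : ℝ) * (0 - (s : ℝ)) ≤ 0
    nlinarith
  have hlim : ∀ t : Time T, Tendsto (fun n => χ n t) atTop
      (𝓝 (if s < t then 1 else 0)) := by
    intro t
    split_ifs with h
    · have h0 : 0 < (t : ℝ) - s := sub_pos.2 h
      have h1 : Tendsto (fun n : ℕ => (n + 1 : ℝ) * ((t : ℝ) - s)) atTop atTop :=
        (tendsto_atTop_add_const_right _ _ tendsto_natCast_atTop_atTop).atTop_mul_const h0
      refine tendsto_const_nhds.congr' ?_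
      filter_upwards [h1.eventually_ge_atTop 1] with n hn
      exact (Real.smoothTransition.one_of_one_le hn).symm
    · have h0 : (t : ℝ) - s ≤ 0 := sub_nonpos.2 (not_lt.1 h)
      refine tendsto_const_nhds.congr fun n => ?_
      refine (Real.smoothTransition.zero_of_nonpos ?_).symm
      have hn : (0 : ℝ) ≤ n + 1 := by positivity
      exact mul_nonpos_of_nonneg_of_nonpos hn h0
  have hχb : ∀ n t, ‖χ n t‖ ≤ 1 := fun n t => by
    change ‖Real.smoothTransition ((n + 1 : ℝ) * ((t : ℝ) - s))‖ ≤ 1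
    rw [Real.norm_of_nonneg (Real.smoothTransition.nonneg _)]
    exact Real.smoothTransition.le_one _
  have hR : Tendsto (fun n => ∫ x : FluxSpace d T, (χ n x.1 * φ x.2.2.1 + χ n x.1 * φ x.2.2.2
      - χ n x.1 * φ x.2.1.1 - χ n x.1 * φ x.2.1.2) ∂(Q : Measure (FluxSpace d T))) atTop
      (𝓝 (∫ x in {x | s < x.1}, velGrad φ x ∂(Q : Measure (FluxSpace d T)))) := by
    rw [← integral_indicator hset]
    have e : ∀ n (x : FluxSpace d T), χ n x.1 * φ x.2.2.1 + χ n x.1 * φ x.2.2.2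
      - χ n x.1 * φ x.2.1.1 - χ n x.1 * φ x.2.1.2 = χ n x.1 * velGrad φ x := fun n x => by
      unfold velGrad; ring
    simp_rw [e]
    refine tendsto_integral_of_dominated_convergence (fun _ => 4 * ‖φ‖) (fun n => ?_)
      (integrable_const _) (fun n => ae_of_all _ fun x => ?_) (ae_of_all _ fun x => ?_)
    · exact (((χ n).continuous.comp continuous_fst).mul hφg).aestronglyMeasurable
    · rw [norm_mul]
      exact (mul_le_of_le_one_left (norm_nonneg _) (hχb n _)).trans (hφb x)
    · have := (hlim x.1).mul_const (velGrad φ x)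
      by_cases h : s < x.1
      · rw [indicator_of_mem (by exact h)]; simpa [h] using this
      · rw [indicator_of_notMem (by exact h)]; simpa [h] using this
  refine tendsto_nhds_unique ?_ hR
  simp_rw [← hbal, hχ0]
  have h1 : Tendsto (fun n => χ n (t1 hT)) atTop (𝓝 1) := by
    have := hlim (t1 hT)
    rwa [if_pos (by exact hs)] at this
  have h2 := tendsto_integral_cutoff hT (continuous_integral_path P φ) s hs
  have h3 := ((h1.mul_const (∫ v, φ v ∂(P (t1 hT) : Measure (Vel d)))).sub_const 0).sub h2
  simp only [one_mul, sub_zero] at h3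
  refine h3.congr fun n => ?_
  simp only [integral_const_mul, zero_mul, integral_zero, sub_zero, χ', ContinuousMap.coe_mk]

/-- Integrability of a function of the velocity with respect to the four velocity marginals. -/
def FluxIntegrable (Q : Measure (FluxSpace d T)) (h : Vel d → ℝ) : Prop :=
  Integrable (fun x => h x.2.1.1) Q ∧ Integrable (fun x => h x.2.1.2) Q ∧
    Integrable (fun x => h x.2.2.1) Q ∧ Integrable (fun x => h x.2.2.2) Q

theorem FluxIntegrable.velGrad {Q : Measure (FluxSpace d T)} {h : Vel d → ℝ}
    (H : FluxIntegrable Q h) : Integrable (velGrad h) Q :=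
  ((H.2.2.1.add H.2.2.2).sub H.1).sub H.2.1

theorem FluxIntegrable.integral_velGrad {Q : Measure (FluxSpace d T)} {h : Vel d → ℝ}
    (H : FluxIntegrable Q h) : ∫ x, HBE.velGrad h x ∂Q
      = ∫ x, h x.2.2.1 ∂Q + ∫ x, h x.2.2.2 ∂Q - ∫ x, h x.2.1.1 ∂Q - ∫ x, h x.2.1.2 ∂Q := by
  rw [← integral_add H.2.2.1 H.2.2.2,
    ← integral_sub (f := fun x => h x.2.2.1 + h x.2.2.2) (H.2.2.1.add H.2.2.2) H.1,
    ← integral_sub (f := fun x => h x.2.2.1 + h x.2.2.2 - h x.2.1.1)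
      ((H.2.2.1.add H.2.2.2).sub H.1) H.2.1]
  rfl

theorem FluxIntegrable.restrict {Q : Measure (FluxSpace d T)} {h : Vel d → ℝ}
    (H : FluxIntegrable Q h) (A : Set (FluxSpace d T)) : FluxIntegrable (Q.restrict A) h :=
  ⟨H.1.integrableOn, H.2.1.integrableOn, H.2.2.1.integrableOn, H.2.2.2.integrableOn⟩

/-- The balance equation as an equality of measures. -/
theorem balance_measure (hT : 0 ≤ T) {P : ProbPath d T}
    {Q : FiniteMeasure (FluxSpace d T)} (hB : Balance hT P Q) (s : Time T) :
    (P (t1 hT) : Measure (Vel d))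
      + ((Q : Measure (FluxSpace d T)).restrict {x | s < x.1}).map (fun x => x.2.1.1)
      + ((Q : Measure (FluxSpace d T)).restrict {x | s < x.1}).map (fun x => x.2.1.2)
    = (P s : Measure (Vel d))
      + ((Q : Measure (FluxSpace d T)).restrict {x | s < x.1}).map (fun x => x.2.2.1)
      + ((Q : Measure (FluxSpace d T)).restrict {x | s < x.1}).map (fun x => x.2.2.2) := by
  -- With gains and losses on opposite sides, both sides are finite positive measures, which bounded
  -- continuous functions separate. Unbounded test functions can then be integrated without
  -- truncation.
  refine ext_of_forall_integral_eq_of_IsFiniteMeasure fun φ => ?_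
  have h := integral_sub_eq_of_boundedContinuous hT hB φ s
  have hi : ∀ (m : Measure (Vel d)) [IsFiniteMeasure m], Integrable φ m := fun m _ => φ.integrable m
  have hj : ∀ u : FluxSpace d T → Vel d, Measurable u → Integrable (fun x => φ (u x))
      ((Q : Measure (FluxSpace d T)).restrict {x | s < x.1}) := fun u hu =>
    Integrable.of_bound (φ.continuous.measurable.comp hu).aestronglyMeasurable ‖φ‖
      (ae_of_all _ fun x => φ.norm_coe_le_norm _)
  rw [integral_add_measure (hi _) (hi _), integral_add_measure (hi _) (hi _),
    integral_add_measure (hi _) (hi _), integral_add_measure (hi _) (hi _),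
    integral_map (by fun_prop) φ.continuous.aestronglyMeasurable,
    integral_map (by fun_prop) φ.continuous.aestronglyMeasurable,
    integral_map (by fun_prop) φ.continuous.aestronglyMeasurable,
    integral_map (by fun_prop) φ.continuous.aestronglyMeasurable]
  have H : FluxIntegrable ((Q : Measure (FluxSpace d T)).restrict {x | s < x.1}) φ :=
    ⟨hj _ (by fun_prop), hj _ (by fun_prop), hj _ (by fun_prop), hj _ (by fun_prop)⟩
  rw [H.integral_velGrad] at h
  linarith

theorem balance_interval (hT : 0 ≤ T) {P : ProbPath d T}
    {Q : FiniteMeasure (FluxSpace d T)} (hB : Balance hT P Q) {h : Vel d → ℝ} (hm : Measurable h)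
    (hP : ∀ t, Integrable h (P t : Measure (Vel d)))
    (hQ : FluxIntegrable (Q : Measure (FluxSpace d T)) h) {s t : Time T} (hst : s ≤ t) :
    ∫ v, h v ∂(P t : Measure (Vel d)) - ∫ v, h v ∂(P s : Measure (Vel d))
      = ∫ x in {x | s < x.1 ∧ x.1 ≤ t}, velGrad h x ∂(Q : Measure (FluxSpace d T)) := by
  have key : ∀ s : Time T, ∫ v, h v ∂(P (t1 hT) : Measure (Vel d)) - ∫ v, h v ∂(P s : Measure (Vel d))
      = ∫ x in {x | s < x.1}, velGrad h x ∂(Q : Measure (FluxSpace d T)) := by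
    intro s
    have e := congrArg (fun m => ∫ v, h v ∂m) (balance_measure hT hB s)
    have hmap : ∀ u : FluxSpace d T → Vel d, Measurable u → Integrable (fun x => h (u x)) (Q : Measure (FluxSpace d T)) →
        Integrable h (((Q : Measure (FluxSpace d T)).restrict {x | s < x.1}).map u) := fun u hu hi =>
      (integrable_map_measure hm.aestronglyMeasurable hu.aemeasurable).2 hi.integrableOn
    have m1 := hmap (fun x => x.2.1.1) (by fun_prop) hQ.1
    have m2 := hmap (fun x => x.2.1.2) (by fun_prop) hQ.2.1
    have m3 := hmap (fun x => x.2.2.1) (by fun_prop) hQ.2.2.1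
    have m4 := hmap (fun x => x.2.2.2) (by fun_prop) hQ.2.2.2
    rw [integral_add_measure ((hP _).add_measure m1) m2, integral_add_measure (hP _) m1,
      integral_add_measure ((hP _).add_measure m3) m4, integral_add_measure (hP _) m3,
      integral_map (by fun_prop) hm.aestronglyMeasurable,
      integral_map (by fun_prop) hm.aestronglyMeasurable,
      integral_map (by fun_prop) hm.aestronglyMeasurable,
      integral_map (by fun_prop) hm.aestronglyMeasurable] at e
    rw [(hQ.restrict _).integral_velGrad]
    linarith
  have hs := key s
  have ht := key t
  have hset : {x : FluxSpace d T | s < x.1} = {x | s < x.1 ∧ x.1 ≤ t} ∪ {x | t < x.1} := by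
    ext x
    simp only [mem_ofPred_eq, mem_union]
    constructor
    · intro hx
      rcases le_or_gt x.1 t with h | h
      · exact Or.inl ⟨hx, h⟩
      · exact Or.inr h
    · rintro (h | h)
      · exact h.1
      · exact hst.trans_lt h
  have hdisj : Disjoint {x : FluxSpace d T | s < x.1 ∧ x.1 ≤ t} {x | t < x.1} :=
    Set.disjoint_left.2 fun x hx hx' => not_lt.2 hx.2 hx'
  have hmeas : MeasurableSet {x : FluxSpace d T | t < x.1} :=
    measurableSet_lt measurable_const measurable_fst
  rw [hset, setIntegral_union hdisj hmeas hQ.velGrad.integrableOn hQ.velGrad.integrableOn] at hs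
  linarith

end Balance

/-! ### Riemann sums in time with respect to a general measure -/

section Partition

/-- Riemann sums over partitions: an increment bound on subintervals integrates to `[0,T]`. -/
theorem integral_le_of_increments {T : ℝ} (hT : 0 < T) {X : Type*} [MeasurableSpace X]
    {m : Measure X} [IsFiniteMeasure m] {clock : X → Time T} (hclock : Measurable clock)
    {S : Time T → ℝ} {K : Time T → X → ℝ} {b : X → ℝ} (hb : Integrable b m)
    (hKb : ∀ t x, |K t x| ≤ b x) (hKm : ∀ t, Measurable (K t))
    (hKc : ∀ x, Continuous fun t => K t x) {pick : Time T → Time T → Time T}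
    (hpick : ∀ s t, s ≤ t → s ≤ pick s t ∧ pick s t ≤ t)
    (hinc : ∀ s t, s ≤ t →
      ∫ x in {x | s < clock x ∧ clock x ≤ t}, K (pick s t) x ∂m ≤ S t - S s)
    (h0 : m {x | clock x = t0 hT.le} = 0) :
    ∫ x, K (clock x) x ∂m ≤ S (t1 hT.le) - S (t0 hT.le) := by
  let u : ℕ → ℕ → Time T := fun n k => projIcc 0 T hT.le (k * T / (n + 1))
  have hu_mono : ∀ n, Monotone (u n) := fun n j k hjk => by
    refine monotone_projIcc hT.le ?_
    have : (j : ℝ) ≤ k := by exact_mod_cast hjk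
    gcongr
  have hu_val : ∀ n k, k ≤ n + 1 → (u n k : ℝ) = k * T / (n + 1) := fun n k hk => by
    have hk' : (k : ℝ) ≤ n + 1 := by exact_mod_cast hk
    have hn : (0 : ℝ) < n + 1 := by positivity
    have : (k : ℝ) * T / (n + 1) ∈ Icc 0 T := ⟨by positivity, by
      rw [div_le_iff₀ hn, mul_comm]; exact mul_le_mul_of_nonneg_left hk' hT.le⟩
    simp only [u, projIcc_of_mem hT.le this]
  -- The half-open cells cover (0,T] and miss time 0, hence the hypothesis that time 0 carries no
  -- mass.
  let A : ℕ → ℕ → Set X := fun n k => {x | u n k < clock x ∧ clock x ≤ u n (k + 1)}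
  have hA : ∀ n k, MeasurableSet (A n k) := fun n k =>
    (measurableSet_lt (f := fun _ => u n k) measurable_const hclock).inter
      (measurableSet_le (g := fun _ => u n (k + 1)) hclock measurable_const)
  let r : ℕ → ℕ → Time T := fun n k => pick (u n k) (u n (k + 1))
  let F : ℕ → X → ℝ := fun n x => ∑ k ∈ Finset.range (n + 1), (A n k).indicator (K (r n k)) x
  have hKi : ∀ t, Integrable (K t) m := fun t =>
    hb.mono' (hKm t).aestronglyMeasurable (ae_of_all _ (hKb t))
  have hFint : ∀ n, ∫ x, F n x ∂m ≤ S (t1 hT.le) - S (t0 hT.le) := by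
    intro n
    have hn : (0 : ℝ) < n + 1 := by positivity
    have e0 : u n 0 = t0 hT.le := Subtype.ext (by
      rw [hu_val n 0 (Nat.zero_le _)]; simp [t0])
    have e1 : u n (n + 1) = t1 hT.le := Subtype.ext (by
      rw [hu_val n (n + 1) le_rfl]; push_cast; simp only [t1]; field_simp)
    simp only [F]
    rw [integral_finsetSum _ fun k _ => (hKi _).indicator (hA n k)]
    calc ∑ k ∈ Finset.range (n + 1), ∫ x, (A n k).indicator (K (r n k)) x ∂m
        ≤ ∑ k ∈ Finset.range (n + 1), (S (u n (k + 1)) - S (u n k)) := by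
          refine Finset.sum_le_sum fun k _ => ?_
          rw [integral_indicator (hA n k)]
          exact hinc _ _ (hu_mono n (Nat.le_succ k))
      _ = S (t1 hT.le) - S (t0 hT.le) := by
          rw [Finset.sum_range_sub (fun k => S (u n k)), e0, e1]
  -- At a fixed x only the cell containing its time contributes, so the sum collapses to K at one
  -- sampling time within one mesh width of `clock x`. Below, α is the time in mesh units, and the
  -- cell index is ⌈α⌉ - 1 because cells are closed on the right.
  have hFx : ∀ (n : ℕ) (x : X), t0 hT.le < clock x →
      ∃ s : Time T, |(s : ℝ) - clock x| ≤ T / (n + 1) ∧ F n x = K s x := by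
    intro n x hx
    have hn : (0 : ℝ) < n + 1 := by positivity
    have hx0 : (0 : ℝ) < clock x := hx
    have hxT : (clock x : ℝ) ≤ T := (clock x).2.2
    set α : ℝ := (clock x : ℝ) * (n + 1) / T with hα
    have hα0 : 0 < α := by positivity
    have hαn : α ≤ n + 1 := by rw [hα, div_le_iff₀ hT, mul_comm]; gcongr
    have hmem : ∀ k : ℕ, k < n + 1 → (x ∈ A n k ↔ (k : ℝ) < α ∧ α ≤ k + 1) := by
      intro k hk
      have h1 : x ∈ A n k ↔ (u n k : ℝ) < clock x ∧ (clock x : ℝ) ≤ u n (k + 1) := Iff.rfl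
      rw [h1, hu_val n k hk.le, hu_val n (k + 1) hk, div_lt_iff₀ hn, le_div_iff₀ hn, hα,
        lt_div_iff₀ hT, div_le_iff₀ hT]
      push_cast
      exact Iff.rfl
    obtain ⟨k, hk⟩ : ∃ k, ⌈α⌉₊ = k + 1 :=
      Nat.exists_eq_succ_of_ne_zero (Nat.ceil_pos.2 hα0).ne'
    have hk1 : α ≤ k + 1 := by have := Nat.le_ceil α; rw [hk] at this; exact_mod_cast this
    have hk2 : (k : ℝ) < α := by
      have := Nat.ceil_lt_add_one hα0.le
      rw [hk] at this; push_cast at this; linarith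
    have hkn : k < n + 1 := by
      have : (k : ℝ) < ((n + 1 : ℕ) : ℝ) := by push_cast; linarith
      exact_mod_cast this
    have hxk : x ∈ A n k := (hmem k hkn).2 ⟨hk2, hk1⟩
    have hp := hpick _ _ (hu_mono n (Nat.le_succ k))
    have hp1 : (u n k : ℝ) ≤ r n k := hp.1
    have hp2 : (r n k : ℝ) ≤ u n (k + 1) := hp.2
    have hx1 : (u n k : ℝ) < clock x := hxk.1
    have hx2 : (clock x : ℝ) ≤ u n (k + 1) := hxk.2
    rw [hu_val n k hkn.le] at hp1 hx1
    rw [hu_val n (k + 1) hkn] at hp2 hx2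
    push_cast at hp2 hx2
    have hstep : ((k : ℝ) + 1) * T / (n + 1) = k * T / (n + 1) + T / (n + 1) := by ring
    refine ⟨r n k, ?_, ?_⟩
    · rw [abs_le]; constructor <;> linarith
    · simp only [F]
      rw [Finset.sum_eq_single k, indicator_of_mem hxk]
      · intro j hj hjk
        refine indicator_of_notMem (fun hxj => hjk ?_) _
        obtain ⟨h1, h2⟩ := (hmem j (Finset.mem_range.1 hj)).1 hxj
        have h3 : (j : ℝ) < ((k + 1 : ℕ) : ℝ) := by push_cast; linarith
        have h4 : (k : ℝ) < ((j + 1 : ℕ) : ℝ) := by push_cast; linarith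
        rw [Nat.cast_lt] at h3 h4
        omega
      · intro h; exact absurd (Finset.mem_range.2 hkn) h
  have hpos : ∀ᵐ x ∂m, t0 hT.le < clock x := by
    filter_upwards [measure_eq_zero_iff_ae_notMem.1 h0] with x hx
    exact lt_of_le_of_ne (Subtype.coe_le_coe.1 (clock x).2.1) (Ne.symm hx)
  refine le_of_tendsto' (tendsto_integral_of_dominated_convergence (F := F) b (fun n => ?_) hb
    (fun n => hpos.mono fun x hx => ?_) (hpos.mono fun x hx => ?_)) hFint
  · exact (Finset.measurable_fun_sum _ fun k _ => (hKm _).indicator (hA n k)).aestronglyMeasurable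
  · obtain ⟨s, -, hs⟩ := hFx n x hx
    rw [hs]; exact hKb s x
  · choose s hs1 hs2 using fun n => hFx n x hx
    simp_rw [hs2]
    have hs : Tendsto s atTop (𝓝 (clock x)) := by
      rw [tendsto_subtype_rng, tendsto_iff_dist_tendsto_zero]
      have h1 : Tendsto (fun n : ℕ => T / (n + 1 : ℝ)) atTop (𝓝 0) := by
        have := (tendsto_const_div_atTop_nhds_zero_nat T).comp (tendsto_add_atTop_nat 1)
        simpa [Function.comp_def] using this
      exact squeeze_zero (fun n => dist_nonneg) (fun n => by rw [Real.dist_eq]; exact hs1 n) h1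
    exact ((hKc x).tendsto _).comp hs

end Partition

/-! ### Chain rule for the regularized entropy along a measure-flux pair -/

section ChainRule

variable {d : ℕ} {T τ : ℝ} (P : ProbPath d T)

theorem continuous_reg_path (hτ : 0 < τ) (z : Vel d) :
    Continuous fun t => reg τ (P t : Measure (Vel d)) z := by
  have hs := pow_pos hτ 2
  let φ : Vel d →ᵇ ℝ := BoundedContinuousFunction.ofNormedAddCommGroup
    (fun v => gaussScaled (τ ^ 2) (z - v)) (by fun_prop) (((τ ^ 2) ^ d)⁻¹) (fun v => by
      rw [Real.norm_of_nonneg (gaussScaled_pos hs _).le]; exact gaussScaled_le hs _)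
  exact (continuous_integral_path P φ).add continuous_const

/-- For fixed z the Gaussian kernel is a bounded continuous test function, so weak continuity of the
path makes `reg` continuous in time. The logarithmic bound, uniform in time, then passes this to the
Gaussian average. -/
theorem continuous_pot_path (hτ : 0 < τ) (v : Vel d) :
    Continuous fun t => pot τ (P t : Measure (Vel d)) v := by
  refine continuous_of_dominated (bound := fun y => logBound d τ
    + (d + 3 : ℕ) * (Real.log (1 + ‖v‖) + τ ^ 2 * ‖y‖)) (fun t => ?_)
    (fun t => ae_of_all _ fun y => abs_log_reg_add_le _ hτ v y) ?_ (ae_of_all _ fun y => ?_)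
  · exact (integrable_log_reg_add _ hτ v).aestronglyMeasurable
  · exact (integrable_const _).add
      (((integrable_const _).add (integrable_norm_gaussMeasure.const_mul _)).const_mul _)
  · exact (continuous_reg_path P hτ _).log fun t => (reg_pos _ hτ _).ne'

theorem measurable_reg_path (hτ : 0 < τ) :
    Measurable (Function.uncurry fun (t : Time T) z => reg τ (P t : Measure (Vel d)) z) :=
  measurable_uncurry_of_continuous_of_measurable (fun z => continuous_reg_path P hτ z)
    fun _ => measurable_reg _

theorem measurable_pot_path (hτ : 0 < τ) :
    Measurable (Function.uncurry fun (t : Time T) v => pot τ (P t : Measure (Vel d)) v) :=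
  measurable_uncurry_of_continuous_of_measurable (fun v => continuous_pot_path P hτ v)
    fun _ => measurable_pot _

/-- The collisional gradient of the mollified logarithm along the path. -/
noncomputable def potGrad (τ : ℝ) (P : ProbPath d T) (x : FluxSpace d T) : ℝ :=
  velGrad (pot τ (P x.1 : Measure (Vel d))) x

theorem measurable_potGrad (hτ : 0 < τ) : Measurable (potGrad τ P) := by
  have h := measurable_pot_path P hτ
  have hc : ∀ w : FluxSpace d T → Vel d, Measurable w →
      Measurable fun x : FluxSpace d T => pot τ (P x.1 : Measure (Vel d)) (w x) := fun w hw =>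
    h.comp (measurable_fst.prodMk hw)
  exact (((hc _ (by fun_prop)).add (hc _ (by fun_prop))).sub (hc _ (by fun_prop))).sub
    (hc _ (by fun_prop))

/-- An upper bound of the collisional gradient of the mollified logarithm. -/
noncomputable def potGradBound (τ : ℝ) (x : FluxSpace d T) : ℝ :=
  4 * (logBound d τ + (d + 3 : ℕ) * (τ ^ 2 * gaussMoment d))
    + (d + 3 : ℕ) * (Real.log (1 + ‖x.2.2.1‖) + Real.log (1 + ‖x.2.2.2‖)
      + Real.log (1 + ‖x.2.1.1‖) + Real.log (1 + ‖x.2.1.2‖))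

theorem abs_velGrad_pot_le (hτ : 0 < τ) (π : Measure (Vel d)) [IsProbabilityMeasure π]
    (x : FluxSpace d T) : |velGrad (pot τ π) x| ≤ potGradBound τ x := by
  have h1 := abs_le.1 (abs_pot_le π hτ x.2.2.1)
  have h2 := abs_le.1 (abs_pot_le π hτ x.2.2.2)
  have h3 := abs_le.1 (abs_pot_le π hτ x.2.1.1)
  have h4 := abs_le.1 (abs_pot_le π hτ x.2.1.2)
  unfold velGrad potGradBound
  rw [abs_le]; constructor <;> linarith

theorem integrable_potGradBound {Q : Measure (FluxSpace d T)} [IsFiniteMeasure Q]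
    (hQ : FluxIntegrable Q fun v => Real.log (1 + ‖v‖)) : Integrable (potGradBound τ) Q :=
  (integrable_const _).add ((((hQ.2.2.1.add hQ.2.2.2).add hQ.1).add hQ.2.1).const_mul _)

theorem integrable_potGrad (hτ : 0 < τ) {Q : Measure (FluxSpace d T)} [IsFiniteMeasure Q]
    (hQ : FluxIntegrable Q fun v => Real.log (1 + ‖v‖)) : Integrable (potGrad τ P) Q :=
  (integrable_potGradBound (τ := τ) hQ).mono' (measurable_potGrad P hτ).aestronglyMeasurable
    (ae_of_all _ fun x => abs_velGrad_pot_le hτ _ x)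

/-- The chain rule for the regularized entropy along a measure-flux pair. -/
theorem regEntropy_sub_eq (hT : 0 < T) (hτ : 0 < τ) {P : ProbPath d T}
    {Q : FiniteMeasure (FluxSpace d T)} (hB : Balance hT.le P Q)
    (hP : ∀ t, Integrable (fun v => ‖v‖) (P t : Measure (Vel d)))
    (hQ : FluxIntegrable (Q : Measure (FluxSpace d T)) fun v => Real.log (1 + ‖v‖))
    (h0 : (Q : Measure (FluxSpace d T)) {x | x.1 = t0 hT.le} = 0) :
    regEntropy τ (P (t1 hT.le) : Measure (Vel d)) - regEntropy τ (P (t0 hT.le) : Measure (Vel d))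
      = ∫ x, potGrad τ P x ∂(Q : Measure (FluxSpace d T)) := by
  have hinc : ∀ r s t : Time T, s ≤ t →
      ∫ x in {x | s < x.1 ∧ x.1 ≤ t}, velGrad (pot τ (P r : Measure (Vel d))) x
        ∂(Q : Measure (FluxSpace d T))
      = ∫ v, pot τ (P r : Measure (Vel d)) v ∂(P t : Measure (Vel d))
        - ∫ v, pot τ (P r : Measure (Vel d)) v ∂(P s : Measure (Vel d)) := fun r s t hst =>
    (balance_interval hT.le hB (measurable_pot _) (fun t => integrable_pot hτ (hP t))
      ⟨integrable_pot_comp _ hτ (by fun_prop) hQ.1, integrable_pot_comp _ hτ (by fun_prop) hQ.2.1,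
        integrable_pot_comp _ hτ (by fun_prop) hQ.2.2.1,
        integrable_pot_comp _ hτ (by fun_prop) hQ.2.2.2⟩ hst).symm
  have hm : ∀ t, Measurable fun x : FluxSpace d T => velGrad (pot τ (P t : Measure (Vel d))) x := by
    intro t
    have := measurable_pot (P t : Measure (Vel d)) (τ := τ)
    unfold velGrad
    fun_prop
  have hc : ∀ x : FluxSpace d T, Continuous fun t => velGrad (pot τ (P t : Measure (Vel d))) x :=
    fun x => (((continuous_pot_path P hτ _).add (continuous_pot_path P hτ _)).sub
      (continuous_pot_path P hτ _)).sub (continuous_pot_path P hτ _)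
  -- Convexity bounds an increment from (s,t] above by the potential at t and below by the potential
  -- at s. The two bounds differ only in the sampling point, and both sums converge to the same
  -- integral.
  refine le_antisymm ?_ ?_
  · have := integral_le_of_increments hT (m := (Q : Measure (FluxSpace d T))) (clock := Prod.fst)
      measurable_fst (S := fun t => -regEntropy τ (P t : Measure (Vel d)))
      (K := fun t x => -velGrad (pot τ (P t : Measure (Vel d))) x)
      (integrable_potGradBound (τ := τ) hQ)
      (fun t x => by rw [abs_neg]; exact abs_velGrad_pot_le hτ _ x) (fun t => (hm t).neg)
      (fun x => (hc x).neg) (pick := fun _ t => t) (fun s t hst => ⟨hst, le_rfl⟩)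
      (fun s t hst => by
        rw [integral_neg, hinc t s t hst]
        have := integral_pot_sub_le (π := (P t : Measure (Vel d))) (ρ := (P s : Measure (Vel d)))
          hτ (hP t) (hP s)
        linarith) h0
    rw [integral_neg] at this
    unfold potGrad
    linarith
  · exact integral_le_of_increments hT (m := (Q : Measure (FluxSpace d T))) (clock := Prod.fst)
      measurable_fst (S := fun t => regEntropy τ (P t : Measure (Vel d)))
      (K := fun t x => velGrad (pot τ (P t : Measure (Vel d))) x)
      (integrable_potGradBound (τ := τ) hQ)
      (fun t x => abs_velGrad_pot_le hτ _ x) hm hc (pick := fun s _ => s)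
      (fun s t hst => ⟨le_rfl, hst⟩)
      (fun s t hst => by
        rw [hinc s s t hst]
        exact integral_pot_sub_le hτ (hP s) (hP t)) h0

end ChainRule

/-! ### The collision map: linear involution, conservation laws and invariant measures -/

section Collision

variable {d : ℕ}

theorem inner_collide (p : Vel d × Vel d) {ω : Vel d} (hω : ‖ω‖ = 1) :
    inner ℝ ((collide p ω).1 - (collide p ω).2) ω = -inner ℝ (p.1 - p.2) ω := by
  have h : (collide p ω).1 - (collide p ω).2
      = (p.1 - p.2) - (2 * inner ℝ (p.1 - p.2) ω) • ω := by
    simp only [collide]; module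
  rw [h, inner_sub_left, real_inner_smul_left, real_inner_self_eq_norm_sq, hω]
  ring

theorem collide_collide (p : Vel d × Vel d) {ω : Vel d} (hω : ‖ω‖ = 1) :
    collide (collide p ω) ω = p := by
  have h := inner_collide p hω
  conv_lhs => rw [collide, h]
  simp only [collide]
  ext1 <;> simp

theorem hardSphere_collide (p : Vel d × Vel d) {ω : Vel d} (hω : ‖ω‖ = 1) :
    hardSphere ((collide p ω).1 - (collide p ω).2) ω = hardSphere (p.1 - p.2) ω := by
  rw [hardSphere, inner_collide p hω, abs_neg, hardSphere]

theorem norm_sq_collide (p : Vel d × Vel d) {ω : Vel d} (hω : ‖ω‖ = 1) :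
    ‖(collide p ω).1‖ ^ 2 + ‖(collide p ω).2‖ ^ 2 = ‖p.1‖ ^ 2 + ‖p.2‖ ^ 2 := by
  simp only [collide]
  rw [norm_sub_sq_real, norm_add_sq_real, norm_smul, hω, inner_smul_right, inner_smul_right,
    mul_one, Real.norm_eq_abs, sq_abs, inner_sub_left]
  ring

theorem norm_collide_le (p : Vel d × Vel d) {ω : Vel d} (hω : ‖ω‖ = 1) :
    ‖(collide p ω).1‖ ≤ ‖p.1‖ + ‖p.2‖ ∧ ‖(collide p ω).2‖ ≤ ‖p.1‖ + ‖p.2‖ := by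
  have h := norm_sq_collide p hω
  have h1 := norm_nonneg p.1
  have h2 := norm_nonneg p.2
  have h3 := mul_nonneg h1 h2
  constructor
  · refine abs_le_of_sq_le_sq' ?_ (by positivity) |>.2
    nlinarith [sq_nonneg ‖(collide p ω).2‖]
  · refine abs_le_of_sq_le_sq' ?_ (by positivity) |>.2
    nlinarith [sq_nonneg ‖(collide p ω).1‖]

theorem hardSphere_nonneg (w ω : Vel d) : 0 ≤ hardSphere w ω := by unfold hardSphere; positivity

theorem hardSphere_le (w : Vel d) {ω : Vel d} (hω : ‖ω‖ = 1) : hardSphere w ω ≤ ‖w‖ / 2 := by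
  have := abs_real_inner_le_norm w ω
  rw [hω, mul_one] at this
  unfold hardSphere; linarith

/-- The kernel is Lipschitz in the relative velocity. This measures the cost of evaluating it at
shifted velocities. -/
theorem hardSphere_le_add (w w' : Vel d) {ω : Vel d} (hω : ‖ω‖ = 1) :
    hardSphere w ω ≤ hardSphere w' ω + ‖w - w'‖ / 2 := by
  have h1 := hardSphere_le (w - w') hω
  have h2 : |inner ℝ w ω| ≤ |inner ℝ w' ω| + |inner ℝ (w - w') ω| := by
    have : inner ℝ w ω = inner ℝ w' ω + inner ℝ (w - w') ω := by rw [← inner_add_left]; simp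
    rw [this]; exact abs_add_le _ _
  unfold hardSphere at *
  linarith

@[fun_prop]
theorem continuous_hardSphere {X : Type*} [TopologicalSpace X] {f g : X → Vel d}
    (hf : Continuous f) (hg : Continuous g) : Continuous fun x => hardSphere (f x) (g x) := by
  unfold hardSphere; fun_prop

@[fun_prop]
theorem continuous_collide {X : Type*} [TopologicalSpace X] {f : X → Vel d × Vel d} {g : X → Vel d}
    (hf : Continuous f) (hg : Continuous g) : Continuous fun x => collide (f x) (g x) := by
  unfold collide; fun_prop

/-- The collision map as a linear map. -/
noncomputable def collideLin (ω : Vel d) : (Vel d × Vel d) →ₗ[ℝ] (Vel d × Vel d) where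
  toFun p := collide p ω
  map_add' p q := by
    have : inner ℝ ((p + q).1 - (p + q).2) ω = inner ℝ (p.1 - p.2) ω + inner ℝ (q.1 - q.2) ω := by
      rw [← inner_add_left]; congr 1; simp only [Prod.fst_add, Prod.snd_add]; abel
    simp only [collide, this]
    ext1
    · simp only [Prod.fst_add]; module
    · simp only [Prod.snd_add]; module
  map_smul' r p := by
    have : inner ℝ ((r • p).1 - (r • p).2) ω = r * inner ℝ (p.1 - p.2) ω := by
      rw [← real_inner_smul_left]; congr 1; simp only [Prod.smul_fst, Prod.smul_snd]; module
    simp only [collide, this, RingHom.id_apply]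
    ext1
    · simp only [Prod.smul_fst]; module
    · simp only [Prod.smul_snd]; module

/-- For fixed ω the collision is linear in the velocities, so shifting the incoming pair by y shifts
the outgoing pair by the collided y. -/
theorem collide_add_smul (p q : Vel d × Vel d) (r : ℝ) (ω : Vel d) :
    collide (p + r • q) ω = collide p ω + r • collide q ω := by
  have h1 := (collideLin ω).map_add p (r • q)
  have h2 := (collideLin ω).map_smul r q
  rw [h2] at h1
  exact h1

/-- A linear involution has determinant ±1. -/
theorem measurePreserving_collide {ω : Vel d} (hω : ‖ω‖ = 1) :
    MeasurePreserving (fun p : Vel d × Vel d => collide p ω) volume volume := by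
  refine ⟨(by fun_prop : Continuous _).measurable, ?_⟩
  have hcomp : collideLin ω ∘ₗ collideLin ω = LinearMap.id :=
    LinearMap.ext fun p => collide_collide p hω
  have hdet : LinearMap.det (collideLin ω) * LinearMap.det (collideLin ω) = 1 := by
    rw [← LinearMap.det_comp, hcomp, LinearMap.det_id]
  have habs : |LinearMap.det (collideLin ω)| = 1 := by
    rcases mul_self_eq_one_iff.1 hdet with h | h <;> rw [h] <;> simp
  have : (volume : Measure (Vel d × Vel d)).IsAddHaarMeasure :=
    inferInstanceAs ((volume : Measure (Vel d)).prod volume).IsAddHaarMeasure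
  have h := Measure.map_linearMap_addHaar_eq_smul_addHaar (volume : Measure (Vel d × Vel d))
    (f := collideLin ω) (fun h0 => by rw [h0] at hdet; simp at hdet)
  rw [abs_inv, habs, inv_one, ENNReal.ofReal_one, one_smul] at h
  exact h

theorem lintegral_comp_collide {ω : Vel d} (hω : ‖ω‖ = 1) {h : Vel d × Vel d → ℝ≥0∞}
    (hh : Measurable h) : ∫⁻ p, h (collide p ω) = ∫⁻ p, h p :=
  (measurePreserving_collide hω).lintegral_comp hh

/-- Pairs of independent Gaussians. -/
noncomputable abbrev gaussPair (d : ℕ) : Measure (Vel d × Vel d) :=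
  (gaussMeasure d).prod (gaussMeasure d)

theorem lintegral_gaussPair_comp {s : ℝ} (hs : 0 < s) (x : Vel d × Vel d)
    {h : Vel d × Vel d → ℝ≥0∞} (hh : Measurable h) :
    ∫⁻ y, h (x + s • y) ∂(gaussPair d)
      = ∫⁻ z, h z * (ENNReal.ofReal (gaussScaled s (z.1 - x.1))
          * ENNReal.ofReal (gaussScaled s (z.2 - x.2))) := by
  rw [lintegral_prod _ (by fun_prop), Measure.volume_eq_prod, lintegral_prod _ (by fun_prop)]
  have h1 : ∀ y1 : Vel d, ∫⁻ y2, h (x + s • (y1, y2)) ∂(gaussMeasure d)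
      = ∫⁻ z2, h (x.1 + s • y1, z2) * ENNReal.ofReal (gaussScaled s (z2 - x.2)) := fun y1 =>
    lintegral_gaussMeasure_comp hs x.2 (h := fun w => h (x.1 + s • y1, w)) (by fun_prop)
  simp_rw [h1]
  rw [lintegral_gaussMeasure_comp hs x.1
    (h := fun w => ∫⁻ z2, h (w, z2) * ENNReal.ofReal (gaussScaled s (z2 - x.2)))
    (Measurable.lintegral_prod_right'
      (f := fun q : Vel d × Vel d => h q * ENNReal.ofReal (gaussScaled s (q.2 - x.2)))
      (by fun_prop))]
  refine lintegral_congr fun z1 => ?_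
  rw [← lintegral_mul_const _ (by fun_prop)]
  refine lintegral_congr fun z2 => ?_
  ring

/-- The density of a Gaussian pair depends only on |y|² + |y_*|², which the collision conserves, and
Lebesgue measure is preserved. This is why a Gaussian mollifier is chosen. -/
theorem measurePreserving_collide_gaussPair {ω : Vel d} (hω : ‖ω‖ = 1) :
    MeasurePreserving (fun p : Vel d × Vel d => collide p ω) (gaussPair d) (gaussPair d) := by
  refine ⟨(by fun_prop : Continuous _).measurable, ?_⟩
  have key : ∀ h : Vel d × Vel d → ℝ≥0∞, Measurable h →
      ∫⁻ y, h y ∂(gaussPair d)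
        = ∫⁻ z, h z * (ENNReal.ofReal (gauss z.1) * ENNReal.ofReal (gauss z.2)) := fun h hh => by
    simpa [gaussScaled] using lintegral_gaussPair_comp one_pos (0 : Vel d × Vel d) hh
  have hinv : ∀ z : Vel d × Vel d, ENNReal.ofReal (gauss (collide z ω).1)
      * ENNReal.ofReal (gauss (collide z ω).2)
      = ENNReal.ofReal (gauss z.1) * ENNReal.ofReal (gauss z.2) := fun z => by
    rw [← ENNReal.ofReal_mul (gauss_pos _).le, ← ENNReal.ofReal_mul (gauss_pos _).le]
    congr 1
    have h := norm_sq_collide z hω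
    have e : ∀ a b : Vel d, gauss a * gauss b = ((Real.pi ^ ((d : ℝ) / 2))⁻¹) ^ 2
        * Real.exp (-(‖a‖ ^ 2 + ‖b‖ ^ 2)) := fun a b => by
      rw [gauss, gauss, neg_add, Real.exp_add]; ring
    rw [e, e, h]
  refine Measure.ext_of_lintegral _ fun h hh => ?_
  rw [lintegral_map hh (by fun_prop), key _ (by fun_prop), key _ hh,
    ← lintegral_comp_collide hω (by fun_prop)]
  simp_rw [hinv, collide_collide _ hω]

end Collision

/-! ### Pointwise commutator estimate for the Gaussian kernel -/

section Commutator

variable {d : ℕ} {τ : ℝ}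

/-- Split at |y| = τ(1 + |z|). Below the threshold the first term suffices. Above it, r = |y|/τ²
satisfies τ r > 1 + |z|, and exp(-r²) ≤ (d+3)!/r^{2(d+3)} leaves enough powers both for the weight
(1+|z|)^{-(d+3)} and for τ³. The gap between the mollification scale τ² and the threshold scale τ is
what makes this work. -/
theorem norm_mul_gaussScaled_le (hτ : 0 < τ) (hτ1 : τ ≤ 1) (z y : Vel d) :
    ‖y‖ * gaussScaled (τ ^ 2) y ≤ τ * (1 + ‖z‖) * gaussScaled (τ ^ 2) y
      + (d + 3).factorial * τ ^ 3 * weight z := by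
  have hσ : 0 < τ ^ 2 := pow_pos hτ 2
  have hG := gaussScaled_pos hσ y
  have hz := norm_nonneg z
  have hw : 0 ≤ ((d + 3).factorial : ℝ) * τ ^ 3 * weight z := by
    have := weight_pos z; positivity
  rcases le_or_gt ‖y‖ (τ * (1 + ‖z‖)) with h | h
  · have := mul_le_mul_of_nonneg_right h hG.le
    linarith
  have hmain : ‖y‖ * gaussScaled (τ ^ 2) y ≤ (d + 3).factorial * τ ^ 3 * weight z := by
    obtain ⟨r, hr⟩ : ∃ r, r = ‖y‖ / τ ^ 2 := ⟨_, rfl⟩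
    have hy : ‖y‖ = τ ^ 2 * r := by rw [hr]; field_simp
    have hA : 1 + ‖z‖ < τ * r := by
      rw [hy] at h
      have : τ * (1 + ‖z‖) < τ * (τ * r) := by nlinarith
      exact lt_of_mul_lt_mul_left this hτ.le
    have hτr : 1 ≤ τ * r := by linarith
    have hr1 : 1 ≤ r := by nlinarith
    have hr0 : 0 < r := by linarith
    have hexp : Real.exp (-r ^ 2) ≤ (d + 3).factorial / r ^ (2 * (d + 3)) := by
      have h1 := Real.pow_div_factorial_le_exp (r ^ 2) (by positivity) (d + 3)
      rw [← pow_mul, div_le_iff₀ (by positivity)] at h1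
      rw [Real.exp_neg, le_div_iff₀ (by positivity), inv_mul_le_iff₀ (Real.exp_pos _)]
      exact h1
    have hgs : gaussScaled (τ ^ 2) y ≤ ((τ ^ 2) ^ d)⁻¹ * ((d + 3).factorial / r ^ (2 * (d + 3))) := by
      unfold gaussScaled
      refine mul_le_mul_of_nonneg_left (le_trans ?_ hexp) (by positivity)
      have hn : ‖(τ ^ 2)⁻¹ • y‖ = r := by
        rw [norm_smul, Real.norm_of_nonneg (by positivity), hr]; field_simp
      rw [gauss, hn]
      refine mul_le_of_le_one_left (Real.exp_pos _).le (inv_le_one_of_one_le₀ ?_)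
      exact Real.one_le_rpow (by have := Real.pi_gt_three; linarith) (by positivity)
    have hwz : ((τ * r) ^ (d + 3))⁻¹ ≤ weight z := by
      unfold weight
      exact inv_anti₀ (by positivity) (pow_le_pow_left₀ (by positivity) hA.le _)
    have hpow : r * (τ * r) ^ (d + 3) ≤ τ * (τ ^ 2) ^ d * r ^ (2 * (d + 3)) := by
      have h1 : (1 : ℝ) ≤ (τ * r) ^ d := one_le_pow₀ hτr
      have h2 : τ ^ 2 ≤ r ^ 2 := pow_le_pow_left₀ hτ.le (hτ1.trans hr1) 2
      have e1 : r * (τ * r) ^ (d + 3) = (τ * r) ^ d * (τ * r ^ 4) * τ ^ 2 := by ring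
      have e2 : τ * (τ ^ 2) ^ d * r ^ (2 * (d + 3))
          = (τ * r) ^ d * (τ * r ^ 4) * ((τ * r) ^ d * r ^ 2) := by ring
      rw [e1, e2]
      refine mul_le_mul_of_nonneg_left ?_ (by positivity)
      nlinarith [sq_nonneg r]
    calc ‖y‖ * gaussScaled (τ ^ 2) y
        ≤ (τ ^ 2 * r) * (((τ ^ 2) ^ d)⁻¹ * ((d + 3).factorial / r ^ (2 * (d + 3)))) := by
          rw [hy]; exact mul_le_mul_of_nonneg_left hgs (by positivity)
      _ = (d + 3).factorial * τ ^ 2 * (r / ((τ ^ 2) ^ d * r ^ (2 * (d + 3)))) := by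
          field_simp
      _ ≤ (d + 3).factorial * τ ^ 2 * (τ * ((τ * r) ^ (d + 3))⁻¹) := by
          refine mul_le_mul_of_nonneg_left ?_ (by positivity)
          rw [div_le_iff₀ (by positivity), ← mul_inv_cancel_right₀
            (by positivity : (τ * r) ^ (d + 3) ≠ 0) r]
          calc r * (τ * r) ^ (d + 3) * ((τ * r) ^ (d + 3))⁻¹
              ≤ (τ * (τ ^ 2) ^ d * r ^ (2 * (d + 3))) * ((τ * r) ^ (d + 3))⁻¹ :=
                mul_le_mul_of_nonneg_right hpow (by positivity)
            _ = _ := by rw [mul_inv_cancel_right₀ (by positivity)]; ring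
      _ ≤ (d + 3).factorial * τ ^ 2 * (τ * weight z) := by gcongr
      _ = _ := by ring
  have : 0 ≤ τ * (1 + ‖z‖) * gaussScaled (τ ^ 2) y := by positivity
  linarith

/-- The tail term τ³·weight is τ times the τ²·weight already contained in `reg`. Hence the
displacement caused by mollification costs a factor τ(1 + |z|) relative to `reg` itself, with no
lower bound on the mollified density. -/
theorem lintegral_norm_mul_gaussScaled_le (π : Measure (Vel d)) [IsProbabilityMeasure π]
    (hτ : 0 < τ) (hτ1 : τ ≤ 1) (z : Vel d) :
    ∫⁻ v, ENNReal.ofReal (‖z - v‖ * gaussScaled (τ ^ 2) (z - v)) ∂π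
      ≤ ENNReal.ofReal ((d + 3).factorial * τ * (1 + ‖z‖) * reg τ π z) := by
  have hi := integrable_gaussScaled π (pow_pos hτ 2) z
  have hw := weight_pos z
  have hz := norm_nonneg z
  calc ∫⁻ v, ENNReal.ofReal (‖z - v‖ * gaussScaled (τ ^ 2) (z - v)) ∂π
      ≤ ∫⁻ v, ENNReal.ofReal (τ * (1 + ‖z‖) * gaussScaled (τ ^ 2) (z - v)
          + (d + 3).factorial * τ ^ 3 * weight z) ∂π :=
        lintegral_mono fun v => ENNReal.ofReal_le_ofReal (norm_mul_gaussScaled_le hτ hτ1 z _)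
    _ = ENNReal.ofReal (∫ v, (τ * (1 + ‖z‖) * gaussScaled (τ ^ 2) (z - v)
          + (d + 3).factorial * τ ^ 3 * weight z) ∂π) := by
        refine (ofReal_integral_eq_lintegral_ofReal ((hi.const_mul _).add (integrable_const _))
          (ae_of_all _ fun v => ?_)).symm
        have := gaussScaled_pos (pow_pos hτ 2) (z - v)
        change 0 ≤ τ * (1 + ‖z‖) * gaussScaled (τ ^ 2) (z - v) + (d + 3).factorial * τ ^ 3 * weight z
        positivity
    _ ≤ _ := by
        refine ENNReal.ofReal_le_ofReal ?_
        rw [integral_add (hi.const_mul _) (integrable_const _), integral_const_mul]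
        simp only [integral_const, probReal_univ, one_smul]
        change τ * (1 + ‖z‖) * mollify (τ ^ 2) π z + _ ≤ _
        have hm := mollify_nonneg π (pow_pos hτ 2) z
        have hf : (1 : ℝ) ≤ (d + 3).factorial := by exact_mod_cast Nat.factorial_pos _
        have h1 : τ * (1 + ‖z‖) * mollify (τ ^ 2) π z
            ≤ (d + 3).factorial * τ * (1 + ‖z‖) * mollify (τ ^ 2) π z := by
          have : 0 ≤ τ * (1 + ‖z‖) * mollify (τ ^ 2) π z := by positivity
          nlinarith
        have h2 : (d + 3).factorial * τ ^ 3 * weight z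
            ≤ (d + 3).factorial * τ * (1 + ‖z‖) * (τ ^ 2 * weight z) := by
          have : 0 ≤ (d + 3).factorial * τ ^ 3 * weight z * ‖z‖ := by positivity
          nlinarith
        unfold reg
        linarith

end Commutator

/-! ### The mollified collision ratio against the collision measure -/

section CollisionRatio

variable {d : ℕ} {τ : ℝ} (π : Measure (Vel d)) [IsProbabilityMeasure π]

/-- Supplies a constant independent of τ, so that the error terms below are O(τ). -/
theorem lintegral_one_add_norm_reg_le (hτ : 0 < τ) (hτ1 : τ ≤ 1)
    (hπ : Integrable (fun v => ‖v‖) π) :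
    ∫⁻ z, ENNReal.ofReal (1 + ‖z‖) * ENNReal.ofReal (reg τ π z)
      ≤ ENNReal.ofReal (1 + ∫ v, ‖v‖ ∂π + gaussMoment d + ∫ z : Vel d, (1 + ‖z‖) * weight z) := by
  have hs := pow_pos hτ 2
  have hm := measurable_mollify π (s := τ ^ 2)
  have hW : 0 ≤ ∫ z : Vel d, (1 + ‖z‖) * weight z :=
    integral_nonneg fun z => mul_nonneg (by positivity) (weight_pos z).le
  have hgm : 0 ≤ gaussMoment d := integral_nonneg fun y => norm_nonneg _
  have hpm : 0 ≤ ∫ v, ‖v‖ ∂π := integral_nonneg fun y => norm_nonneg _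
  have h1 : ∫⁻ z : Vel d, ENNReal.ofReal (1 + ‖z‖) * ENNReal.ofReal (mollify (τ ^ 2) π z)
      ≤ ENNReal.ofReal (1 + ∫ v, ‖v‖ ∂π + gaussMoment d) := by
    rw [lintegral_mollify π hs (by fun_prop)]
    have hi : Integrable (fun p : Vel d × Vel d => 1 + (‖p.1‖ + ‖p.2‖)) (π.prod (gaussMeasure d)) :=
      (integrable_const _).add (integrable_norm_add_gauss hπ)
    have hval : ∫ p : Vel d × Vel d, (1 + (‖p.1‖ + ‖p.2‖)) ∂(π.prod (gaussMeasure d))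
        = 1 + ∫ v, ‖v‖ ∂π + gaussMoment d := by
      rw [integral_add (integrable_const _) (integrable_norm_add_gauss hπ),
        integral_add (hπ.comp_fst _) (integrable_norm_gaussMeasure.comp_snd _),
        integral_fun_fst (fun v : Vel d => ‖v‖), integral_fun_snd (fun v : Vel d => ‖v‖)]
      simp [gaussMoment]; ring
    rw [← hval, ofReal_integral_eq_lintegral_ofReal hi (ae_of_all _ fun p => by
      change 0 ≤ 1 + (‖p.1‖ + ‖p.2‖); positivity), lintegral_prod _ (by fun_prop)]
    refine lintegral_mono fun v => lintegral_mono fun y => ENNReal.ofReal_le_ofReal ?_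
    have h2 := norm_add_le v (τ ^ 2 • y)
    have h0 : τ ^ 2 ≤ 1 := pow_le_one₀ hτ.le hτ1
    rw [norm_smul, Real.norm_of_nonneg hs.le] at h2
    have := mul_le_of_le_one_left (norm_nonneg y) h0
    simp only
    linarith
  have h2 : ∫⁻ z : Vel d, ENNReal.ofReal (1 + ‖z‖) * ENNReal.ofReal (τ ^ 2 * weight z)
      ≤ ENNReal.ofReal (∫ z : Vel d, (1 + ‖z‖) * weight z) := by
    rw [ofReal_integral_eq_lintegral_ofReal integrable_one_add_norm_mul_weight
      (ae_of_all _ fun z => mul_nonneg (by positivity) (weight_pos z).le)]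
    refine lintegral_mono fun z => ?_
    rw [← ENNReal.ofReal_mul (by positivity)]
    refine ENNReal.ofReal_le_ofReal (mul_le_mul_of_nonneg_left ?_ (by positivity))
    exact mul_le_of_le_one_left (weight_pos z).le (pow_le_one₀ hτ.le hτ1)
  calc ∫⁻ z, ENNReal.ofReal (1 + ‖z‖) * ENNReal.ofReal (reg τ π z)
      = ∫⁻ z : Vel d, (ENNReal.ofReal (1 + ‖z‖) * ENNReal.ofReal (mollify (τ ^ 2) π z)
        + ENNReal.ofReal (1 + ‖z‖) * ENNReal.ofReal (τ ^ 2 * weight z)) := by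
        refine lintegral_congr fun z => ?_
        rw [reg, ENNReal.ofReal_add (mollify_nonneg π hs z)
          (mul_nonneg hs.le (weight_pos z).le), mul_add]
    _ ≤ _ := by
        rw [lintegral_add_left (by fun_prop), ENNReal.ofReal_add (by positivity) hW]
        exact add_le_add h1 h2

/-- The error rate of the commutation of the mollification with the collision kernel. -/
noncomputable def commErr (d : ℕ) (τ : ℝ) : ℝ≥0∞ :=
  2 * (ENNReal.ofReal ((d + 3).factorial * τ) + ENNReal.ofReal (τ ^ 2))

/-- Replaces the kernel at x by its value at the mollified point z. The Lipschitz error |z - x|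
falls on one Gaussian factor at a time and is absorbed into `reg`. -/
theorem lintegral_kernel_gauss_le (hτ : 0 < τ) (hτ1 : τ ≤ 1) {ω : Vel d} (hω : ‖ω‖ = 1)
    (z : Vel d × Vel d) :
    ∫⁻ x, ENNReal.ofReal (hardSphere (x.1 - x.2) ω)
      * (ENNReal.ofReal (gaussScaled (τ ^ 2) (z.1 - x.1))
          * ENNReal.ofReal (gaussScaled (τ ^ 2) (z.2 - x.2))) ∂(π.prod π)
      ≤ (ENNReal.ofReal (hardSphere (z.1 - z.2) ω) + ENNReal.ofReal ((d + 3).factorial * τ)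
          * (ENNReal.ofReal (1 + ‖z.1‖) + ENNReal.ofReal (1 + ‖z.2‖)))
        * (ENNReal.ofReal (reg τ π z.1) * ENNReal.ofReal (reg τ π z.2)) := by
  have hs := pow_pos hτ 2
  let G : Vel d → Vel d → ℝ≥0∞ := fun a v => ENNReal.ofReal (gaussScaled (τ ^ 2) (a - v))
  let D : Vel d → Vel d → ℝ≥0∞ := fun a v =>
    ENNReal.ofReal (‖a - v‖ * gaussScaled (τ ^ 2) (a - v))
  have hG : ∀ a, Measurable (G a) := fun a => by fun_prop
  have hD : ∀ a, Measurable (D a) := fun a => by fun_prop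
  have hGi : ∀ a, ∫⁻ v, G a v ∂π ≤ ENNReal.ofReal (reg τ π a) := fun a => by
    rw [← ofReal_mollify π hs]
    exact ENNReal.ofReal_le_ofReal (mollify_le_reg π hτ a)
  have hDi : ∀ a, ∫⁻ v, D a v ∂π ≤ ENNReal.ofReal ((d + 3).factorial * τ)
      * ENNReal.ofReal (1 + ‖a‖) * ENNReal.ofReal (reg τ π a) := fun a => by
    rw [← ENNReal.ofReal_mul (by positivity), ← ENNReal.ofReal_mul (by positivity)]
    exact lintegral_norm_mul_gaussScaled_le π hτ hτ1 a
  calc ∫⁻ x, ENNReal.ofReal (hardSphere (x.1 - x.2) ω) * (G z.1 x.1 * G z.2 x.2) ∂(π.prod π)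
      ≤ ∫⁻ x, (ENNReal.ofReal (hardSphere (z.1 - z.2) ω) * (G z.1 x.1 * G z.2 x.2)
          + (D z.1 x.1 * G z.2 x.2 + G z.1 x.1 * D z.2 x.2)) ∂(π.prod π) := by
        refine lintegral_mono fun x => ?_
        have h1 := hardSphere_le_add (x.1 - x.2) (z.1 - z.2) hω
        have h2 : ‖x.1 - x.2 - (z.1 - z.2)‖ ≤ ‖z.1 - x.1‖ + ‖z.2 - x.2‖ := by
          have : x.1 - x.2 - (z.1 - z.2) = (z.2 - x.2) - (z.1 - x.1) := by abel
          rw [this, add_comm]; exact norm_sub_le _ _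
        have h3 : hardSphere (x.1 - x.2) ω
            ≤ hardSphere (z.1 - z.2) ω + (‖z.1 - x.1‖ + ‖z.2 - x.2‖) := by
          have := norm_nonneg (z.1 - x.1)
          have := norm_nonneg (z.2 - x.2)
          linarith
        refine (mul_le_mul_left (ENNReal.ofReal_le_ofReal h3) _).trans_eq ?_
        rw [ENNReal.ofReal_add (hardSphere_nonneg _ _) (by positivity),
          ENNReal.ofReal_add (norm_nonneg _) (norm_nonneg _)]
        simp only [D, G]
        rw [ENNReal.ofReal_mul (norm_nonneg _), ENNReal.ofReal_mul (norm_nonneg _)]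
        ring
    _ = ENNReal.ofReal (hardSphere (z.1 - z.2) ω) * ((∫⁻ v, G z.1 v ∂π) * ∫⁻ v, G z.2 v ∂π)
          + ((∫⁻ v, D z.1 v ∂π) * (∫⁻ v, G z.2 v ∂π)
          + (∫⁻ v, G z.1 v ∂π) * ∫⁻ v, D z.2 v ∂π) := by
        rw [lintegral_add_left (by fun_prop), lintegral_add_left (by fun_prop),
          lintegral_const_mul _ (by fun_prop),
          lintegral_prod_mul (hG _).aemeasurable (hG _).aemeasurable,
          lintegral_prod_mul (hD _).aemeasurable (hG _).aemeasurable,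
          lintegral_prod_mul (hG _).aemeasurable (hD _).aemeasurable]
    _ ≤ ENNReal.ofReal (hardSphere (z.1 - z.2) ω)
            * (ENNReal.ofReal (reg τ π z.1) * ENNReal.ofReal (reg τ π z.2))
          + (ENNReal.ofReal ((d + 3).factorial * τ) * ENNReal.ofReal (1 + ‖z.1‖)
              * ENNReal.ofReal (reg τ π z.1) * ENNReal.ofReal (reg τ π z.2)
          + ENNReal.ofReal (reg τ π z.1) * (ENNReal.ofReal ((d + 3).factorial * τ)
              * ENNReal.ofReal (1 + ‖z.2‖) * ENNReal.ofReal (reg τ π z.2))) := by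
        gcongr
        · exact hGi _
        · exact hGi _
        · exact hDi _
        · exact hGi _
        · exact hGi _
        · exact hDi _
    _ = _ := by ring

theorem lintegral_mollify_pair {s : ℝ} (hs : 0 < s) {h : Vel d × Vel d → ℝ≥0∞}
    (hh : Measurable h) :
    ∫⁻ x, ∫⁻ y, h (x + s • y) ∂(gaussPair d) ∂(π.prod π)
      = ∫⁻ z, h z * (ENNReal.ofReal (mollify s π z.1) * ENNReal.ofReal (mollify s π z.2)) := by
  simp_rw [lintegral_gaussPair_comp hs _ hh]
  rw [lintegral_lintegral_swap]
  · refine lintegral_congr fun z => ?_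
    rw [lintegral_const_mul _ (by fun_prop),
      lintegral_prod_mul (f := fun v => ENNReal.ofReal (gaussScaled s (z.1 - v)))
        (g := fun v => ENNReal.ofReal (gaussScaled s (z.2 - v))) (by fun_prop) (by fun_prop),
      ofReal_mollify π hs, ofReal_mollify π hs]
  · unfold Function.uncurry
    fun_prop

theorem lintegral_prod_norm_mul_le {f g : Vel d → ℝ≥0∞} (hf : Measurable f) (hg : Measurable g)
    {N : ℝ≥0∞} (hfN : ∫⁻ z, ENNReal.ofReal (1 + ‖z‖) * f z ≤ N)
    (hgN : ∫⁻ z, ENNReal.ofReal (1 + ‖z‖) * g z ≤ N) :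
    ∫⁻ z : Vel d × Vel d, ENNReal.ofReal (1 + ‖z.1‖) * ENNReal.ofReal (1 + ‖z.2‖) * (f z.1 * g z.2)
      ≤ N ^ 2 := by
  have e : ∀ z : Vel d × Vel d,
      ENNReal.ofReal (1 + ‖z.1‖) * ENNReal.ofReal (1 + ‖z.2‖) * (f z.1 * g z.2)
      = (ENNReal.ofReal (1 + ‖z.1‖) * f z.1) * (ENNReal.ofReal (1 + ‖z.2‖) * g z.2) := fun z => by
    ring
  simp_rw [e]
  rw [Measure.volume_eq_prod, lintegral_prod_mul (f := fun v => ENNReal.ofReal (1 + ‖v‖) * f v)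
    (g := fun v => ENNReal.ofReal (1 + ‖v‖) * g v) (by fun_prop) (by fun_prop), sq]
  exact mul_le_mul' hfN hgN

/-- The mollified collision ratio, tested against a bounded function, is controlled by the
exchanged collision measure. -/
theorem lintegral_collision_ratio_le (hτ : 0 < τ) (hτ1 : τ ≤ 1) {ω : Vel d} (hω : ‖ω‖ = 1)
    {F : Vel d × Vel d → ℝ≥0∞} (hF : Measurable F) {C : ℝ≥0∞} (hC : ∀ z, F z ≤ C) {N : ℝ≥0∞}
    (hN : ∫⁻ z, ENNReal.ofReal (1 + ‖z‖) * ENNReal.ofReal (reg τ π z) ≤ N)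
    (hNw : ∫⁻ z : Vel d, ENNReal.ofReal (1 + ‖z‖) * ENNReal.ofReal (weight z) ≤ N) :
    ∫⁻ x, ENNReal.ofReal (hardSphere (x.1 - x.2) ω) * ∫⁻ y, (fun z : Vel d × Vel d =>
        F z * ENNReal.ofReal (reg τ π (collide z ω).1 * reg τ π (collide z ω).2
          / (reg τ π z.1 * reg τ π z.2))) (x + τ ^ 2 • y) ∂(gaussPair d) ∂(π.prod π)
      ≤ ∫⁻ x, ∫⁻ y, (fun z : Vel d × Vel d => ENNReal.ofReal (hardSphere (z.1 - z.2) ω)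
          * F (collide z ω)) (x + τ ^ 2 • y) ∂(gaussPair d) ∂(π.prod π)
        + C * N ^ 2 * commErr d τ := by
  have hs := pow_pos hτ 2
  have hr := measurable_reg π (τ := τ)
  have hm := measurable_mollify π (s := τ ^ 2)
  let J : Vel d → ℝ≥0∞ := fun z => ENNReal.ofReal (1 + ‖z‖)
  let Γ : Vel d → ℝ≥0∞ := fun z => ENNReal.ofReal (reg τ π z)
  let w : Vel d → ℝ≥0∞ := fun z => ENNReal.ofReal (weight z)
  let m : Vel d → ℝ≥0∞ := fun z => ENNReal.ofReal (mollify (τ ^ 2) π z)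
  let B : Vel d × Vel d → ℝ≥0∞ := fun z => ENNReal.ofReal (hardSphere (z.1 - z.2) ω)
  let κ : ℝ≥0∞ := ENNReal.ofReal ((d + 3).factorial * τ)
  let R : Vel d × Vel d → ℝ≥0∞ := fun z => ENNReal.ofReal
    (reg τ π (collide z ω).1 * reg τ π (collide z ω).2 / (reg τ π z.1 * reg τ π z.2))
  have hcol : Measurable fun z : Vel d × Vel d => collide z ω :=
    (by fun_prop : Continuous _).measurable
  have hB : Measurable B := (by fun_prop : Continuous fun z : Vel d × Vel d =>
    hardSphere (z.1 - z.2) ω).measurable.ennreal_ofReal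
  have hJ : Measurable J := by fun_prop
  have hΓ : Measurable Γ := by fun_prop
  have hw : Measurable w := by fun_prop
  have hmm : Measurable m := by fun_prop
  have hR : Measurable R := by fun_prop
  -- The denominator of the collision ratio cancels exactly, because the commutator estimate is
  -- expressed through `reg` and not through the bare mollification.
  have hRΓ : ∀ z, R z * (Γ z.1 * Γ z.2) = Γ (collide z ω).1 * Γ (collide z ω).2 := fun z => by
    have h1 := reg_pos π hτ z.1
    have h2 := reg_pos π hτ z.2
    have h3 := reg_pos π hτ (collide z ω).1
    have h4 := reg_pos π hτ (collide z ω).2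
    simp only [R, Γ]
    rw [← ENNReal.ofReal_mul h1.le, ← ENNReal.ofReal_mul (by positivity),
      ← ENNReal.ofReal_mul h3.le]
    congr 1
    field_simp
  have hJcol : ∀ z : Vel d × Vel d, J (collide z ω).1 + J (collide z ω).2 ≤ 2 * (J z.1 * J z.2) := by
    intro z
    have h := norm_collide_le z hω
    have h1 := norm_nonneg z.1
    have h2 := norm_nonneg z.2
    have h3 := mul_nonneg h1 h2
    have h2e : ∀ a : ℝ, ENNReal.ofReal (2 * a) = 2 * ENNReal.ofReal a := fun a => by
      rw [ENNReal.ofReal_mul zero_le_two]; simp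
    simp only [J]
    rw [← ENNReal.ofReal_add (by positivity) (by positivity), ← ENNReal.ofReal_mul (by positivity),
      ← h2e]
    refine ENNReal.ofReal_le_ofReal ?_
    nlinarith [h.1, h.2]
  have hBJ : ∀ z : Vel d × Vel d, B z ≤ J z.1 * J z.2 := by
    intro z
    have h := hardSphere_le (z.1 - z.2) hω
    have h' := norm_sub_le z.1 z.2
    have h1 := norm_nonneg z.1
    have h2 := norm_nonneg z.2
    have h3 := mul_nonneg h1 h2
    simp only [J, B]
    rw [← ENNReal.ofReal_mul (by positivity)]
    refine ENNReal.ofReal_le_ofReal ?_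
    nlinarith
  -- The main term needs the pure mollification, which is an average over shifts of the original
  -- measure. The weight contributes only O(τ²).
  have hΓm : ∀ z : Vel d × Vel d, Γ z.1 * Γ z.2
      ≤ m z.1 * m z.2 + ENNReal.ofReal (τ ^ 2) * (w z.1 * Γ z.2 + Γ z.1 * w z.2) := by
    intro z
    have e : ∀ a, Γ a = m a + ENNReal.ofReal (τ ^ 2) * w a := fun a => by
      simp only [Γ, m, w, reg]
      rw [ENNReal.ofReal_add (mollify_nonneg π hs a) (mul_nonneg hs.le (weight_pos a).le),
        ENNReal.ofReal_mul hs.le]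
    have hle : m z.1 ≤ Γ z.1 := by rw [e]; exact le_self_add
    calc Γ z.1 * Γ z.2 = m z.1 * m z.2 + ENNReal.ofReal (τ ^ 2) * (w z.1 * Γ z.2 + m z.1 * w z.2) := by
          rw [e z.1, e z.2]; ring
      _ ≤ _ := by gcongr
  have hJΓ : ∫⁻ z : Vel d × Vel d, J z.1 * J z.2 * (Γ z.1 * Γ z.2) ≤ N ^ 2 :=
    lintegral_prod_norm_mul_le hΓ hΓ hN hN
  have hJwΓ : ∫⁻ z : Vel d × Vel d, J z.1 * J z.2 * (w z.1 * Γ z.2) ≤ N ^ 2 :=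
    lintegral_prod_norm_mul_le hw hΓ hNw hN
  have hJΓw : ∫⁻ z : Vel d × Vel d, J z.1 * J z.2 * (Γ z.1 * w z.2) ≤ N ^ 2 :=
    lintegral_prod_norm_mul_le hΓ hw hN hNw
  have hfirst : ∫⁻ x, B x * ∫⁻ y, (fun z => F z * R z) (x + τ ^ 2 • y) ∂(gaussPair d) ∂(π.prod π)
      ≤ ∫⁻ z, F z * (B z + κ * (J z.1 + J z.2))
          * (Γ (collide z ω).1 * Γ (collide z ω).2) := by
    calc ∫⁻ x, B x * ∫⁻ y, (fun z => F z * R z) (x + τ ^ 2 • y) ∂(gaussPair d) ∂(π.prod π)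
        = ∫⁻ x, ∫⁻ z, (F z * R z) * (B x * (ENNReal.ofReal (gaussScaled (τ ^ 2) (z.1 - x.1))
          * ENNReal.ofReal (gaussScaled (τ ^ 2) (z.2 - x.2)))) ∂volume ∂(π.prod π) := by
          refine lintegral_congr fun x => ?_
          rw [lintegral_gaussPair_comp hs x (h := fun z => F z * R z) (by fun_prop),
            ← lintegral_const_mul _ (by fun_prop)]
          refine lintegral_congr fun z => ?_
          ring
      _ = ∫⁻ z, ∫⁻ x, (F z * R z) * (B x * (ENNReal.ofReal (gaussScaled (τ ^ 2) (z.1 - x.1))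
          * ENNReal.ofReal (gaussScaled (τ ^ 2) (z.2 - x.2)))) ∂(π.prod π) := by
          refine lintegral_lintegral_swap ?_
          unfold Function.uncurry
          fun_prop
      _ ≤ ∫⁻ z, (F z * R z) * ((B z + κ * (J z.1 + J z.2)) * (Γ z.1 * Γ z.2)) := by
          refine lintegral_mono fun z => ?_
          rw [lintegral_const_mul _ (by fun_prop)]
          exact mul_le_mul_right (lintegral_kernel_gauss_le π hτ hτ1 hω z) _
      _ = _ := by
          refine lintegral_congr fun z => ?_
          rw [← hRΓ]; ring
  calc _ ≤ _ := hfirst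
    -- The change of variables z ↦ `collide z ω` moves the collision from the densities to the test
    -- function; the kernel is invariant.
    _ = ∫⁻ z, F (collide z ω) * (B z + κ * (J (collide z ω).1 + J (collide z ω).2))
          * (Γ z.1 * Γ z.2) := by
        rw [← lintegral_comp_collide hω (by fun_prop)]
        refine lintegral_congr fun z => ?_
        have : B (collide z ω) = B z := by simp only [B, hardSphere_collide z hω]
        rw [collide_collide z hω, this]
    _ ≤ ∫⁻ z, (F (collide z ω) * B z * (m z.1 * m z.2)
          + (C * ENNReal.ofReal (τ ^ 2) * (J z.1 * J z.2 * (w z.1 * Γ z.2)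
              + J z.1 * J z.2 * (Γ z.1 * w z.2))
            + C * κ * 2 * (J z.1 * J z.2 * (Γ z.1 * Γ z.2)))) := by
        refine lintegral_mono fun z => ?_
        calc F (collide z ω) * (B z + κ * (J (collide z ω).1 + J (collide z ω).2)) * (Γ z.1 * Γ z.2)
            = F (collide z ω) * B z * (Γ z.1 * Γ z.2)
              + F (collide z ω) * κ * (J (collide z ω).1 + J (collide z ω).2) * (Γ z.1 * Γ z.2) := by
              ring
          _ ≤ F (collide z ω) * B z * (m z.1 * m z.2
                + ENNReal.ofReal (τ ^ 2) * (w z.1 * Γ z.2 + Γ z.1 * w z.2))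
              + C * κ * (2 * (J z.1 * J z.2)) * (Γ z.1 * Γ z.2) := by
              gcongr
              · exact hΓm z
              · exact hC _
              · exact hJcol z
          _ = F (collide z ω) * B z * (m z.1 * m z.2)
              + (F (collide z ω) * B z * (ENNReal.ofReal (τ ^ 2) * (w z.1 * Γ z.2 + Γ z.1 * w z.2))
              + C * κ * (2 * (J z.1 * J z.2)) * (Γ z.1 * Γ z.2)) := by ring
          _ ≤ F (collide z ω) * B z * (m z.1 * m z.2)
              + (C * (J z.1 * J z.2) * (ENNReal.ofReal (τ ^ 2) * (w z.1 * Γ z.2 + Γ z.1 * w z.2))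
              + C * κ * (2 * (J z.1 * J z.2)) * (Γ z.1 * Γ z.2)) := by
              gcongr
              · exact hC _
              · exact hBJ z
          _ = _ := by ring
    _ = (∫⁻ z, F (collide z ω) * B z * (m z.1 * m z.2))
          + (C * ENNReal.ofReal (τ ^ 2) * ((∫⁻ z : Vel d × Vel d, J z.1 * J z.2 * (w z.1 * Γ z.2))
              + ∫⁻ z : Vel d × Vel d, J z.1 * J z.2 * (Γ z.1 * w z.2))
            + C * κ * 2 * ∫⁻ z : Vel d × Vel d, J z.1 * J z.2 * (Γ z.1 * Γ z.2)) := by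
        rw [lintegral_add_left (by fun_prop), lintegral_add_left (by fun_prop),
          lintegral_const_mul _ (by fun_prop), lintegral_const_mul _ (by fun_prop),
          lintegral_add_left (by fun_prop)]
    _ ≤ (∫⁻ z, F (collide z ω) * B z * (m z.1 * m z.2))
          + (C * ENNReal.ofReal (τ ^ 2) * (N ^ 2 + N ^ 2) + C * κ * 2 * N ^ 2) := by
        gcongr
    _ = _ := by
        rw [lintegral_mollify_pair π hs (h := fun z => ENNReal.ofReal (hardSphere (z.1 - z.2) ω)
          * F (collide z ω)) (by fun_prop)]
        congr 1
        · refine lintegral_congr fun z => ?_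
          simp only [B, m]; ring
        · simp only [commErr, κ]; ring

end CollisionRatio

/-! ### Moments and time marginal of the collision flux -/

section FluxBase

variable {d : ℕ} {T : ℝ} (P : ProbPath d T)

/-- The parameters `((t, (v, v_*)), ω)` of a collision. -/
abbrev CollSpace (d : ℕ) (T : ℝ) : Type :=
  (Time T × (Vel d × Vel d)) × Metric.sphere (0 : Vel d) 1

/-- The measure `dt P_t(dv) P_t(dv_*) dω`. -/
noncomputable def collMeasure : Measure (CollSpace d T) :=
  (timeMeasure T ⊗ₘ (pathKernel P ×ₖ pathKernel P)).prod (volume : Measure (Vel d)).toSphere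

instance : IsFiniteMeasure (collMeasure P) := by unfold collMeasure; infer_instance

/-- The rate `½ B(v - v_*, ω)` of a collision. -/
noncomputable def collRate (x : CollSpace d T) : ℝ :=
  1 / 2 * hardSphere (x.1.2.1 - x.1.2.2) (x.2 : Vel d)

/-- The incoming and outgoing velocities of a collision. -/
noncomputable def collFlux (x : CollSpace d T) : FluxSpace d T := (x.1.1, x.1.2, collide x.1.2 (x.2 : Vel d))

/-- The measure `dt ½ P_t(dv) P_t(dv_*) B(v - v_*, ω) dω`. -/
noncomputable def fluxBase : Measure (CollSpace d T) :=
  (collMeasure P).withDensity fun x => ENNReal.ofReal (collRate x)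

theorem fluxPP_eq_map : fluxPP P = (fluxBase P).map collFlux := rfl

theorem norm_sphere (ω : Metric.sphere (0 : Vel d) 1) : ‖(ω : Vel d)‖ = 1 := by simp

theorem continuous_collRate : Continuous (collRate : CollSpace d T → ℝ) := by
  unfold collRate; fun_prop

theorem continuous_collFlux : Continuous (collFlux : CollSpace d T → FluxSpace d T) := by
  unfold collFlux; fun_prop

theorem continuous_exchange : Continuous (exchange : FluxSpace d T → FluxSpace d T) := by
  unfold exchange; fun_prop

theorem measurable_collRate : Measurable (collRate : CollSpace d T → ℝ) :=
  continuous_collRate.measurable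

theorem measurable_collFlux : Measurable (collFlux : CollSpace d T → FluxSpace d T) :=
  continuous_collFlux.measurable

theorem measurable_exchange : Measurable (exchange : FluxSpace d T → FluxSpace d T) :=
  continuous_exchange.measurable

theorem collRate_nonneg (x : CollSpace d T) : 0 ≤ collRate x :=
  mul_nonneg (by norm_num) (hardSphere_nonneg _ _)

theorem collRate_le (x : CollSpace d T) : collRate x ≤ ‖x.1.2.1‖ + ‖x.1.2.2‖ := by
  have h1 := hardSphere_le (x.1.2.1 - x.1.2.2) (norm_sphere x.2)
  have h2 := norm_sub_le x.1.2.1 x.1.2.2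
  have h3 := norm_nonneg x.1.2.1
  have h4 := norm_nonneg x.1.2.2
  unfold collRate; linarith

theorem lintegral_collMeasure {h : CollSpace d T → ℝ≥0∞} (hh : Measurable h) :
    ∫⁻ x, h x ∂(collMeasure P) = ∫⁻ ω, ∫⁻ t, ∫⁻ x, h ((t, x), ω)
      ∂((P t : Measure (Vel d)).prod (P t : Measure (Vel d))) ∂(timeMeasure T)
      ∂(volume : Measure (Vel d)).toSphere := by
  rw [collMeasure, lintegral_prod_symm _ hh.aemeasurable]
  refine lintegral_congr fun ω => ?_
  rw [Measure.lintegral_compProd (by fun_prop)]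
  refine lintegral_congr fun t => ?_
  rw [Kernel.prod_apply]
  rfl

theorem lintegral_fluxBase {h : CollSpace d T → ℝ≥0∞} (hh : Measurable h) :
    ∫⁻ x, h x ∂(fluxBase P) = ∫⁻ x, ENNReal.ofReal (collRate x) * h x ∂(collMeasure P) := by
  rw [fluxBase, lintegral_withDensity_eq_lintegral_mul _ measurable_collRate.ennreal_ofReal hh]
  rfl

theorem integrable_fluxBase_iff {g : CollSpace d T → ℝ} :
    Integrable g (fluxBase P) ↔ Integrable (fun x => collRate x * g x) (collMeasure P) := by
  rw [fluxBase, integrable_withDensity_iff_integrable_smul' measurable_collRate.ennreal_ofReal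
    (ae_of_all _ fun x => ENNReal.ofReal_lt_top)]
  simp_rw [ENNReal.toReal_ofReal (collRate_nonneg _), smul_eq_mul]

theorem integral_fluxBase (g : CollSpace d T → ℝ) :
    ∫ x, g x ∂(fluxBase P) = ∫ x, collRate x * g x ∂(collMeasure P) := by
  rw [fluxBase, integral_withDensity_eq_integral_toReal_smul measurable_collRate.ennreal_ofReal
    (ae_of_all _ fun x => ENNReal.ofReal_lt_top)]
  simp_rw [ENNReal.toReal_ofReal (collRate_nonneg _), smul_eq_mul]

variable {P} {e : ℝ}

theorem integrable_norm_of_energy {π : ProbabilityMeasure (Vel d)} (h : MeanZeroEnergyLE e π) :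
    Integrable (fun v => ‖v‖) (π : Measure (Vel d)) := by
  refine ((integrable_const (1 / 2 : ℝ)).add h.1).mono' (by fun_prop) (ae_of_all _ fun v => ?_)
  simp only [norm_norm, Pi.add_apply]
  nlinarith [sq_nonneg (‖v‖ - 1)]

theorem integral_norm_le_of_energy {π : ProbabilityMeasure (Vel d)} (h : MeanZeroEnergyLE e π) :
    ∫ v, ‖v‖ ∂(π : Measure (Vel d)) ≤ 1 / 2 + e := by
  calc ∫ v, ‖v‖ ∂(π : Measure (Vel d))
      ≤ ∫ v, (1 / 2 + ‖v‖ ^ 2 / 2) ∂(π : Measure (Vel d)) := by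
        refine integral_mono (integrable_norm_of_energy h) ((integrable_const _).add h.1) fun v => ?_
        simp only
        nlinarith [sq_nonneg (‖v‖ - 1)]
    _ ≤ _ := by
        rw [integral_add (integrable_const _) h.1]
        simpa using h.2.1

theorem integrable_energy (hP : ∀ t, MeanZeroEnergyLE e (P t)) :
    Integrable (fun x : CollSpace d T => 1 + ‖x.1.2.1‖ ^ 2 / 2 + ‖x.1.2.2‖ ^ 2 / 2)
      (collMeasure P) := by
  have hm : Measurable fun x : CollSpace d T => 1 + ‖x.1.2.1‖ ^ 2 / 2 + ‖x.1.2.2‖ ^ 2 / 2 := by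
    fun_prop
  refine ⟨hm.aestronglyMeasurable, ?_⟩
  rw [hasFiniteIntegral_iff_ofReal (ae_of_all _ fun x => by
    change 0 ≤ 1 + ‖x.1.2.1‖ ^ 2 / 2 + ‖x.1.2.2‖ ^ 2 / 2; positivity),
    lintegral_collMeasure P hm.ennreal_ofReal]
  have hb : ∀ t : Time T, ∫⁻ x : Vel d × Vel d, ENNReal.ofReal (1 + ‖x.1‖ ^ 2 / 2 + ‖x.2‖ ^ 2 / 2)
      ∂((P t : Measure (Vel d)).prod (P t : Measure (Vel d))) ≤ ENNReal.ofReal (1 + e + e) := by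
    intro t
    have h1 := (hP t).1.comp_fst (P t : Measure (Vel d))
    have h2 := (hP t).1.comp_snd (P t : Measure (Vel d))
    have hi : Integrable (fun x : Vel d × Vel d => 1 + ‖x.1‖ ^ 2 / 2 + ‖x.2‖ ^ 2 / 2)
        ((P t : Measure (Vel d)).prod (P t : Measure (Vel d))) :=
      ((integrable_const (1 : ℝ)).add h1).add h2
    rw [← ofReal_integral_eq_lintegral_ofReal hi (ae_of_all _ fun x => by
      change 0 ≤ 1 + ‖x.1‖ ^ 2 / 2 + ‖x.2‖ ^ 2 / 2; positivity)]
    refine ENNReal.ofReal_le_ofReal ?_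
    rw [integral_add (f := fun x : Vel d × Vel d => 1 + ‖x.1‖ ^ 2 / 2)
      ((integrable_const (1 : ℝ)).add h1) h2, integral_add (integrable_const _) h1,
      integral_fun_fst (fun v : Vel d => ‖v‖ ^ 2 / 2), integral_fun_snd (fun v : Vel d => ‖v‖ ^ 2 / 2)]
    have := (hP t).2.1
    simp only [integral_const, probReal_univ, one_smul]
    linarith
  refine lt_of_le_of_lt (lintegral_mono fun ω => lintegral_mono fun t => hb t) ?_
  rw [lintegral_const, lintegral_const]
  exact ENNReal.mul_lt_top (ENNReal.mul_lt_top ENNReal.ofReal_lt_top (measure_lt_top _ _))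
    (measure_lt_top _ _)

/-- The rate grows linearly, so the product has quadratic growth, which the uniform energy bound
controls. -/
theorem integrable_fluxBase (hP : ∀ t, MeanZeroEnergyLE e (P t)) {g : CollSpace d T → ℝ}
    (hg : Measurable g) {C : ℝ} (hgC : ∀ x, |g x| ≤ C * (1 + ‖x.1.2.1‖ + ‖x.1.2.2‖)) :
    Integrable g (fluxBase P) := by
  rw [integrable_fluxBase_iff]
  refine ((integrable_energy hP).const_mul (6 * C)).mono'
    (measurable_collRate.mul hg).aestronglyMeasurable (ae_of_all _ fun x => ?_)
  have h1 := collRate_le x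
  have h3 := norm_nonneg x.1.2.1
  have h4 := norm_nonneg x.1.2.2
  have hC : 0 ≤ C := by
    have := (abs_nonneg _).trans (hgC x)
    by_contra hC
    nlinarith
  rw [norm_mul, Real.norm_of_nonneg (collRate_nonneg x), Real.norm_eq_abs]
  calc collRate x * |g x|
      ≤ (‖x.1.2.1‖ + ‖x.1.2.2‖) * (C * (1 + ‖x.1.2.1‖ + ‖x.1.2.2‖)) :=
        mul_le_mul h1 (hgC x) (abs_nonneg _) (by positivity)
    _ = C * ((‖x.1.2.1‖ + ‖x.1.2.2‖) * (1 + ‖x.1.2.1‖ + ‖x.1.2.2‖)) := by ring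
    _ ≤ C * (6 * (1 + ‖x.1.2.1‖ ^ 2 / 2 + ‖x.1.2.2‖ ^ 2 / 2)) := by
        refine mul_le_mul_of_nonneg_left ?_ hC
        nlinarith [sq_nonneg (‖x.1.2.1‖ - ‖x.1.2.2‖), sq_nonneg (‖x.1.2.1‖ - 1),
          sq_nonneg (‖x.1.2.2‖ - 1)]
    _ = _ := by ring

theorem isFiniteMeasure_fluxBase (hP : ∀ t, MeanZeroEnergyLE e (P t)) :
    IsFiniteMeasure (fluxBase P) := by
  have h := integrable_fluxBase hP (g := fun _ => 1) measurable_const (C := 1) fun x => by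
    have h3 := norm_nonneg x.1.2.1
    have h4 := norm_nonneg x.1.2.2
    rw [abs_one]; linarith
  exact (integrable_const_iff_isFiniteMeasure one_ne_zero).1 h

theorem fluxIntegrable_fluxPP (hP : ∀ t, MeanZeroEnergyLE e (P t)) :
    FluxIntegrable (fluxPP P) fun v => 1 + ‖v‖ := by
  have key : ∀ w : FluxSpace d T → Vel d, Measurable w →
      (∀ x : CollSpace d T, ‖w (collFlux x)‖ ≤ ‖x.1.2.1‖ + ‖x.1.2.2‖) →
      Integrable (fun x => 1 + ‖w x‖) (fluxPP P) := by
    intro w hw hb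
    rw [fluxPP_eq_map, integrable_map_measure (by fun_prop) measurable_collFlux.aemeasurable]
    refine integrable_fluxBase hP (C := 1) ?_ fun x => ?_
    · exact (measurable_const.add hw.norm).comp measurable_collFlux
    · have := hb x
      simp only [Function.comp]
      rw [abs_of_nonneg (by positivity)]; linarith
  refine ⟨key _ (by fun_prop) fun x => ?_, key _ (by fun_prop) fun x => ?_,
    key _ (by fun_prop) fun x => ?_, key _ (by fun_prop) fun x => ?_⟩
  · exact le_add_of_nonneg_right (norm_nonneg _)
  · exact le_add_of_nonneg_left (norm_nonneg _)
  · exact (norm_collide_le _ (norm_sphere x.2)).1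
  · exact (norm_collide_le _ (norm_sphere x.2)).2

theorem isFiniteMeasure_fluxPP (hP : ∀ t, MeanZeroEnergyLE e (P t)) :
    IsFiniteMeasure (fluxPP P) := by
  have := isFiniteMeasure_fluxBase hP
  rw [fluxPP_eq_map]; infer_instance

theorem FluxIntegrable.exchange {Q : Measure (FluxSpace d T)} {h : Vel d → ℝ} (hh : Measurable h)
    (hQ : FluxIntegrable Q h) : FluxIntegrable (Q.map HBE.exchange) h := by
  have key : ∀ w : FluxSpace d T → Vel d, Measurable w →
      Integrable (fun x => h (w (HBE.exchange x))) Q →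
      Integrable (fun x => h (w x)) (Q.map HBE.exchange) := fun w hw hi => by
    rw [integrable_map_measure (f := HBE.exchange) (g := fun x => h (w x))
      (hh.comp hw).aestronglyMeasurable measurable_exchange.aemeasurable]
    exact hi
  exact ⟨key _ (by fun_prop) hQ.2.2.1, key _ (by fun_prop) hQ.2.2.2, key _ (by fun_prop) hQ.1,
    key _ (by fun_prop) hQ.2.1⟩

theorem timeMeasure_singleton (t : Time T) : timeMeasure T {t} = 0 := by
  rw [timeMeasure, (MeasurableEmbedding.subtype_coe measurableSet_Icc).comap_apply]
  simp

/-- The time marginal is absolutely continuous. This rules out an atom at time 0, also for any flux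
absolutely continuous with respect to the exchanged one. -/
theorem fluxPP_time_eq (t : Time T) : fluxPP P {x | x.1 = t} = 0 := by
  have hs : MeasurableSet {x : FluxSpace d T | x.1 = t} :=
    measurable_fst (measurableSet_singleton t)
  rw [fluxPP_eq_map, Measure.map_apply measurable_collFlux hs]
  refine withDensity_absolutelyContinuous _ _ ?_
  rw [← lintegral_indicator_one (measurable_collFlux hs), lintegral_collMeasure P
    (measurable_one.indicator (measurable_collFlux hs))]
  have : ∀ s : Time T, ∀ ω : Metric.sphere (0 : Vel d) 1,
      ∫⁻ x, (collFlux ⁻¹' {x : FluxSpace d T | x.1 = t}).indicator 1 ((s, x), ω)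
        ∂((P s : Measure (Vel d)).prod (P s : Measure (Vel d))) = ({t} : Set (Time T)).indicator 1 s := by
    intro s ω
    by_cases h : s = t
    · subst h
      simp [indicator, collFlux]
    · simp [indicator, collFlux, h]
  simp_rw [this]
  rw [lintegral_indicator_one (measurableSet_singleton t), timeMeasure_singleton, lintegral_zero]

end FluxBase

/-! ### Averaging collisions over Gaussian shifts of the velocities -/

section Average

variable {d : ℕ} {T τ : ℝ} {P : ProbPath d T} {e : ℝ}

/-- The velocities of a collision shifted by `y`. -/
def collShift (τ : ℝ) (x : CollSpace d T) (y : Vel d × Vel d) : CollSpace d T :=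
  ((x.1.1, x.1.2 + τ ^ 2 • y), x.2)

theorem continuous_collShift :
    Continuous fun p : ℝ × CollSpace d T × (Vel d × Vel d) => collShift p.1 p.2.1 p.2.2 := by
  unfold collShift; fun_prop

theorem measurable_collShift (τ : ℝ) :
    Measurable fun p : CollSpace d T × (Vel d × Vel d) => collShift τ p.1 p.2 :=
  (continuous_collShift.comp (continuous_const.prodMk continuous_id)).measurable

theorem tendsto_collShift (x : CollSpace d T) (y : Vel d × Vel d) :
    Tendsto (fun τ => collShift τ x y) (𝓝[>] 0) (𝓝 x) := by
  have h : Continuous fun τ : ℝ => collShift τ x y := by unfold collShift; fun_prop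
  have h0 : collShift 0 x y = x := by simp [collShift]
  exact (h0 ▸ h.tendsto 0).mono_left nhdsWithin_le_nhds

/-- A bounded function of the collision averaged over Gaussian shifts of the velocities. -/
noncomputable def collAvg (τ : ℝ) (Φ : FluxSpace d T →ᵇ ℝ) (x : CollSpace d T) : ℝ :=
  ∫ y, Φ (collFlux (collShift τ x y)) ∂(gaussPair d)

theorem measurable_comp_collShift (Φ : FluxSpace d T →ᵇ ℝ) (τ : ℝ) :
    Measurable fun p : CollSpace d T × (Vel d × Vel d) => Φ (collFlux (collShift τ p.1 p.2)) :=
  Φ.continuous.measurable.comp (measurable_collFlux.comp (measurable_collShift τ))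

theorem integrable_comp_collShift (Φ : FluxSpace d T →ᵇ ℝ) (τ : ℝ) (x : CollSpace d T) :
    Integrable (fun y => Φ (collFlux (collShift τ x y))) (gaussPair d) :=
  Integrable.of_bound ((measurable_comp_collShift Φ τ).comp
    measurable_prodMk_left).aestronglyMeasurable ‖Φ‖ (ae_of_all _ fun _ => Φ.norm_coe_le_norm _)

theorem measurable_collAvg (Φ : FluxSpace d T →ᵇ ℝ) (τ : ℝ) : Measurable (collAvg τ Φ) :=
  ((measurable_comp_collShift Φ τ).stronglyMeasurable.integral_prod_right'
    (ν := gaussPair d)).measurable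

theorem abs_collAvg_le (Φ : FluxSpace d T →ᵇ ℝ) (τ : ℝ) (x : CollSpace d T) :
    |collAvg τ Φ x| ≤ ‖Φ‖ := by
  have := norm_integral_le_of_norm_le_const (μ := gaussPair d)
    (ae_of_all _ fun y => Φ.norm_coe_le_norm (collFlux (collShift τ x y)))
  simpa [collAvg] using this

theorem tendsto_collAvg (Φ : FluxSpace d T →ᵇ ℝ) (x : CollSpace d T) :
    Tendsto (fun τ => collAvg τ Φ x) (𝓝[>] 0) (𝓝 (Φ (collFlux x))) := by
  have h := tendsto_integral_filter_of_dominated_convergence (μ := gaussPair d)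
    (l := 𝓝[>] (0 : ℝ)) (F := fun τ y => Φ (collFlux (collShift τ x y)))
    (f := fun _ => Φ (collFlux x)) (fun _ => ‖Φ‖)
    (Eventually.of_forall fun τ => (integrable_comp_collShift Φ τ x).aestronglyMeasurable)
    (Eventually.of_forall fun τ => ae_of_all _ fun y => Φ.norm_coe_le_norm _)
    (integrable_const _)
    (ae_of_all _ fun y => ((Φ.continuous.comp continuous_collFlux).tendsto x).comp
      (tendsto_collShift x y))
  simpa [collAvg] using h

theorem tendsto_integral_collAvg (hP : ∀ t, MeanZeroEnergyLE e (P t)) (Φ : FluxSpace d T →ᵇ ℝ) :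
    Tendsto (fun τ => ∫ x, collAvg τ Φ x ∂(fluxBase P)) (𝓝[>] 0) (𝓝 (∫ x, Φ x ∂(fluxPP P))) := by
  have := isFiniteMeasure_fluxBase hP
  rw [fluxPP_eq_map, integral_map measurable_collFlux.aemeasurable
    Φ.continuous.measurable.aestronglyMeasurable]
  exact tendsto_integral_filter_of_dominated_convergence (fun _ => ‖Φ‖)
    (Eventually.of_forall fun τ => (measurable_collAvg Φ τ).aestronglyMeasurable)
    (Eventually.of_forall fun τ => ae_of_all _ fun y => abs_collAvg_le Φ τ y)
    (integrable_const _) (ae_of_all _ fun y => tendsto_collAvg Φ y)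

theorem integral_gaussPair_fst (h : Vel d → ℝ) :
    ∫ y, h y.1 ∂(gaussPair d) = ∫ y, h y ∂(gaussMeasure d) := by
  rw [integral_fun_fst h]; simp

theorem integral_gaussPair_snd (h : Vel d → ℝ) :
    ∫ y, h y.2 ∂(gaussPair d) = ∫ y, h y ∂(gaussMeasure d) := by
  rw [integral_fun_snd h]; simp

variable (P) in
/-- The logarithmic collision ratio of the regularized density. -/
noncomputable def logRatio (τ : ℝ) (x : CollSpace d T) : ℝ :=
  velGrad (fun v => Real.log (reg τ (P x.1.1 : Measure (Vel d)) v)) (collFlux x)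

/-- Shifting the incoming pair by y shifts the outgoing pair by `collide y ω`, which is again a pair
of independent Gaussians. Each of the four terms therefore averages to `pot` at the corresponding
velocity. -/
theorem integral_logRatio (hτ : 0 < τ) (x : CollSpace d T) :
    Integrable (fun y => logRatio P τ (collShift τ x y)) (gaussPair d) ∧
    ∫ y, logRatio P τ (collShift τ x y) ∂(gaussPair d) = potGrad τ P (collFlux x) := by
  have hω := norm_sphere x.2
  have hC := measurePreserving_collide_gaussPair (d := d) hω
  let π : Measure (Vel d) := (P x.1.1 : Measure (Vel d))
  have hi : ∀ v, Integrable (fun y => Real.log (reg τ π (v + τ ^ 2 • y))) (gaussMeasure d) :=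
    integrable_log_reg_add π hτ
  have i1 : Integrable (fun y : Vel d × Vel d => Real.log (reg τ π (x.1.2.1 + τ ^ 2 • y.1)))
      (gaussPair d) := (hi _).comp_fst _
  have i2 : Integrable (fun y : Vel d × Vel d => Real.log (reg τ π (x.1.2.2 + τ ^ 2 • y.2)))
      (gaussPair d) := (hi _).comp_snd _
  have i3' : Integrable (fun y : Vel d × Vel d => Real.log (reg τ π
      ((collide x.1.2 x.2).1 + τ ^ 2 • y.1))) (gaussPair d) := (hi _).comp_fst _
  have i4' : Integrable (fun y : Vel d × Vel d => Real.log (reg τ π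
      ((collide x.1.2 x.2).2 + τ ^ 2 • y.2))) (gaussPair d) := (hi _).comp_snd _
  have hr := measurable_reg π (τ := τ)
  have i3 : Integrable (fun y : Vel d × Vel d => Real.log (reg τ π
      ((collide x.1.2 x.2).1 + τ ^ 2 • (collide y x.2).1))) (gaussPair d) :=
    (hC.integrable_comp i3'.aestronglyMeasurable).2 i3'
  have i4 : Integrable (fun y : Vel d × Vel d => Real.log (reg τ π
      ((collide x.1.2 x.2).2 + τ ^ 2 • (collide y x.2).2))) (gaussPair d) :=
    (hC.integrable_comp i4'.aestronglyMeasurable).2 i4'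
  have e3 : ∫ y, Real.log (reg τ π ((collide x.1.2 x.2).1 + τ ^ 2 • (collide y x.2).1))
      ∂(gaussPair d) = pot τ π (collide x.1.2 x.2).1 := by
    rw [pot, ← integral_gaussPair_fst]
    conv_rhs => rw [← hC.map_eq]
    rw [integral_map hC.measurable.aemeasurable (by rw [hC.map_eq]; exact i3'.aestronglyMeasurable)]
  have e4 : ∫ y, Real.log (reg τ π ((collide x.1.2 x.2).2 + τ ^ 2 • (collide y x.2).2))
      ∂(gaussPair d) = pot τ π (collide x.1.2 x.2).2 := by
    rw [pot, ← integral_gaussPair_snd]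
    conv_rhs => rw [← hC.map_eq]
    rw [integral_map hC.measurable.aemeasurable (by rw [hC.map_eq]; exact i4'.aestronglyMeasurable)]
  have hrw : ∀ y, logRatio P τ (collShift τ x y)
      = Real.log (reg τ π ((collide x.1.2 x.2).1 + τ ^ 2 • (collide y x.2).1))
      + Real.log (reg τ π ((collide x.1.2 x.2).2 + τ ^ 2 • (collide y x.2).2))
      - Real.log (reg τ π (x.1.2.1 + τ ^ 2 • y.1)) - Real.log (reg τ π (x.1.2.2 + τ ^ 2 • y.2)) := by
    intro y
    simp only [logRatio, velGrad, collFlux, collShift, collide_add_smul]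
    rfl
  simp_rw [hrw]
  refine ⟨((i3.add i4).sub i1).sub i2, ?_⟩
  rw [integral_sub (f := fun y : Vel d × Vel d =>
      Real.log (reg τ π ((collide x.1.2 x.2).1 + τ ^ 2 • (collide y x.2).1))
      + Real.log (reg τ π ((collide x.1.2 x.2).2 + τ ^ 2 • (collide y x.2).2))
      - Real.log (reg τ π (x.1.2.1 + τ ^ 2 • y.1))) ((i3.add i4).sub i1) i2,
    integral_sub (f := fun y : Vel d × Vel d =>
      Real.log (reg τ π ((collide x.1.2 x.2).1 + τ ^ 2 • (collide y x.2).1))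
      + Real.log (reg τ π ((collide x.1.2 x.2).2 + τ ^ 2 • (collide y x.2).2))) (i3.add i4) i1,
    integral_add (f := fun y : Vel d × Vel d =>
      Real.log (reg τ π ((collide x.1.2 x.2).1 + τ ^ 2 • (collide y x.2).1))) i3 i4, e3, e4,
    integral_gaussPair_fst (fun y => Real.log (reg τ π (x.1.2.1 + τ ^ 2 • y))),
    integral_gaussPair_snd (fun y => Real.log (reg τ π (x.1.2.2 + τ ^ 2 • y)))]
  rfl

/-- Jensen applies once the gradient and Φ are averaged over the same shifts; this is the reason for
using `collAvg` in place of Φ. -/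
theorem ofReal_exp_potGrad_add_le (hτ : 0 < τ) (Φ : FluxSpace d T →ᵇ ℝ) (x : CollSpace d T) :
    ENNReal.ofReal (Real.exp (potGrad τ P (collFlux x) + collAvg τ Φ x))
      ≤ ∫⁻ y, (fun z : Vel d × Vel d => ENNReal.ofReal (Real.exp (Φ (x.1.1, z, collide z x.2)))
          * ENNReal.ofReal (reg τ (P x.1.1 : Measure (Vel d)) (collide z x.2).1
            * reg τ (P x.1.1 : Measure (Vel d)) (collide z x.2).2
            / (reg τ (P x.1.1 : Measure (Vel d)) z.1 * reg τ (P x.1.1 : Measure (Vel d)) z.2)))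
          (x.1.2 + τ ^ 2 • y) ∂(gaussPair d) := by
  have h := integral_logRatio (P := P) hτ x
  have hΦ := integrable_comp_collShift Φ τ x
  rw [← h.2, collAvg, ← integral_add h.1 hΦ]
  refine (ofReal_exp_integral_le (h.1.add hΦ)).trans (lintegral_mono fun y => ?_)
  have hp := reg_pos (P x.1.1 : Measure (Vel d)) hτ
  simp only [Pi.add_apply]
  rw [← ENNReal.ofReal_mul (Real.exp_pos _).le, Real.exp_add, mul_comm]
  refine le_of_eq ?_
  congr 2
  simp only [logRatio, velGrad, collFlux, collShift]
  rw [Real.exp_sub, Real.exp_sub, Real.exp_add, Real.exp_log (hp _), Real.exp_log (hp _),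
    Real.exp_log (hp _), Real.exp_log (hp _), div_div]

end Average

/-! ### Exponential moments of the regularized collisional gradient -/

section ExponentialBound

variable {d : ℕ} {T τ : ℝ} {P : ProbPath d T} {e : ℝ}

variable (P) in
/-- The exchanged collision rate tested against `exp Φ`, averaged over Gaussian shifts. -/
noncomputable def exchangeAvg (Φ : FluxSpace d T →ᵇ ℝ) (τ : ℝ) : ℝ :=
  ∫ p, collRate (collShift τ p.1 p.2) * Real.exp (Φ (exchange (collFlux (collShift τ p.1 p.2))))
    ∂((collMeasure P).prod (gaussPair d))

theorem continuous_rate_mul_exp (Φ : FluxSpace d T →ᵇ ℝ) :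
    Continuous fun x : CollSpace d T => collRate x * Real.exp (Φ (exchange (collFlux x))) :=
  continuous_collRate.mul (Real.continuous_exp.comp (Φ.continuous.comp
    (continuous_exchange.comp continuous_collFlux)))

theorem rate_mul_exp_nonneg (Φ : FluxSpace d T →ᵇ ℝ) (x : CollSpace d T) :
    0 ≤ collRate x * Real.exp (Φ (exchange (collFlux x))) :=
  mul_nonneg (collRate_nonneg _) (Real.exp_pos _).le

theorem exp_apply_le (Φ : FluxSpace d T →ᵇ ℝ) (x : FluxSpace d T) :
    Real.exp (Φ x) ≤ Real.exp ‖Φ‖ :=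
  Real.exp_le_exp.2 ((le_abs_self _).trans (Φ.norm_coe_le_norm x))

theorem integrable_shiftBound (hP : ∀ t, MeanZeroEnergyLE e (P t)) :
    Integrable (fun p : CollSpace d T × (Vel d × Vel d) =>
      (‖p.1.1.2.1‖ + ‖p.1.1.2.2‖) + (‖p.2.1‖ + ‖p.2.2‖)) ((collMeasure P).prod (gaussPair d)) := by
  have h1 : Integrable (fun x : CollSpace d T => ‖x.1.2.1‖ + ‖x.1.2.2‖) (collMeasure P) := by
    refine (integrable_energy hP).mono' (by fun_prop) (ae_of_all _ fun x => ?_)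
    rw [Real.norm_of_nonneg (by positivity)]
    nlinarith [sq_nonneg (‖x.1.2.1‖ - 1), sq_nonneg (‖x.1.2.2‖ - 1)]
  have h2 : Integrable (fun y : Vel d × Vel d => ‖y.1‖ + ‖y.2‖) (gaussPair d) :=
    (integrable_norm_gaussMeasure.comp_fst _).add (integrable_norm_gaussMeasure.comp_snd _)
  exact (h1.comp_fst _).add (h2.comp_snd _)

theorem rate_mul_exp_shift_le (Φ : FluxSpace d T →ᵇ ℝ) (hτ : 0 < τ) (hτ1 : τ ≤ 1)
    (p : CollSpace d T × (Vel d × Vel d)) :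
    ‖collRate (collShift τ p.1 p.2) * Real.exp (Φ (exchange (collFlux (collShift τ p.1 p.2))))‖
      ≤ ((‖p.1.1.2.1‖ + ‖p.1.1.2.2‖) + (‖p.2.1‖ + ‖p.2.2‖)) * Real.exp ‖Φ‖ := by
  rw [Real.norm_of_nonneg (rate_mul_exp_nonneg _ _)]
  refine mul_le_mul ((collRate_le _).trans ?_) (exp_apply_le Φ _) (Real.exp_pos _).le (by positivity)
  have h0 : τ ^ 2 ≤ 1 := pow_le_one₀ hτ.le hτ1
  have hn : ∀ a b : Vel d, ‖a + τ ^ 2 • b‖ ≤ ‖a‖ + ‖b‖ := fun a b => by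
    have h2 := norm_add_le a (τ ^ 2 • b)
    rw [norm_smul, Real.norm_of_nonneg (pow_pos hτ 2).le] at h2
    have := mul_le_of_le_one_left (norm_nonneg b) h0
    linarith
  have h1 := hn p.1.1.2.1 p.2.1
  have h2 := hn p.1.1.2.2 p.2.2
  simp only [collShift, Prod.fst_add, Prod.snd_add, Prod.smul_fst, Prod.smul_snd]
  linarith

theorem measurable_rate_mul_exp_shift (Φ : FluxSpace d T →ᵇ ℝ) (τ : ℝ) :
    Measurable fun p : CollSpace d T × (Vel d × Vel d) =>
      collRate (collShift τ p.1 p.2) * Real.exp (Φ (exchange (collFlux (collShift τ p.1 p.2)))) :=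
  (continuous_rate_mul_exp Φ).measurable.comp (measurable_collShift τ)

theorem integrable_rate_mul_exp_shift (hP : ∀ t, MeanZeroEnergyLE e (P t))
    (Φ : FluxSpace d T →ᵇ ℝ) (hτ : 0 < τ) (hτ1 : τ ≤ 1) :
    Integrable (fun p : CollSpace d T × (Vel d × Vel d) => collRate (collShift τ p.1 p.2)
      * Real.exp (Φ (exchange (collFlux (collShift τ p.1 p.2)))))
      ((collMeasure P).prod (gaussPair d)) :=
  ((integrable_shiftBound hP).mul_const _).mono'
    (measurable_rate_mul_exp_shift Φ τ).aestronglyMeasurable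
    (ae_of_all _ fun p => rate_mul_exp_shift_le Φ hτ hτ1 p)

/-- Dominated convergence as the shift vanishes: the rate is continuous with linear growth and exp Φ
is bounded and continuous. -/
theorem tendsto_exchangeAvg (hP : ∀ t, MeanZeroEnergyLE e (P t)) (Φ : FluxSpace d T →ᵇ ℝ) :
    Tendsto (exchangeAvg P Φ) (𝓝[>] 0) (𝓝 (∫ x, Real.exp (Φ x) ∂((fluxPP P).map exchange))) := by
  have hlim : ∫ x, Real.exp (Φ x) ∂((fluxPP P).map exchange)
      = ∫ p : CollSpace d T × (Vel d × Vel d),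
        collRate p.1 * Real.exp (Φ (exchange (collFlux p.1)))
        ∂((collMeasure P).prod (gaussPair d)) := by
    rw [integral_fun_fst (fun x : CollSpace d T =>
      collRate x * Real.exp (Φ (exchange (collFlux x)))), fluxPP_eq_map,
      Measure.map_map measurable_exchange measurable_collFlux,
      integral_map (f := fun x => Real.exp (Φ x)) (measurable_exchange.comp measurable_collFlux).aemeasurable
        (Real.continuous_exp.comp Φ.continuous).measurable.aestronglyMeasurable, integral_fluxBase]
    simp
  rw [hlim]
  refine tendsto_integral_filter_of_dominated_convergence _
    (Eventually.of_forall fun τ => (measurable_rate_mul_exp_shift Φ τ).aestronglyMeasurable) ?_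
    ((integrable_shiftBound hP).mul_const (Real.exp ‖Φ‖)) (ae_of_all _ fun p => ?_)
  · filter_upwards [Ioc_mem_nhdsGT one_pos] with τ hτ
    exact ae_of_all _ fun p => rate_mul_exp_shift_le Φ hτ.1 hτ.2 p
  · exact ((continuous_rate_mul_exp Φ).tendsto p.1).comp (tendsto_collShift p.1 p.2)

variable (P) in
theorem measurable_ratio_shift (hτ : 0 < τ) (Φ : FluxSpace d T →ᵇ ℝ) :
    Measurable fun x : CollSpace d T => ENNReal.ofReal (hardSphere (x.1.2.1 - x.1.2.2) (x.2 : Vel d))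
      * ∫⁻ y, (fun z : Vel d × Vel d => ENNReal.ofReal (Real.exp (Φ (x.1.1, z, collide z x.2)))
          * ENNReal.ofReal (reg τ (P x.1.1 : Measure (Vel d)) (collide z x.2).1
            * reg τ (P x.1.1 : Measure (Vel d)) (collide z x.2).2
            / (reg τ (P x.1.1 : Measure (Vel d)) z.1 * reg τ (P x.1.1 : Measure (Vel d)) z.2)))
          (x.1.2 + τ ^ 2 • y) ∂(gaussPair d) := by
  have hΦ : Measurable Φ := Φ.continuous.measurable
  have hcol : Measurable fun x : CollSpace d T × (Vel d × Vel d) =>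
      collide (x.1.1.2 + τ ^ 2 • x.2) (x.1.2 : Vel d) := (by fun_prop : Continuous _).measurable
  have hB : Measurable fun x : CollSpace d T => hardSphere (x.1.2.1 - x.1.2.2) (x.2 : Vel d) :=
    (by fun_prop : Continuous _).measurable
  have hr : ∀ w : CollSpace d T × (Vel d × Vel d) → Vel d, Measurable w →
      Measurable fun x => reg τ (P x.1.1.1 : Measure (Vel d)) (w x) := fun w hw =>
    (measurable_reg_path P hτ).comp ((by fun_prop : Measurable fun x :
      CollSpace d T × (Vel d × Vel d) => x.1.1.1).prodMk hw)
  refine hB.ennreal_ofReal.mul (Measurable.lintegral_prod_right' (ν := gaussPair d)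
    (f := fun x : CollSpace d T × (Vel d × Vel d) =>
      ENNReal.ofReal (Real.exp (Φ (x.1.1.1, x.1.1.2 + τ ^ 2 • x.2,
        collide (x.1.1.2 + τ ^ 2 • x.2) x.1.2)))
          * ENNReal.ofReal (reg τ (P x.1.1.1 : Measure (Vel d)) (collide (x.1.1.2 + τ ^ 2 • x.2) x.1.2).1
            * reg τ (P x.1.1.1 : Measure (Vel d)) (collide (x.1.1.2 + τ ^ 2 • x.2) x.1.2).2
            / (reg τ (P x.1.1.1 : Measure (Vel d)) (x.1.1.2 + τ ^ 2 • x.2).1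
              * reg τ (P x.1.1.1 : Measure (Vel d)) (x.1.1.2 + τ ^ 2 • x.2).2))) ?_)
  refine Measurable.mul (by fun_prop) (Measurable.ennreal_ofReal ?_)
  exact ((hr _ hcol.fst).mul (hr _ hcol.snd)).div
    ((hr _ (by fun_prop)).mul (hr _ (by fun_prop)))

/-- Jensen followed by the collision-ratio estimate for each fixed t and ω, integrated over both.
The constant is uniform because the energy bound holds at all times. -/
theorem exists_lintegral_exp_potGrad_le (hP : ∀ t, MeanZeroEnergyLE e (P t))
    (Φ : FluxSpace d T →ᵇ ℝ) :
    ∃ D : ℝ≥0∞, D ≠ ∞ ∧ ∀ τ, 0 < τ → τ ≤ 1 →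
      ∫⁻ x, ENNReal.ofReal (Real.exp (potGrad τ P (collFlux x) + collAvg τ Φ x)) ∂(fluxBase P)
        ≤ ENNReal.ofReal (exchangeAvg P Φ τ) + D * commErr d τ := by
  let W : ℝ := ∫ z : Vel d, (1 + ‖z‖) * weight z
  have hW : 0 ≤ W := integral_nonneg fun z => mul_nonneg (by positivity) (weight_pos z).le
  have hgm : 0 ≤ gaussMoment d := integral_nonneg fun y => norm_nonneg _
  let N : ℝ≥0∞ := ENNReal.ofReal (1 + (1 / 2 + e) + gaussMoment d + W)
  let C : ℝ≥0∞ := ENNReal.ofReal (Real.exp ‖Φ‖)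
  let σ : Measure (Metric.sphere (0 : Vel d) 1) := (volume : Measure (Vel d)).toSphere
  let D : ℝ≥0∞ := ENNReal.ofReal (1 / 2) * (C * N ^ 2 * timeMeasure T univ * σ univ)
  have hD : D ≠ ∞ := by
    refine ENNReal.mul_ne_top ENNReal.ofReal_ne_top (ENNReal.mul_ne_top (ENNReal.mul_ne_top
      (ENNReal.mul_ne_top ENNReal.ofReal_ne_top (ENNReal.pow_ne_top ENNReal.ofReal_ne_top)) ?_) ?_)
    · exact measure_ne_top _ _
    · exact measure_ne_top _ _
  refine ⟨D, hD, fun τ hτ hτ1 => ?_⟩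
  have hΦ : Measurable Φ := Φ.continuous.measurable
  have hN : ∀ t, ∫⁻ z, ENNReal.ofReal (1 + ‖z‖) * ENNReal.ofReal (reg τ (P t : Measure (Vel d)) z)
      ≤ N := fun t => by
    refine (lintegral_one_add_norm_reg_le (P t : Measure (Vel d)) hτ hτ1
      (integrable_norm_of_energy (hP t))).trans (ENNReal.ofReal_le_ofReal ?_)
    have := integral_norm_le_of_energy (hP t)
    gcongr
  have hNw : Nonempty (Time T) → ∫⁻ z : Vel d, ENNReal.ofReal (1 + ‖z‖) * ENNReal.ofReal (weight z) ≤ N := by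
    intro ⟨t⟩
    have he : 0 ≤ 1 / 2 + e := (integral_nonneg fun v => norm_nonneg _).trans
      (integral_norm_le_of_energy (hP t))
    simp_rw [← ENNReal.ofReal_mul (add_nonneg zero_le_one (norm_nonneg _))]
    rw [← ofReal_integral_eq_lintegral_ofReal integrable_one_add_norm_mul_weight
      (ae_of_all _ fun z => mul_nonneg (by positivity) (weight_pos z).le)]
    refine ENNReal.ofReal_le_ofReal ?_
    change W ≤ _
    linarith
  have hr := measurable_ratio_shift P hτ Φ
  let B : Vel d → Vel d × Vel d → ℝ≥0∞ := fun ω z => ENNReal.ofReal (hardSphere (z.1 - z.2) ω)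
  let F : Time T → Vel d → Vel d × Vel d → ℝ≥0∞ := fun t ω z =>
    ENNReal.ofReal (Real.exp (Φ (t, z, collide z ω)))
  let ρ : Time T → Vel d → Vel d × Vel d → ℝ≥0∞ := fun t ω z => F t ω z *
    ENNReal.ofReal (reg τ (P t : Measure (Vel d)) (collide z ω).1
            * reg τ (P t : Measure (Vel d)) (collide z ω).2
            / (reg τ (P t : Measure (Vel d)) z.1 * reg τ (P t : Measure (Vel d)) z.2))
  have hmain : Measurable fun x : CollSpace d T => ∫⁻ y, (fun z : Vel d × Vel d =>
      B x.2 z * F x.1.1 x.2 (collide z x.2)) (x.1.2 + τ ^ 2 • y) ∂(gaussPair d) := by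
    have hcont : Continuous fun p : CollSpace d T × (Vel d × Vel d) =>
        hardSphere ((p.1.1.2 + τ ^ 2 • p.2).1 - (p.1.1.2 + τ ^ 2 • p.2).2) (p.1.2 : Vel d) := by
      fun_prop
    have hcont' : Continuous fun p : CollSpace d T × (Vel d × Vel d) =>
        Real.exp (Φ (p.1.1.1, collide (p.1.1.2 + τ ^ 2 • p.2) p.1.2,
          collide (collide (p.1.1.2 + τ ^ 2 • p.2) p.1.2) p.1.2)) := by
      have := Φ.continuous
      fun_prop
    exact Measurable.lintegral_prod_right' (ν := gaussPair d)
      (f := fun p : CollSpace d T × (Vel d × Vel d) =>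
        B p.1.2 (p.1.1.2 + τ ^ 2 • p.2) * F p.1.1.1 p.1.2 (collide (p.1.1.2 + τ ^ 2 • p.2) p.1.2))
      (hcont.measurable.ennreal_ofReal.mul hcont'.measurable.ennreal_ofReal)
  calc ∫⁻ x, ENNReal.ofReal (Real.exp (potGrad τ P (collFlux x) + collAvg τ Φ x)) ∂(fluxBase P)
      = ∫⁻ x, ENNReal.ofReal (collRate x) * ENNReal.ofReal (Real.exp
          (potGrad τ P (collFlux x) + collAvg τ Φ x)) ∂(collMeasure P) :=
        lintegral_fluxBase P ((((measurable_potGrad P hτ).comp measurable_collFlux).add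
          (measurable_collAvg Φ τ)).exp.ennreal_ofReal)
    _ ≤ ∫⁻ x, ENNReal.ofReal (1 / 2) * (B x.2 x.1.2
          * ∫⁻ y, ρ x.1.1 x.2 (x.1.2 + τ ^ 2 • y) ∂(gaussPair d)) ∂(collMeasure P) := by
        refine lintegral_mono fun x => ?_
        rw [← mul_assoc, collRate, ENNReal.ofReal_mul (by norm_num)]
        exact mul_le_mul_right (ofReal_exp_potGrad_add_le hτ Φ x) _
    _ = ENNReal.ofReal (1 / 2) * ∫⁻ ω, ∫⁻ t, ∫⁻ x, B (ω : Vel d) x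
          * ∫⁻ y, ρ t ω (x + τ ^ 2 • y) ∂(gaussPair d)
          ∂((P t : Measure (Vel d)).prod (P t : Measure (Vel d))) ∂(timeMeasure T) ∂σ := by
        rw [lintegral_const_mul _ hr, lintegral_collMeasure P hr]
    _ ≤ ENNReal.ofReal (1 / 2) * ∫⁻ ω, ∫⁻ t, (∫⁻ x, ∫⁻ y, (fun z : Vel d × Vel d =>
            B (ω : Vel d) z * F t ω (collide z ω)) (x + τ ^ 2 • y) ∂(gaussPair d)
            ∂((P t : Measure (Vel d)).prod (P t : Measure (Vel d)))
          + C * N ^ 2 * commErr d τ) ∂(timeMeasure T) ∂σ := by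
        refine mul_le_mul_right (lintegral_mono fun ω => lintegral_mono fun t => ?_) _
        have hF : Measurable (F t ω) := by
          have : Continuous fun z : Vel d × Vel d => Real.exp (Φ (t, z, collide z ω)) := by
            have := Φ.continuous
            fun_prop
          exact this.measurable.ennreal_ofReal
        exact lintegral_collision_ratio_le (P t : Measure (Vel d)) hτ hτ1 (norm_sphere ω) hF
          (fun z => ENNReal.ofReal_le_ofReal (exp_apply_le Φ _)) (hN t) (hNw ⟨t⟩)
    _ = ENNReal.ofReal (1 / 2) * (∫⁻ x, ∫⁻ y, (fun z : Vel d × Vel d =>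
            B x.2 z * F x.1.1 x.2 (collide z x.2)) (x.1.2 + τ ^ 2 • y) ∂(gaussPair d)
            ∂(collMeasure P))
          + D * commErr d τ := by
        simp_rw [lintegral_add_right _ measurable_const, lintegral_const]
        rw [lintegral_collMeasure P hmain, mul_add]
        congr 1
        simp only [D]; ring
    -- Since the collision is an involution, F at the collided pair is exp Φ with incoming and
    -- outgoing velocities interchanged; the exchange map enters here.
    _ = _ := by
        congr 1
        rw [exchangeAvg, ofReal_integral_eq_lintegral_ofReal
          (integrable_rate_mul_exp_shift hP Φ hτ hτ1) (ae_of_all _ fun p => rate_mul_exp_nonneg Φ _),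
          lintegral_prod _ (measurable_rate_mul_exp_shift Φ τ).ennreal_ofReal.aemeasurable,
          ← lintegral_const_mul _ hmain]
        refine lintegral_congr fun x => ?_
        rw [← lintegral_const_mul' _ _ ENNReal.ofReal_ne_top]
        refine lintegral_congr fun y => ?_
        simp only [B, F, collRate, collShift, exchange, collFlux]
        rw [collide_collide _ (norm_sphere x.2), ENNReal.ofReal_mul (mul_nonneg (by norm_num)
          (hardSphere_nonneg _ _)), ENNReal.ofReal_mul (by norm_num), mul_assoc]

/-- The exponential moments of the mollified logarithmic collision ratio are asymptotically
controlled by the exchanged collision measure. -/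
theorem exists_integral_exp_potGrad_le (hP : ∀ t, MeanZeroEnergyLE e (P t))
    (Φ : FluxSpace d T →ᵇ ℝ) :
    ∃ A : ℝ → ℝ, Tendsto A (𝓝[>] 0) (𝓝 (∫ x, Real.exp (Φ x) ∂((fluxPP P).map exchange))) ∧
      ∀ τ, 0 < τ → τ ≤ 1 →
        Integrable (fun x => Real.exp (potGrad τ P (collFlux x) + collAvg τ Φ x)) (fluxBase P) ∧
        ∫ x, Real.exp (potGrad τ P (collFlux x) + collAvg τ Φ x) ∂(fluxBase P) ≤ A τ := by
  obtain ⟨D, hD, h⟩ := exists_lintegral_exp_potGrad_le hP Φ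
  let err : ℝ → ℝ := fun τ => D.toReal * (2 * ((d + 3).factorial * τ + τ ^ 2))
  refine ⟨fun τ => exchangeAvg P Φ τ + err τ, ?_, fun τ hτ hτ1 => ?_⟩
  · have he : Tendsto err (𝓝[>] 0) (𝓝 0) := by
      have hc : Continuous err := by fun_prop
      have := hc.tendsto 0
      simp only [err] at this
      simpa using this.mono_left nhdsWithin_le_nhds
    simpa using (tendsto_exchangeAvg hP Φ).add he
  have hm : Measurable fun x => Real.exp (potGrad τ P (collFlux x) + collAvg τ Φ x) :=
    (((measurable_potGrad P hτ).comp measurable_collFlux).add (measurable_collAvg Φ τ)).exp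
  have hb : ∫⁻ x, ENNReal.ofReal (Real.exp (potGrad τ P (collFlux x) + collAvg τ Φ x)) ∂(fluxBase P)
      ≤ ENNReal.ofReal (exchangeAvg P Φ τ + err τ) := by
    have hM : 0 ≤ exchangeAvg P Φ τ := integral_nonneg fun p => rate_mul_exp_nonneg Φ _
    refine (h τ hτ hτ1).trans_eq ?_
    rw [ENNReal.ofReal_add hM (by positivity), ENNReal.ofReal_mul ENNReal.toReal_nonneg,
      ENNReal.ofReal_toReal hD, ENNReal.ofReal_mul zero_le_two, ENNReal.ofReal_add (by positivity)
        (by positivity), commErr]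
    simp
  have hi : Integrable (fun x => Real.exp (potGrad τ P (collFlux x) + collAvg τ Φ x)) (fluxBase P) :=
    ⟨hm.aestronglyMeasurable, by
      rw [hasFiniteIntegral_iff_ofReal (ae_of_all _ fun x => (Real.exp_pos _).le)]
      exact hb.trans_lt ENNReal.ofReal_lt_top⟩
  refine ⟨hi, ?_⟩
  rw [← ofReal_integral_eq_lintegral_ofReal hi (ae_of_all _ fun x => (Real.exp_pos _).le)] at hb
  refine (ENNReal.ofReal_le_ofReal_iff ?_).1 hb
  have hM : 0 ≤ exchangeAvg P Φ τ := integral_nonneg fun p => rate_mul_exp_nonneg Φ _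
  positivity

end ExponentialBound

/-! ### The two entropy inequalities in the limit of vanishing regularization -/

section EntropyInequalities

variable {d : ℕ} {T : ℝ} {P : ProbPath d T} {e : ℝ}

/-- The supremum over Φ of the left sides is the entropy, so finiteness comes out together with the
bound. -/
theorem weightEntropy_le_of_forall {π : Measure (Vel d)} [IsProbabilityMeasure π] {c : ℝ}
    (h : ∀ Φ : Vel d →ᵇ ℝ, ∫ v, Φ v ∂π + ∫ v, Real.log (weight v) ∂π + 1
      - ∫ v, Real.exp (Φ v) ∂(weightMeasure d) ≤ c) :
    klDiv π (weightMeasure d) ≠ ∞ ∧ weightEntropy π ≤ c := by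
  let c' := c - (∫ v, Real.log (weight v) ∂π + 1 - ∫ z : Vel d, weight z)
  have h' : ∀ Φ : Vel d →ᵇ ℝ, ∫ v, Φ v ∂π - ∫ v, Real.exp (Φ v) ∂(weightMeasure d)
      + (weightMeasure d).real univ ≤ c' := fun Φ => by
    have := h Φ
    rw [weightMeasure_real_univ]
    simp only [c']
    linarith
  have hkl := klDiv_le_of_forall_boundedContinuous h'
  have hc : 0 ≤ c' := by simpa using h' 0
  refine ⟨ne_top_of_le_ne_top ENNReal.ofReal_ne_top hkl, ?_⟩
  have := ENNReal.toReal_le_of_le_ofReal hc hkl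
  simp only [c'] at this
  rw [weightEntropy]
  linarith

theorem fluxIntegrable_log {Q : Measure (FluxSpace d T)}
    (hQ : FluxIntegrable Q fun v => 1 + ‖v‖) : FluxIntegrable Q fun v => Real.log (1 + ‖v‖) := by
  have key : ∀ w : FluxSpace d T → Vel d, Measurable w → Integrable (fun x => 1 + ‖w x‖) Q →
      Integrable (fun x => Real.log (1 + ‖w x‖)) Q := fun w hw hi => by
    refine hi.mono' (by fun_prop : Measurable _).aestronglyMeasurable (ae_of_all _ fun x => ?_)
    rw [Real.norm_of_nonneg (log_one_add_norm_nonneg _)]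
    exact (log_one_add_norm_le _).trans (by linarith)
  exact ⟨key _ (by fun_prop) hQ.1, key _ (by fun_prop) hQ.2.1, key _ (by fun_prop) hQ.2.2.1,
    key _ (by fun_prop) hQ.2.2.2⟩

/-- Logarithmic moments are inherited under finite relative entropy. -/
theorem fluxIntegrable_log_of_klDiv {Q R : Measure (FluxSpace d T)} [IsFiniteMeasure Q]
    [IsFiniteMeasure R] (hkl : klDiv Q R ≠ ∞) (hR : FluxIntegrable R fun v => 1 + ‖v‖) :
    FluxIntegrable Q fun v => Real.log (1 + ‖v‖) := by
  have key : ∀ w : FluxSpace d T → Vel d, Measurable w → Integrable (fun x => 1 + ‖w x‖) R →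
      Integrable (fun x => Real.log (1 + ‖w x‖)) Q := fun w hw hi => by
    refine integrable_of_integrable_exp hkl (by fun_prop) (fun x => log_one_add_norm_nonneg _) ?_
    refine hi.congr (ae_of_all _ fun x => ?_)
    exact (Real.exp_log (by positivity)).symm
  exact ⟨key _ (by fun_prop) hR.1, key _ (by fun_prop) hR.2.1, key _ (by fun_prop) hR.2.2.1,
    key _ (by fun_prop) hR.2.2.2⟩

theorem potGrad_exchange (τ : ℝ) (x : FluxSpace d T) :
    potGrad τ P (exchange x) = -potGrad τ P x := by
  simp only [potGrad, velGrad, exchange]; ring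

theorem map_exchange_real_univ (R : Measure (FluxSpace d T)) :
    (R.map exchange).real univ = R.real univ := by
  rw [measureReal_def, Measure.map_apply measurable_exchange MeasurableSet.univ, preimage_univ,
    measureReal_def]

theorem tendsto_sq_mul_nhdsGT (K : ℝ) :
    Tendsto (fun τ : ℝ => τ ^ 2 * (1 + (1 + τ ^ 2) * K)) (𝓝[>] 0) (𝓝 0) := by
  have h : Continuous fun τ : ℝ => τ ^ 2 * (1 + (1 + τ ^ 2) * K) := by fun_prop
  have := h.tendsto 0
  simp only [ne_eq, OfNat.ofNat_ne_zero, not_false_eq_true, zero_pow, zero_mul] at this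
  exact this.mono_left nhdsWithin_le_nhds

/-- Entropy production is bounded by the relative entropy with respect to the exchanged flux. -/
theorem weightEntropy_le_add_klDiv (hT : 0 < T) (hP : ∀ t, MeanZeroEnergyLE e (P t))
    {Q : FiniteMeasure (FluxSpace d T)} (hB : Balance hT.le P Q)
    (hQ : klDiv (Q : Measure (FluxSpace d T)) ((fluxPP P).map exchange) ≠ ∞)
    (hPT : klDiv (P (t1 hT.le) : Measure (Vel d)) (weightMeasure d) ≠ ∞) :
    weightEntropy (P (t0 hT.le) : Measure (Vel d))
      ≤ weightEntropy (P (t1 hT.le) : Measure (Vel d))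
        + (klDiv (Q : Measure (FluxSpace d T)) ((fluxPP P).map exchange)).toReal := by
  have := isFiniteMeasure_fluxPP hP
  have := isFiniteMeasure_fluxBase hP
  have hn := fun t => integrable_norm_of_energy (hP t)
  have hlog := fluxIntegrable_log_of_klDiv hQ ((fluxIntegrable_fluxPP hP).exchange (by fun_prop))
  have hQ0 : (Q : Measure (FluxSpace d T)) {x | x.1 = t0 hT.le} = 0 := by
    refine (klDiv_ne_top_iff.1 hQ).1 ?_
    have hs : MeasurableSet {x : FluxSpace d T | x.1 = t0 hT.le} :=
      measurable_fst (measurableSet_singleton _)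
    rw [Measure.map_apply measurable_exchange hs]
    exact fluxPP_time_eq _
  -- With Φ = 0 the limit of A is the mass of the exchanged flux, which cancels the mass term in the
  -- Gibbs inequality.
  obtain ⟨A, hA, hAle⟩ := exists_integral_exp_potGrad_le hP 0
  have hA' : Tendsto A (𝓝[>] 0) (𝓝 (((fluxPP P).map exchange).real univ)) := by
    simpa using hA
  refine (weightEntropy_le_of_forall fun Φ => ?_).2
  obtain ⟨L, hLle, hL⟩ := exists_le_regEntropy (hn (t0 hT.le)) Φ
  let kl := (klDiv (Q : Measure (FluxSpace d T)) ((fluxPP P).map exchange)).toReal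
  let K := ∫ z : Vel d, weight z
  let w := weightEntropy (P (t1 hT.le) : Measure (Vel d))
  have hlim : Tendsto (fun τ => w + τ ^ 2 * (1 + (1 + τ ^ 2) * K)
      + (kl + A τ - ((fluxPP P).map exchange).real univ)) (𝓝[>] 0)
      (𝓝 (w + 0 + (kl + ((fluxPP P).map exchange).real univ
        - ((fluxPP P).map exchange).real univ))) :=
    (tendsto_const_nhds.add (tendsto_sq_mul_nhdsGT K)).add
      ((tendsto_const_nhds.add hA').sub tendsto_const_nhds)
  rw [add_zero, add_sub_cancel_right] at hlim
  refine le_of_tendsto_of_tendsto hL hlim ?_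
  filter_upwards [Ioc_mem_nhdsGT one_pos] with τ hτ
  have hchain := regEntropy_sub_eq hT hτ.1 hB hn hlog hQ0
  have hupper := regEntropy_le hτ.1 (hn (t1 hT.le)) hPT
  have hlower := hLle τ hτ.1
  obtain ⟨hi, hle⟩ := hAle τ hτ.1 hτ.2
  have hz : ∀ x, collAvg τ (0 : FluxSpace d T →ᵇ ℝ) x = 0 := fun x => by simp [collAvg]
  simp_rw [hz, add_zero] at hi hle
  have hm := measurable_potGrad P hτ.1
  have hmE : Measurable fun x => Real.exp (-potGrad τ P x) := hm.neg.exp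
  have hcomp : (fun x => Real.exp (-potGrad τ P x)) ∘ (exchange ∘ collFlux)
      = fun x => Real.exp (potGrad τ P (collFlux x)) := by
    funext x
    simp [potGrad_exchange]
  have hi' : Integrable (fun x => Real.exp (-potGrad τ P x)) ((fluxPP P).map exchange) := by
    rw [fluxPP_eq_map, Measure.map_map measurable_exchange measurable_collFlux,
      integrable_map_measure hmE.aestronglyMeasurable
        (measurable_exchange.comp measurable_collFlux).aemeasurable, hcomp]
    exact hi
  have hval : ∫ x, Real.exp (-potGrad τ P x) ∂((fluxPP P).map exchange)
      = ∫ x, Real.exp (potGrad τ P (collFlux x)) ∂(fluxBase P) := by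
    rw [fluxPP_eq_map, Measure.map_map measurable_exchange measurable_collFlux,
      integral_map (measurable_exchange.comp measurable_collFlux).aemeasurable
        hmE.aestronglyMeasurable]
    exact integral_congr_ae (ae_of_all _ fun x => congrFun hcomp x)
  -- The gradient is odd under `exchange`, so this exponential moment against the exchanged flux is
  -- that of +∇̄ against the original one, which is under control.
  have hdv := integral_le_toReal_klDiv_add hQ (f := fun x => -potGrad τ P x)
    (integrable_potGrad P hτ.1 hlog).neg hi'
  rw [integral_neg, hval] at hdv
  simp only [w, kl, K]
  linarith

/-- The entropy dissipation inequality for measure-flux solutions. -/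
theorem weightEntropy_add_klDiv_le (hT : 0 < T) (hP : ∀ t, MeanZeroEnergyLE e (P t))
    {Q : FiniteMeasure (FluxSpace d T)} (hB : Balance hT.le P Q)
    (hQ : (Q : Measure (FluxSpace d T)) = fluxPP P)
    (hP0 : klDiv (P (t0 hT.le) : Measure (Vel d)) (weightMeasure d) ≠ ∞) :
    klDiv (P (t1 hT.le) : Measure (Vel d)) (weightMeasure d) ≠ ∞ ∧
    klDiv (fluxPP P) ((fluxPP P).map exchange) ≠ ∞ ∧
    weightEntropy (P (t1 hT.le) : Measure (Vel d))
        + (klDiv (fluxPP P) ((fluxPP P).map exchange)).toReal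
      ≤ weightEntropy (P (t0 hT.le) : Measure (Vel d)) := by
  have := isFiniteMeasure_fluxPP hP
  have := isFiniteMeasure_fluxBase hP
  have hn := fun t => integrable_norm_of_energy (hP t)
  have hlogR := fluxIntegrable_log (fluxIntegrable_fluxPP hP)
  have hlog : FluxIntegrable (Q : Measure (FluxSpace d T)) fun v => Real.log (1 + ‖v‖) := hQ ▸ hlogR
  have hQ0 : (Q : Measure (FluxSpace d T)) {x | x.1 = t0 hT.le} = 0 := by
    rw [hQ]; exact fluxPP_time_eq _
  have hreal : (fluxBase P).real univ = (fluxPP P).real univ := by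
    rw [fluxPP_eq_map, measureReal_def, measureReal_def,
      Measure.map_apply measurable_collFlux MeasurableSet.univ, preimage_univ]
  let w := weightEntropy (P (t0 hT.le) : Measure (Vel d))
  have key : ∀ Φ : FluxSpace d T →ᵇ ℝ,
      klDiv (P (t1 hT.le) : Measure (Vel d)) (weightMeasure d) ≠ ∞ ∧
      weightEntropy (P (t1 hT.le) : Measure (Vel d))
        ≤ w + (∫ x, Real.exp (Φ x) ∂((fluxPP P).map exchange) - (fluxPP P).real univ
          - ∫ x, Φ x ∂(fluxPP P)) := by
    intro Φ
    obtain ⟨A, hA, hAle⟩ := exists_integral_exp_potGrad_le hP Φ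
    refine weightEntropy_le_of_forall fun Ψ => ?_
    obtain ⟨L, hLle, hL⟩ := exists_le_regEntropy (hn (t1 hT.le)) Ψ
    let K := ∫ z : Vel d, weight z
    have hlim : Tendsto (fun τ => w + τ ^ 2 * (1 + (1 + τ ^ 2) * K)
        + (A τ - (fluxPP P).real univ - ∫ x, collAvg τ Φ x ∂(fluxBase P))) (𝓝[>] 0)
        (𝓝 (w + 0 + (∫ x, Real.exp (Φ x) ∂((fluxPP P).map exchange) - (fluxPP P).real univ
          - ∫ x, Φ x ∂(fluxPP P)))) :=
      (tendsto_const_nhds.add (tendsto_sq_mul_nhdsGT K)).add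
        ((hA.sub tendsto_const_nhds).sub (tendsto_integral_collAvg hP Φ))
    rw [add_zero] at hlim
    refine le_of_tendsto_of_tendsto hL hlim ?_
    filter_upwards [Ioc_mem_nhdsGT one_pos] with τ hτ
    have hchain := regEntropy_sub_eq hT hτ.1 hB hn hlog hQ0
    have hupper := regEntropy_le hτ.1 (hn (t0 hT.le)) hP0
    have hlower := hLle τ hτ.1
    obtain ⟨hi, hle⟩ := hAle τ hτ.1 hτ.2
    have hm := measurable_potGrad P hτ.1
    have hg : Integrable (fun x => potGrad τ P (collFlux x)) (fluxBase P) := by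
      have := integrable_potGrad P hτ.1 hlogR
      rw [fluxPP_eq_map, integrable_map_measure hm.aestronglyMeasurable
        measurable_collFlux.aemeasurable] at this
      exact this
    have ha : Integrable (collAvg τ Φ) (fluxBase P) :=
      Integrable.of_bound (measurable_collAvg Φ τ).aestronglyMeasurable ‖Φ‖
        (ae_of_all _ fun x => abs_collAvg_le Φ τ x)
    have hint : ∫ x, potGrad τ P x ∂(Q : Measure (FluxSpace d T))
        ≤ A τ - (fluxPP P).real univ - ∫ x, collAvg τ Φ x ∂(fluxBase P) := by
      rw [hQ, fluxPP_eq_map, integral_map measurable_collFlux.aemeasurable hm.aestronglyMeasurable,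
        ← fluxPP_eq_map, ← hreal]
      -- Pointwise a ≤ exp(a + Φ) - 1 - Φ. The free Φ is kept so that its optimization produces the
      -- relative entropy of the flux with respect to the exchanged flux.
      calc ∫ x, potGrad τ P (collFlux x) ∂(fluxBase P)
          ≤ ∫ x, (Real.exp (potGrad τ P (collFlux x) + collAvg τ Φ x) - 1 - collAvg τ Φ x)
            ∂(fluxBase P) := by
            refine integral_mono hg ((hi.sub (integrable_const _)).sub ha) fun x => ?_
            have := Real.add_one_le_exp (potGrad τ P (collFlux x) + collAvg τ Φ x)
            simp only
            linarith
        _ = ∫ x, Real.exp (potGrad τ P (collFlux x) + collAvg τ Φ x) ∂(fluxBase P)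
            - (fluxBase P).real univ - ∫ x, collAvg τ Φ x ∂(fluxBase P) := by
            rw [integral_sub (f := fun x => Real.exp (potGrad τ P (collFlux x) + collAvg τ Φ x) - 1)
              (hi.sub (integrable_const _)) ha, integral_sub hi (integrable_const _)]
            simp
        _ ≤ _ := by linarith
    simp only [w, K]
    linarith
  -- The entropy drop bounds every Gibbs functional of the pair of fluxes (the two have equal mass),
  -- hence also their relative entropy.
  let c := w - weightEntropy (P (t1 hT.le) : Measure (Vel d))
  have hbd : ∀ Φ : FluxSpace d T →ᵇ ℝ, ∫ x, Φ x ∂(fluxPP P)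
      - ∫ x, Real.exp (Φ x) ∂((fluxPP P).map exchange)
      + ((fluxPP P).map exchange).real univ ≤ c := fun Φ => by
    have := (key Φ).2
    rw [map_exchange_real_univ]
    simp only [c]
    linarith
  have hkl := klDiv_le_of_forall_boundedContinuous hbd
  have hc : 0 ≤ c := by simpa using hbd 0
  refine ⟨(key 0).1, ne_top_of_le_ne_top ENNReal.ofReal_ne_top hkl, ?_⟩
  have := ENNReal.toReal_le_of_le_ofReal hc hkl
  simp only [c, w] at this
  linarith

theorem entropyH_eq_coe {π : ProbabilityMeasure (Vel d)} (h : MeanZeroEnergyLE e π)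
    (hkl : klDiv (π : Measure (Vel d)) (weightMeasure d) ≠ ∞) :
    entropyH π = ((weightEntropy (π : Measure (Vel d)) : ℝ) : EReal) := by
  rw [entropyH_eq π (integrable_norm_of_energy h), weightEntropy, EReal.coe_add,
    EReal.coe_ennreal_toReal hkl]

theorem entropyH_eq_top_iff {π : ProbabilityMeasure (Vel d)} (h : MeanZeroEnergyLE e π) :
    entropyH π = ⊤ ↔ klDiv (π : Measure (Vel d)) (weightMeasure d) = ∞ := by
  refine ⟨fun ht => ?_, fun hkl => ?_⟩
  · by_contra hkl
    rw [entropyH_eq_coe h hkl] at ht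
    exact EReal.coe_ne_top _ ht
  · rw [entropyH_eq π (integrable_norm_of_energy h), hkl]
    exact EReal.top_add_coe _

end EntropyInequalities

/-! ### The functional in extended reals -/

section Functional

variable {d : ℕ} {e : ℝ} {X Y : Type*} [MeasurableSpace X] [MeasurableSpace Y]

/-- The energy bound excludes the value -∞ for the entropy, so no ∞ - ∞ can occur. -/
theorem entropyH_add_relE_eq_top {π : ProbabilityMeasure (Vel d)} (h : MeanZeroEnergyLE e π)
    {V W : Measure X} {V' W' : Measure Y}
    (ht : klDiv (π : Measure (Vel d)) (weightMeasure d) = ∞ ∨ klDiv V W = ∞ ∨ klDiv V' W' = ∞) :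
    entropyH π + relE V W + relE V' W' = ⊤ := by
  have hne : entropyH π ≠ ⊥ := by
    by_cases hk : klDiv (π : Measure (Vel d)) (weightMeasure d) = ∞
    · rw [(entropyH_eq_top_iff h).2 hk]; exact top_ne_bot
    · rw [entropyH_eq_coe h hk]; exact EReal.coe_ne_bot _
  rw [add_assoc, relE, relE, ← EReal.coe_ennreal_add]
  rcases ht with ht | ht
  · rw [(entropyH_eq_top_iff h).2 ht]
    exact EReal.top_add_of_ne_bot (EReal.coe_ennreal_ne_bot _)
  · rw [ENNReal.add_eq_top.2 ht]
    exact EReal.add_top_of_ne_bot hne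

theorem entropyH_add_relE_eq_coe {π : ProbabilityMeasure (Vel d)} (h : MeanZeroEnergyLE e π)
    {V W : Measure X} {V' W' : Measure Y}
    (hπ : klDiv (π : Measure (Vel d)) (weightMeasure d) ≠ ∞) (hV : klDiv V W ≠ ∞)
    (hV' : klDiv V' W' ≠ ∞) :
    entropyH π + relE V W + relE V' W'
      = ((weightEntropy (π : Measure (Vel d)) + (klDiv V W).toReal + (klDiv V' W').toReal : ℝ)
        : EReal) := by
  rw [entropyH_eq_coe h hπ, EReal.coe_add, EReal.coe_add, EReal.coe_ennreal_toReal hV,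
    EReal.coe_ennreal_toReal hV', relE, relE]

end Functional

end HBE

/-! ### The entropy inequality and its equality case -/

theorem proposition2p1 (d : ℕ) (hd : 2 ≤ d) (T : ℝ) (hT : 0 < T) (e : ℝ) (he : 0 < e)
    (P : HBE.ProbPath d T) (Q : MeasureTheory.FiniteMeasure (HBE.FluxSpace d T))
    (hPQ : HBE.MeasureFluxLE hT.le e P Q)
    (hH : HBE.entropyH (P (HBE.t0 hT.le)) < ⊤) :
    HBE.entropyH (P (HBE.t0 hT.le)) ≤
      HBE.entropyH (P (HBE.t1 hT.le))
        + HBE.relE (Q : MeasureTheory.Measure (HBE.FluxSpace d T)) (HBE.fluxPP P)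
        + HBE.relE (Q : MeasureTheory.Measure (HBE.FluxSpace d T))
            ((HBE.fluxPP P).map HBE.exchange) ∧
    (HBE.entropyH (P (HBE.t1 hT.le))
        + HBE.relE (Q : MeasureTheory.Measure (HBE.FluxSpace d T)) (HBE.fluxPP P)
        + HBE.relE (Q : MeasureTheory.Measure (HBE.FluxSpace d T))
            ((HBE.fluxPP P).map HBE.exchange)
        = HBE.entropyH (P (HBE.t0 hT.le)) ↔
      (Q : MeasureTheory.Measure (HBE.FluxSpace d T)) = HBE.fluxPP P) ∧
    ((Q : MeasureTheory.Measure (HBE.FluxSpace d T)) = HBE.fluxPP P ↔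
      HBE.IsMeasureFluxSolution hT.le P Q) := by
  open InformationTheory HBE in
  have hP := hPQ.2
  have hB := hPQ.1.2
  have := isFiniteMeasure_fluxPP hP
  have hP0 : klDiv (P (t0 hT.le) : Measure (Vel d)) (weightMeasure d) ≠ ∞ := fun h =>
    hH.ne ((entropyH_eq_top_iff (hP _)).2 h)
  rw [entropyH_eq_coe (hP (t0 hT.le)) hP0]
  refine ⟨?_, ⟨fun heq => ?_, fun hQ => ?_⟩, fun hQ => ⟨hPQ.1, hQ⟩, fun hQ => hQ.2⟩
  · by_cases ht : klDiv (P (t1 hT.le) : Measure (Vel d)) (weightMeasure d) = ∞ ∨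
        klDiv (Q : Measure (FluxSpace d T)) (fluxPP P) = ∞ ∨
        klDiv (Q : Measure (FluxSpace d T)) ((fluxPP P).map exchange) = ∞
    · rw [entropyH_add_relE_eq_top (hP _) ht]; exact le_top
    · push Not at ht
      rw [entropyH_add_relE_eq_coe (hP _) ht.1 ht.2.1 ht.2.2]
      have h := weightEntropy_le_add_klDiv hT hP hB ht.2.2 ht.1
      have h' := ENNReal.toReal_nonneg (a := klDiv (Q : Measure (FluxSpace d T)) (fluxPP P))
      exact EReal.coe_le_coe_iff.2 (by linarith)
  · by_cases ht : klDiv (P (t1 hT.le) : Measure (Vel d)) (weightMeasure d) = ∞ ∨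
        klDiv (Q : Measure (FluxSpace d T)) (fluxPP P) = ∞ ∨
        klDiv (Q : Measure (FluxSpace d T)) ((fluxPP P).map exchange) = ∞
    · rw [entropyH_add_relE_eq_top (hP _) ht] at heq
      exact absurd heq.symm (EReal.coe_ne_top _)
    · push Not at ht
      rw [entropyH_add_relE_eq_coe (hP _) ht.1 ht.2.1 ht.2.2, EReal.coe_eq_coe_iff] at heq
      have h := weightEntropy_le_add_klDiv hT hP hB ht.2.2 ht.1
      have h' := ENNReal.toReal_nonneg (a := klDiv (Q : Measure (FluxSpace d T)) (fluxPP P))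
      -- The initial entropy is already at most the final one plus the divergence from the exchanged
      -- flux, so equality leaves no room for this term.
      have h0 : (klDiv (Q : Measure (FluxSpace d T)) (fluxPP P)).toReal = 0 := by linarith
      exact klDiv_eq_zero_iff.1 (((ENNReal.toReal_eq_zero_iff _).1 h0).resolve_right ht.2.1)
  · obtain ⟨hPT, hkl, hle⟩ := weightEntropy_add_klDiv_le hT hP hB hQ hP0
    have hkl' : klDiv (Q : Measure (FluxSpace d T)) ((fluxPP P).map exchange) ≠ ∞ := by
      rwa [hQ]
    have hself : klDiv (Q : Measure (FluxSpace d T)) (fluxPP P) = 0 := klDiv_eq_zero_iff.2 hQ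
    rw [entropyH_add_relE_eq_coe (hP _) hPT (by rw [hself]; exact ENNReal.zero_ne_top) hkl',
      EReal.coe_eq_coe_iff]
    -- For the Boltzmann flux this general lower bound and the dissipation inequality are opposite
    -- to each other, hence equality.
    have h := weightEntropy_le_add_klDiv hT hP hB hkl' hPT
    rw [hself, hQ, ENNReal.toReal_zero, add_zero]
    rw [hQ] at h
    exact le_antisymm hle h
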